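/- Let $R$ be an irreducible root system of simply-laced type with simple roots indexed by the vertices $\mathrm{Vert}$ of its Dynkin diagram, and let $\mathsf v$ be a vertex. Label the vertices by $\{1,\dots,l\}\sqcup\{\underline2,\dots,\underline{l'}\}\sqcup\{\underline{\underline{k+1}},\dots,\underline{\underline{l''}}\}$ so that $\mathsf v=1$ and the paths $(1,\dots,l)$, $(1,\underline2,\dots,\underline{l'})$, $(1,\dots,k,\underline{\underline{k+1}},\dots,\underline{\underline{l''}})$ lead from $\mathsf v$ to the extremities ($k$ is the trivalent vertex; $l''=k=l$ in type $A$; $l'=1$ if $\mathsf v$ is an extremity). For a vertex $i$ let $i-1$ be the preceding label on the path from $1$ to $i$, with $1-1:=0$. Let $L=\mathbb Z\varepsilon\oplus Q_R$ with $\alpha_1^\vee(\varepsilon)=-1$, $\alpha_i^\vee(\varepsilon)=0$ for $i\ne1$; it has the basis $\delta_0=\varepsilon$, $\delta_i=\delta_{i-1}+\alpha_i$. Let $\omega$ be the fundamental weight of $\mathsf v$, write $n_0\omega=\sum_i n_i\alpha_i$ with $n_i\in\mathbb Z$ and $n_0>0$ minimal, and put $\kappa_j=n_j-\sum_{i:\,i-1=j}n_i$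 for $j\in\mathrm{Vert}\cup\{0\}$. For a root datum with lattice $T\supseteq Q_R$, the affine Hecke algebra has generators $g_i$ and $X^x$ ($x\in T$), with $X^0=1$, $X^xX^y=X^{x+y}$, $g_i^2=(q-q^{-1})g_i+1$, the braid relations, and $g_iX^x-X^{r_i(x)}g_i=(q-q^{-1})\frac{X^x-X^{r_i(x)}}{1-X^{-\alpha_i}}$. All algebras and representations are taken over $\mathbb C(q)$. Its calibrated spectrum is the set of characters $\chi:T\to\mathbb C(q)^\times$ for which there are a finite-dimensional representation on which every $X^x$ is diagonalizable and a non-zero vector $u$ in it with $X^xu=\chi(x)u$ for all $x\in T$. Let $H(R,\mathsf v)$ be the algebra with $T=L$, put $X_j=X^{\delta_j}$ and $C=X^{n_0\varepsilon+\sum n_i\alpha_i}$, and let $\overline H(R,\mathsf v)$ be the algebra with $T=Q_R+\mathbb Z\omega$. Let $\phi:L\to Q_R+\mathbb Z\omega$, $\varepsilon\mapsto-\omega$, $\alpha_i\mapsto\alpha_i$, and let $\pi:H(R,\mathsf v)\to\overline H(R,\mathsf v)$ be the morphism $g_i\mapsto g_i$, $X^x\mapsto X^{\phi(x)}$. A sequence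 is a family $S=(s_j)_{j\in\mathrm{Vert}\cup\{0\}}$ in $\mathbb C(q)^\times$. It is identified with the character $\chi_S$ of $L$ with $\chi_S(\delta_j)=s_j$, and the Weyl group acts by $\chi_{w(S)}(x)=\chi_S(w^{-1}x)$. Put $\Delta(S)=\prod_js_j^{\kappa_j}$. The truncated operator is $\overline r_i(S)=\mathbf 0$ if $s_i=q^{\pm2}s_{i-1}$ and $\overline r_i(S)=r_i(S)$ otherwise; the truncated orbit of $S$ is the set of all sequences obtained from $S$ by repeated application of truncated operators. A placed skew diagram is a finite set of pairs $(\Gamma_a,\gamma_a)$ of non-empty skew diagrams $\Gamma_a$ and elements $\gamma_a\in\mathbb C(q)^\times$ with $\gamma_a\notin q^{2\mathbb Z}\gamma_b$ for $a\ne b$. A standard tableau of size $N$ is a numbering by $0,\dots,N-1$ of the $N$ nodes of a placed skew diagram that ascends along rows and down columns of each $\Gamma_a$, up to translating connected components along the diagonal (nodes of one $\Gamma_a$ in the same or adjacent diagonals being in one component) and up to replacing $\gamma_a$ by $\gamma_aq^{2m}$ while translating $\Gamma_a$ by $m$ steps to the left; the content of the node in row $x$ and column $y$ of $\Gamma_a$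 is $\gamma_aq^{2(y-x)}$. A standard tableau of type $(R,\mathsf v)$ is a triple $\boldsymbol T=(T_1,T_2,T_3)$ of standard tableaux of sizes $l+1,l'+1,l''+1$ such that $T_1,T_2$ coincide on the numbers $0,1$ and $T_1,T_3$ coincide on the numbers $0,\dots,k$. Its contents $\mathrm c_j(\boldsymbol T)$, namely those of the nodes $0,\dots,l$ of $T_1$, $2,\dots,l'$ of $T_2$ and $k+1,\dots,l''$ of $T_3$, form a sequence $\mathrm{Seq}(\boldsymbol T)$, and $\Delta(\boldsymbol T):=\Delta(\mathrm{Seq}(\boldsymbol T))$. It is admissible if every element of the truncated orbit of $\mathrm{Seq}(\boldsymbol T)$ is the sequence of contents of a standard tableau of type $(R,\mathsf v)$; that truncated orbit is then called admissible. For an admissible truncated orbit $\mathcal O$ let $V_{\mathcal O}$ have basis $(v_S)_{S\in\mathcal O}$, put $v_{\mathbf 0}=0$, and let $X_jv_S=s_jv_S$ and $g_iv_S=\frac{(q-q^{-1})s_i}{s_i-s_{i-1}}v_S+\frac{qs_i-q^{-1}s_{i-1}}{s_i-s_{i-1}}v_{\overline r_i(S)}$. Then the following hold. (0) $\pi$ is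 surjective and its kernel is the two-sided ideal generated by $C-1$, that is, $\overline H(R,\mathsf v)=H(R,\mathsf v)/(C=1)$. Moreover $\Delta(w(S))=\Delta(S)$ for every sequence $S$ and every element $w$ of the Weyl group; in particular $\Delta(\mathcal O):=\Delta(S)$, $S\in\mathcal O$, is well defined for every truncated orbit $\mathcal O$. (i) For every admissible truncated orbit $\mathcal O$, the formulas above define a representation of $H(R,\mathsf v)$ on $V_{\mathcal O}$, and this representation factors through $\pi$ if and only if $\Delta(\mathcal O)=1$. (ii) The calibrated spectrum of $\overline H(R,\mathsf v)$ is in bijection with the set of admissible standard tableaux $\boldsymbol T$ of type $(R,\mathsf v)$ with $\Delta(\boldsymbol T)=1$, a character $\chi$ corresponding to the tableau $\boldsymbol T$ with $\mathrm c_j(\boldsymbol T)=\chi(\phi(\delta_j))$ for all $j\in\mathrm{Vert}\cup\{0\}$. -/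

import Mathlib

noncomputable section

namespace Calibrated

/-! ### The ground field, root data, affine Hecke algebras -/

/-- The field `ℂ(q)` of rational functions in one indeterminate. -/
abbrev K : Type := RatFunc ℂ

/-- The indeterminate `q`, as an element of `ℂ(q)ˣ`. -/
def q : Kˣ := Units.mk0 RatFunc.X RatFunc.X_ne_zero

/-- A root datum `(Q_R ⊆ T, R^∨ ⊆ Hom(T, ℤ))` for the root system with Cartan matrix
`C i j = α_i^∨(α_j)`, recorded through its simple roots and simple coroots: `T` is a finitely
generated free `ℤ`-module that contains the root lattice `⊕ ℤ α_i`. -/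
structure RootDatum {I : Type} (C : Matrix I I ℤ) (T : Type) [AddCommGroup T] where
  free : Module.Free ℤ T
  finite : Module.Finite ℤ T
  root : I → T
  coroot : I → Module.Dual ℤ T
  linearIndependent_root : LinearIndependent ℤ root
  coroot_root : ∀ i j, coroot i (root j) = C i j
  diag : ∀ i, C i i = 2

namespace RootDatum

variable {I : Type} {C : Matrix I I ℤ} {T T' : Type} [AddCommGroup T] [AddCommGroup T']

/-- The simple reflection `r_i(x) = x - α_i^∨(x) α_i` of `T`. -/
def reflection (D : RootDatum C T) (i : I) : T ≃ₗ[ℤ] T :=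
  Module.reflection (x := D.root i) (f := D.coroot i) (by rw [D.coroot_root, D.diag])

/-- The Weyl group, generated by the simple reflections. -/
def weylGroup (D : RootDatum C T) : Subgroup (T ≃ₗ[ℤ] T) :=
  Subgroup.closure (Set.range D.reflection)

/-- The free generator `g_i`. -/
def genG (T : Type) (i : I) : FreeAlgebra K (I ⊕ T) := FreeAlgebra.ι K (Sum.inl i)

/-- The free generator `X^x`. -/
def genX (I : Type) (x : T) : FreeAlgebra K (I ⊕ T) := FreeAlgebra.ι K (Sum.inr x)

/-- The polynomial `(X^x - X^{r_i(x)}) / (1 - X^{-α_i})`. With `n = α_i^∨(x)` it is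
`X^x ∑_{k<n} X^{-kα_i}` for `n > 0`, it is `-X^{r_i(x)} ∑_{k<-n} X^{-kα_i}` for `n < 0`,
and it is `0` for `n = 0`; at most one of the two sums below is non-empty. -/
def lusztigQuotient (D : RootDatum C T) (i : I) (x : T) : FreeAlgebra K (I ⊕ T) :=
  genX I x * ∑ k ∈ Finset.range (D.coroot i x).toNat, genX I (-(k • D.root i))
    - genX I (D.reflection i x) *
      ∑ k ∈ Finset.range (-(D.coroot i x)).toNat, genX I (-(k • D.root i))

/-- The defining relations of the affine Hecke algebra of a root datum of simply-laced type
(so `m_{ij} = 2` if `C i j = 0` and `m_{ij} = 3` if `C i j = -1`). -/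
inductive Rel (D : RootDatum C T) : FreeAlgebra K (I ⊕ T) → FreeAlgebra K (I ⊕ T) → Prop
  | X_zero : Rel D (genX I 0) 1
  | X_add (x y : T) : Rel D (genX I x * genX I y) (genX I (x + y))
  | quadratic (i : I) :
      Rel D (genG T i * genG T i)
        (algebraMap K _ ((q : K) - (q : K)⁻¹) * genG T i + 1)
  | comm (i j : I) (hij : i ≠ j) (h : C i j = 0) :
      Rel D (genG T i * genG T j) (genG T j * genG T i)
  | braid (i j : I) (hij : i ≠ j) (h : C i j = -1) :
      Rel D (genG T i * genG T j * genG T i) (genG T j * genG T i * genG T j)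
  | lusztig (i : I) (x : T) :
      Rel D (genG T i * genX I x - genX I (D.reflection i x) * genG T i)
        (algebraMap K _ ((q : K) - (q : K)⁻¹) * D.lusztigQuotient i x)

/-- The affine Hecke algebra `ℂ(q)H(R,T)`: the `ℂ(q)`-algebra with the generators and defining
relations of `H(R,T)` (extension of scalars does not change a presentation). -/
abbrev AffineHecke (D : RootDatum C T) : Type := RingQuot D.Rel

/-- The generator `g_i`. -/
def g (D : RootDatum C T) (i : I) : D.AffineHecke := RingQuot.mkAlgHom K D.Rel (genG T i)

/-- The generator `X^x`. -/
def X (D : RootDatum C T) (x : T) : D.AffineHecke := RingQuot.mkAlgHom K D.Rel (genX I x)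

theorem X_zero (D : RootDatum C T) : D.X 0 = 1 := by
  simpa [X] using RingQuot.mkAlgHom_rel K (Rel.X_zero (D := D))

theorem X_mul (D : RootDatum C T) (x y : T) : D.X x * D.X y = D.X (x + y) := by
  simpa [X] using RingQuot.mkAlgHom_rel K (Rel.X_add (D := D) x y)

theorem mk_lusztig (D : RootDatum C T) (i : I) (x : T) :
    RingQuot.mkAlgHom K D.Rel (D.lusztigQuotient i x) =
      D.X x * ∑ k ∈ Finset.range (D.coroot i x).toNat, D.X (-(k • D.root i))
      - D.X (D.reflection i x) *
        ∑ k ∈ Finset.range (-(D.coroot i x)).toNat, D.X (-(k • D.root i)) := by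
  simp only [lusztigQuotient, X, map_sub, map_mul, map_sum]

/-- The morphism of affine Hecke algebras `g_i ↦ g_i`, `X^x ↦ X^{φ(x)}` attached to a
`ℤ`-linear map `φ` that respects simple roots and simple coroots. -/
def mapHecke (D : RootDatum C T) (D' : RootDatum C T') (φ : T →ₗ[ℤ] T')
    (hroot : ∀ i, φ (D.root i) = D'.root i)
    (hcoroot : ∀ i x, D'.coroot i (φ x) = D.coroot i x) :
    D.AffineHecke →ₐ[K] D'.AffineHecke :=
  RingQuot.liftAlgHom K ⟨FreeAlgebra.lift K (Sum.elim D'.g fun x => D'.X (φ x)), by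
    have hG : ∀ i, FreeAlgebra.lift K (Sum.elim D'.g fun x => D'.X (φ x)) (genG T i) = D'.g i :=
      fun i => by simp [genG]
    have hX : ∀ x, FreeAlgebra.lift K (Sum.elim D'.g fun x => D'.X (φ x)) (genX I x)
        = D'.X (φ x) := fun x => by simp [genX]
    have hr : ∀ i x, φ (D.reflection i x) = D'.reflection i (φ x) := fun i x => by
      simp [reflection, Module.reflection_apply, hroot, hcoroot]
    intro a b hab
    induction hab with
    | X_zero => simp [hX, X_zero]
    | X_add x y => simp [hX, X_mul]
    | quadratic i =>
      simpa [hG, g] using RingQuot.mkAlgHom_rel K (Rel.quadratic (D := D') i)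
    | comm i j hij h =>
      simpa [hG, g] using RingQuot.mkAlgHom_rel K (Rel.comm (D := D') i j hij h)
    | braid i j hij h =>
      simpa [hG, g] using RingQuot.mkAlgHom_rel K (Rel.braid (D := D') i j hij h)
    | lusztig i x =>
      have h := RingQuot.mkAlgHom_rel K (Rel.lusztig (D := D') i (φ x))
      simp only [map_sub, map_mul, AlgHom.commutes, mk_lusztig] at h
      simp only [lusztigQuotient, map_sub, map_mul, map_sum, AlgHom.commutes, hG, hX, hr,
        map_neg, map_nsmul, hroot]
      simpa only [hcoroot, g, X, map_sub] using h⟩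

theorem mapHecke_g (D : RootDatum C T) (D' : RootDatum C T') (φ : T →ₗ[ℤ] T')
    (hroot : ∀ i, φ (D.root i) = D'.root i)
    (hcoroot : ∀ i x, D'.coroot i (φ x) = D.coroot i x) (i : I) :
    D.mapHecke D' φ hroot hcoroot (D.g i) = D'.g i := by
  simp [mapHecke, g, genG]

theorem mapHecke_X (D : RootDatum C T) (D' : RootDatum C T') (φ : T →ₗ[ℤ] T')
    (hroot : ∀ i, φ (D.root i) = D'.root i)
    (hcoroot : ∀ i x, D'.coroot i (φ x) = D.coroot i x) (x : T) :
    D.mapHecke D' φ hroot hcoroot (D.X x) = D'.X (φ x) := by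
  simp [mapHecke, X, genX]

/-- The calibrated spectrum: the characters `χ : T → ℂ(q)ˣ` for which there are a
finite-dimensional representation `V` of `ℂ(q)H(R,T)` on which every `X^x` is diagonalizable
(`V` is the sum of the eigenspaces of `X^x`) and a non-zero `u ∈ V` with `X^x u = χ(x) u` for
all `x ∈ T`. -/
def calibratedSpectrum (D : RootDatum C T) : Set (AddChar T Kˣ) :=
  {χ | ∃ (V : Type) (_ : AddCommGroup V) (_ : Module K V) (_ : FiniteDimensional K V)
    (ρ : D.AffineHecke →ₐ[K] Module.End K V),
    (∀ x : T, ⨆ μ : K, Module.End.eigenspace (ρ (D.X x)) μ = ⊤) ∧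
    ∃ u : V, u ≠ 0 ∧ ∀ x : T, ρ (D.X x) u = (χ x : K) • u}

end RootDatum

/-! ### Labelled Dynkin diagrams -/

/-- The shape of a labelled Dynkin diagram: the vertices are `1, …, l`, then `2', …, l'`, then
`(k+1)'', …, l''`. The paths `1, 2, …, l` and `1, 2', …, l'` and
`1, …, k, (k+1)'', …, l''` go from the vertex `1` to the extremities.
Without trivalent vertex (type `A`) one has `l'' = k = l`, and `l' = 1` if the vertex `1` is an
extremity. With a trivalent vertex (types `D`, `E`), this vertex is `k`. -/
structure LabelShape where
  k : ℕ
  l : ℕ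
  l' : ℕ
  l'' : ℕ
  one_le_k : 1 ≤ k
  k_le_l : k ≤ l
  one_le_l' : 1 ≤ l'
  k_le_l'' : k ≤ l''
  conv : (l'' = k ∧ k = l ∧ (2 ≤ l' → 2 ≤ l)) ∨ (k < l'' ∧ k < l ∧ (k = 1 → 2 ≤ l'))

namespace LabelShape

variable (S : LabelShape)

theorem one_le_l : 1 ≤ S.l := S.one_le_k.trans S.k_le_l

/-- The set of vertices `{1,…,l} ⊔ {2',…,l'} ⊔ {(k+1)'',…,l''}`. The set `Vert ∪ {0}` is
`Option S.Vert`, where `none` is the label `0`. -/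
abbrev Vert : Type :=
  ↥(Finset.Icc 1 S.l) ⊕ ↥(Finset.Icc 2 S.l') ⊕ ↥(Finset.Icc (S.k + 1) S.l'')

/-- The vertex `1`. -/
def one : S.Vert := Sum.inl ⟨1, Finset.mem_Icc.2 ⟨le_rfl, S.one_le_l⟩⟩

/-- The labels `0, 1, …, l`. -/
def lab1 (a : ℕ) : Option S.Vert :=
  if h : a ∈ Finset.Icc 1 S.l then some (Sum.inl ⟨a, h⟩) else none

/-- The labels `0, 1, 2', …, l'`. -/
def lab2 (b : ℕ) : Option S.Vert :=
  if h : b ∈ Finset.Icc 2 S.l' then some (Sum.inr (Sum.inl ⟨b, h⟩)) else S.lab1 b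

/-- The labels `0, 1, …, k, (k+1)'', …, l''`. -/
def lab3 (c : ℕ) : Option S.Vert :=
  if h : c ∈ Finset.Icc (S.k + 1) S.l'' then some (Sum.inr (Sum.inr ⟨c, h⟩)) else S.lab1 c

/-- The label `i - 1`, for a vertex `i`. -/
def pred : S.Vert → Option S.Vert
  | Sum.inl a => S.lab1 (a - 1)
  | Sum.inr (Sum.inl b) => S.lab2 (b - 1)
  | Sum.inr (Sum.inr c) => S.lab3 (c - 1)

/-- The Cartan matrix of the labelled diagram, whose edges join `i` and `i - 1`. -/
def cartan : Matrix S.Vert S.Vert ℤ := fun i j =>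
  if i = j then 2 else if S.pred i = some j ∨ S.pred j = some i then -1 else 0

/-- `S.onPath i j`: the vertex `i` lies on the path from `1` to `j` (ends included). -/
def onPath : S.Vert → S.Vert → Prop
  | Sum.inl a, Sum.inl a' => a.1 ≤ a'.1
  | Sum.inl a, Sum.inr (Sum.inl _) => a.1 ≤ 1
  | Sum.inl a, Sum.inr (Sum.inr _) => a.1 ≤ S.k
  | Sum.inr (Sum.inl b), Sum.inr (Sum.inl b') => b.1 ≤ b'.1
  | Sum.inr (Sum.inr c), Sum.inr (Sum.inr c') => c.1 ≤ c'.1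
  | _, _ => False

/-! ### The lattice `L = ℤ ε ⊕ Q_R` -/

/-- The lattice `L = ℤ ε ⊕ Q_R`, with `Q_R = ⊕ ℤ α_i`. -/
abbrev L : Type := ℤ × (S.Vert → ℤ)

/-- The vector `ε`. -/
def eps : S.L := (1, 0)

/-- The simple root `α_i`. -/
def alpha (i : S.Vert) : S.L := (0, Pi.single i 1)

/-- The simple coroot, with `α_i^∨(ε) = -1` if `i = 1` and `α_i^∨(ε) = 0` otherwise. -/
def coroot (i : S.Vert) : Module.Dual ℤ S.L :=
  LinearMap.coprod ((if i = S.one then (-1 : ℤ) else 0) • LinearMap.id)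
    (∑ j, S.cartan i j • LinearMap.proj j)

/-- The root datum with lattice `L`. -/
def rootDatum : RootDatum S.cartan S.L where
  free := inferInstance
  finite := inferInstance
  root := S.alpha
  coroot := S.coroot
  linearIndependent_root := by
    have h : LinearIndependent ℤ (fun i : S.Vert => (Pi.single i 1 : S.Vert → ℤ)) :=
      Pi.linearIndependent_single_one S.Vert ℤ
    exact h.map' (LinearMap.inr ℤ ℤ (S.Vert → ℤ))
      (LinearMap.ker_eq_bot.2 LinearMap.inr_injective)
  coroot_root := fun i j => by
    simp [coroot, alpha, Pi.single_apply, -Fintype.sum_sum_type]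
  diag := fun i => by simp [cartan]

open Classical in
/-- The basis `(δ_j)` of `L`, for `j ∈ Vert ∪ {0}`: `δ_0 = ε`, and `δ_j` is the sum of `ε` and of
the simple roots along the path from `1` to `j`, so that `δ_j = δ_{j-1} + α_j`. -/
def delta : Option S.Vert → S.L
  | none => S.eps
  | some j => S.eps + ∑ i, if S.onPath i j then S.alpha i else 0

theorem pred_cases (j : S.Vert) :
    (j = S.one ∧ S.pred j = none) ∨ ∃ p, S.pred j = some p ∧
      ((∃ a b, j = Sum.inl a ∧ p = Sum.inl b ∧ a.1 = b.1 + 1) ∨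
        (∃ a b, j = Sum.inr (Sum.inl a) ∧ p = Sum.inr (Sum.inl b) ∧ a.1 = b.1 + 1) ∨
        (∃ a b, j = Sum.inr (Sum.inr a) ∧ p = Sum.inr (Sum.inr b) ∧ a.1 = b.1 + 1) ∨
        (∃ a b, j = Sum.inr (Sum.inl a) ∧ p = Sum.inl b ∧ a.1 = 2 ∧ b.1 = 1) ∨
        (∃ a b, j = Sum.inr (Sum.inr a) ∧ p = Sum.inl b ∧ a.1 = S.k + 1 ∧ b.1 = S.k)) := by
  have h1 := S.one_le_k
  have h2 := S.k_le_l
  rcases j with ⟨j, hj⟩ | ⟨j, hj⟩ | ⟨j, hj⟩ <;> have hj' := Finset.mem_Icc.1 hj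
  · by_cases e : j = 1
    · subst e
      exact Or.inl ⟨rfl, dif_neg (by simp)⟩
    · have h : j - 1 ∈ Finset.Icc 1 S.l := Finset.mem_Icc.2 ⟨by omega, by omega⟩
      exact Or.inr ⟨_, dif_pos h, Or.inl ⟨_, _, rfl, rfl, by simp only; omega⟩⟩
  · right
    by_cases e : j = 2
    · subst e
      have h : 2 - 1 ∉ Finset.Icc 2 S.l' := by simp
      have h' : 2 - 1 ∈ Finset.Icc 1 S.l := Finset.mem_Icc.2 ⟨by omega, by omega⟩
      exact ⟨_, (dif_neg h).trans (dif_pos h'),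
        Or.inr (Or.inr (Or.inr (Or.inl ⟨_, _, rfl, rfl, rfl, rfl⟩)))⟩
    · have h : j - 1 ∈ Finset.Icc 2 S.l' := Finset.mem_Icc.2 ⟨by omega, by omega⟩
      exact ⟨_, dif_pos h, Or.inr (Or.inl ⟨_, _, rfl, rfl, by simp only; omega⟩)⟩
  · right
    by_cases e : j = S.k + 1
    · subst e
      have h : S.k + 1 - 1 ∉ Finset.Icc (S.k + 1) S.l'' := by simp
      have h' : S.k + 1 - 1 ∈ Finset.Icc 1 S.l := Finset.mem_Icc.2 ⟨by omega, by omega⟩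
      exact ⟨_, (dif_neg h).trans (dif_pos h'),
        Or.inr (Or.inr (Or.inr (Or.inr ⟨_, _, rfl, rfl, rfl, by simp⟩)))⟩
    · have h : j - 1 ∈ Finset.Icc (S.k + 1) S.l'' := Finset.mem_Icc.2 ⟨by omega, by omega⟩
      exact ⟨_, dif_pos h, Or.inr (Or.inr (Or.inl ⟨_, _, rfl, rfl, by simp only; omega⟩))⟩

theorem onPath_iff (i j : S.Vert) :
    S.onPath i j ↔ i = j ∨ ∃ p, S.pred j = some p ∧ S.onPath i p := by
  have h1 := S.one_le_k
  have h2 : ∀ a : ↥(Finset.Icc 1 S.l), 1 ≤ a.1 := fun a => (Finset.mem_Icc.1 a.2).1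
  have h3 : ∀ a : ↥(Finset.Icc 2 S.l'), 2 ≤ a.1 := fun a => (Finset.mem_Icc.1 a.2).1
  have h4 : ∀ a : ↥(Finset.Icc (S.k + 1) S.l''), S.k + 1 ≤ a.1 :=
    fun a => (Finset.mem_Icc.1 a.2).1
  rcases S.pred_cases j with ⟨rfl, h⟩ | ⟨p, h, ⟨a, b, rfl, rfl, e⟩ | ⟨a, b, rfl, rfl, e⟩ |
    ⟨a, b, rfl, rfl, e⟩ | ⟨a, b, rfl, rfl, e, e'⟩ | ⟨a, b, rfl, rfl, e, e'⟩⟩ <;>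
    simp only [h, reduceCtorEq, false_and, exists_false, or_false, Option.some.injEq,
      exists_eq_left'] <;>
    rcases i with i | i | i <;>
    simp only [onPath, one, Sum.inl.injEq, Sum.inr.injEq, reduceCtorEq, Subtype.ext_iff,
      false_or, or_false]
  all_goals
    first
    | omega
    | (have := h2 i; omega)
    | (have := h3 i; omega)
    | (have := h4 i; omega)

theorem not_onPath_pred {j p : S.Vert} (h : S.pred j = some p) : ¬ S.onPath j p := by
  rcases S.pred_cases j with ⟨rfl, h'⟩ | ⟨p', h', hp⟩
  · simp [h'] at h
  · obtain rfl : p' = p := by simpa [h'] using h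
    rcases hp with ⟨a, b, rfl, rfl, e⟩ | ⟨a, b, rfl, rfl, e⟩ | ⟨a, b, rfl, rfl, e⟩ |
      ⟨a, b, rfl, rfl, e, e'⟩ | ⟨a, b, rfl, rfl, e, e'⟩ <;>
      first
      | (simp only [onPath]; omega)
      | simp [onPath]

theorem delta_pred (j : S.Vert) : S.delta (some j) = S.delta (S.pred j) + S.alpha j := by
  classical
  rcases h : S.pred j with _ | p
  · have h1 : ∀ i, S.onPath i j ↔ i = j := fun i => by rw [onPath_iff]; simp [h]
    simp [delta, h1, -Fintype.sum_sum_type]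
  · have h1 : ∀ i, (if S.onPath i j then S.alpha i else 0) =
        (if S.onPath i p then S.alpha i else 0) + if i = j then S.alpha i else 0 := fun i => by
      by_cases e : i = j
      · subst e
        rw [if_neg (S.not_onPath_pred h), if_pos ((S.onPath_iff i i).2 (Or.inl rfl)), if_pos rfl,
          zero_add]
      · have h2 : S.onPath i j ↔ S.onPath i p := by rw [onPath_iff]; simp [h, e]
        simp [h2, e]
    simp only [delta, h1, Finset.sum_add_distrib]
    simp [add_assoc, -Fintype.sum_sum_type]

/-- The affine Hecke algebra `ℂ(q)H(R,v)`. -/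
abbrev H : Type := S.rootDatum.AffineHecke

/-! ### The fundamental weight and the invariant element -/

/-- The coordinates of the fundamental weight `ω` of the vertex `1` in the basis of simple
roots: the solution of `α_i^∨(ω) = 1` if `i = 1` and `α_i^∨(ω) = 0` otherwise. -/
def omega : S.Vert → ℚ := Matrix.mulVec (S.cartan.map (Int.cast : ℤ → ℚ))⁻¹ (Pi.single S.one 1)

/-- `n_0` is the smallest positive integer such that `n_0 ω` lies in the root lattice, that is,
the least common denominator of the coordinates of `ω`. -/
def n0 : ℕ := Finset.univ.lcm fun i => (S.omega i).den

/-- The integers `n_j`, for `j ∈ Vert ∪ {0}`, with `n_0 ω = ∑ n_i α_i`. -/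
def n : Option S.Vert → ℤ
  | none => S.n0
  | some i => ⌊(S.n0 : ℚ) * S.omega i⌋

/-- The element `Δ = n_0 ε + ∑ n_i α_i` of `L`. -/
def DeltaL : S.L := S.n none • S.eps + ∑ i, S.n (some i) • S.alpha i

/-- The element `C = X^Δ` of the affine Hecke algebra. -/
def centralC : S.H := S.rootDatum.X S.DeltaL

/-- The integers `κ_j = n_j - ∑_{i : i - 1 = j} n_i`. -/
def kappa (j : Option S.Vert) : ℤ :=
  S.n j - ∑ i ∈ Finset.univ.filter (fun i => S.pred i = j), S.n (some i)

/-- The lattice `Q_R + ℤ ω` inside `ℚ ⊗ Q_R`. -/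
def Lbar : Submodule ℤ (S.Vert → ℚ) :=
  Submodule.span ℤ (Set.range (fun i : S.Vert => (Pi.single i 1 : S.Vert → ℚ)) ∪ {S.omega})

/-! ### Sequences, the Weyl group action and truncated operators -/

/-- The set of sequences, indexed by `Vert ∪ {0}`, of elements of `ℂ(q)ˣ`. -/
abbrev Seq : Type := Option S.Vert → Kˣ

/-- The character `χ_s` of `L` with `χ_s(δ_j) = s_j`, that is, with `χ_s(ε) = s_0` and
`χ_s(α_i) = s_i / s_{i-1}`. -/
def char (s : S.Seq) : AddChar S.L Kˣ where
  toFun x := s none ^ x.1 * ∏ i, (s (some i) / s (S.pred i)) ^ x.2 i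
  map_zero_eq_one' := by simp
  map_add_eq_mul' x y := by
    simp only [Prod.fst_add, Prod.snd_add, Pi.add_apply, zpow_add, Finset.prod_mul_distrib]
    exact mul_mul_mul_comm _ _ _ _

theorem char_alpha (s : S.Seq) (i : S.Vert) : S.char s (S.alpha i) = s (some i) / s (S.pred i) := by
  change s none ^ (0 : ℤ) * ∏ j, (s (some j) / s (S.pred j)) ^ (Pi.single i 1 : S.Vert → ℤ) j = _
  rw [Finset.prod_eq_single i (fun j _ h => by simp [h]) (by simp)]
  simp

theorem char_delta (s : S.Seq) (j : Option S.Vert) : S.char s (S.delta j) = s j := by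
  classical
  have h0 : S.char s (S.delta none) = s none := by
    change s none ^ (1 : ℤ) * ∏ j, (s (some j) / s (S.pred j)) ^ (0 : ℤ) = _
    simp
  have key : ∀ (m : ℕ) (j : S.Vert), (Finset.univ.filter fun i => S.onPath i j).card ≤ m →
      S.char s (S.delta (some j)) = s (some j) := by
    intro m
    induction m with
    | zero =>
      intro j hm
      rw [Nat.le_zero, Finset.card_eq_zero] at hm
      have : j ∈ Finset.univ.filter fun i => S.onPath i j := by
        simpa using (S.onPath_iff j j).2 (Or.inl rfl)
      simp [hm] at this
    | succ m ih =>
      intro j hm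
      rw [delta_pred, AddChar.map_add_eq_mul, char_alpha]
      suffices h : S.char s (S.delta (S.pred j)) = s (S.pred j) by
        rw [h, mul_div_cancel]
      rcases h : S.pred j with _ | p
      · exact h0
      · refine ih p (Nat.le_of_lt_succ (lt_of_lt_of_le (Finset.card_lt_card ?_) hm))
        rw [Finset.ssubset_iff_of_subset]
        · exact ⟨j, by simpa using (S.onPath_iff j j).2 (Or.inl rfl),
            by simpa using S.not_onPath_pred h⟩
        · intro i hi
          simp only [Finset.mem_filter, Finset.mem_univ, true_and] at hi ⊢
          exact (S.onPath_iff i j).2 (Or.inr ⟨p, h, hi⟩)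
  rcases j with _ | j
  · exact h0
  · exact key _ j le_rfl

/-- The action of a Weyl group element `w` on sequences: `χ_{w(s)}(x) = χ_s(w⁻¹ x)`. -/
def act (w : S.L ≃ₗ[ℤ] S.L) (s : S.Seq) : S.Seq := fun j => S.char s (w⁻¹ (S.delta j))

open Classical in
/-- The truncated operator; `none` is the symbol `𝟎`. -/
def trunc (i : S.Vert) (s : S.Seq) : Option S.Seq :=
  if s (some i) = q ^ (2 : ℤ) * s (S.pred i) ∨ s (some i) = q ^ (-2 : ℤ) * s (S.pred i) then none
  else some (S.act (S.rootDatum.reflection i) s)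

/-- The truncated orbit of `s`: all sequences obtained from `s` by repeated applications of
truncated operators. -/
def truncOrbit (s : S.Seq) : Set S.Seq :=
  {s' | Relation.ReflTransGen (fun t t' => ∃ i, S.trunc i t = some t') s s'}

/-- The invariant `Δ(s) = ∏_j s_j ^ κ_j`. -/
def Delta (s : S.Seq) : Kˣ := ∏ j, s j ^ S.kappa j

/-! ### The space `V_O` and the operators on it -/

open Classical in
/-- The basis vector `v_s` of the space `V_O` with basis `O`, with `v_𝟎 = 0`. -/
def basisVec (O : Set S.Seq) : Option S.Seq → (O →₀ K)
  | none => 0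
  | some s => if h : s ∈ O then Finsupp.single ⟨s, h⟩ 1 else 0

/-- The operator `X_j` on `V_O`: `X_j v_s = s_j v_s`. -/
def opX (O : Set S.Seq) (j : Option S.Vert) : Module.End K (O →₀ K) :=
  Finsupp.linearCombination K fun s : O => (s.1 j : K) • S.basisVec O (some s.1)

/-- The operator `g_i` on `V_O`:
`g_i v_s = ((q - q⁻¹) s_i / (s_i - s_{i-1})) v_s
  + ((q s_i - q⁻¹ s_{i-1}) / (s_i - s_{i-1})) v_{r̄_i(s)}`. -/
def opG (O : Set S.Seq) (i : S.Vert) : Module.End K (O →₀ K) :=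
  Finsupp.linearCombination K fun s : O =>
    let c : K := s.1 (some i)
    let c' : K := s.1 (S.pred i)
    (((q : K) - (q : K)⁻¹) * c / (c - c')) • S.basisVec O (some s.1)
      + (((q : K) * c - (q : K)⁻¹ * c') / (c - c')) • S.basisVec O (S.trunc i s.1)

end LabelShape

/-! ### Tableaux -/

/-- A skew diagram, as a set of nodes `(x, y)` (row, column): the diagram of a skew partition
`λ/μ`, translated along the diagonal. -/
def IsSkewDiagram (Γ : Set (ℤ × ℤ)) : Prop :=
  ∃ (lam mu : YoungDiagram) (t : ℤ), mu ≤ lam ∧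
    Γ = {θ | ∃ c ∈ lam.cells \ mu.cells, θ = ((c.1 : ℤ) + t, (c.2 : ℤ) + t)}

/-- The classical content `y - x` of a node `(x, y)`. -/
def cc (θ : ℤ × ℤ) : ℤ := θ.2 - θ.1

/-- `N` distinct placed nodes `(θ, γ)`, numbered by `0, …, N-1`, such that two distinct places
`γ` never differ by a factor `q ^ (2a)`. -/
structure Filling (N : ℕ) where
  node : Fin N → ℤ × ℤ
  place : Fin N → Kˣ
  injective : Function.Injective fun i => (node i, place i)
  place_ne : ∀ i j, place i ≠ place j → ∀ a : ℤ, place i ≠ q ^ (2 * a) * place j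

namespace Filling

variable {N : ℕ}

/-- The placed nodes form a placed skew diagram: the nodes with a given place form a skew
diagram. -/
def IsSkew (f : Filling N) : Prop :=
  ∀ i, IsSkewDiagram {θ | ∃ j, f.place j = f.place i ∧ f.node j = θ}

/-- The numbers ascend along rows and down columns in every diagram. -/
def IsStandard (f : Filling N) : Prop :=
  ∀ i j, f.place i = f.place j →
    ((f.node i).1 = (f.node j).1 → (f.node i).2 < (f.node j).2 → i < j) ∧
    ((f.node i).2 = (f.node j).2 → (f.node i).1 < (f.node j).1 → i < j)

/-- Equivalence of fillings. The diagram with place `γ` is translated by `a` steps to the left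
while `γ` is replaced by `γ q^(2a)`, where `a` depends only on the place, and each connected
component of a diagram is translated along the diagonal (by `t`). Nodes of the same diagram that
lie in the same diagonal or in adjacent diagonals are in the same connected component, and the
connected components are the classes of the equivalence relation generated by this. -/
def Equivalent (f f' : Filling N) : Prop :=
  ∃ a t : Fin N → ℤ,
    (∀ i j, f.place i = f.place j → a i = a j) ∧
    (∀ i j, f.place i = f.place j → |cc (f.node i) - cc (f.node j)| ≤ 1 → t i = t j) ∧
    ∀ i, f'.place i = f.place i * q ^ (2 * a i) ∧
      f'.node i = ((f.node i).1 + t i, (f.node i).2 - a i + t i)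

theorem Equivalent.place_eq {f f' : Filling N} {a : Fin N → ℤ}
    (ha : ∀ i j, f.place i = f.place j → a i = a j)
    (h : ∀ i, f'.place i = f.place i * q ^ (2 * a i)) (i j : Fin N) :
    f'.place i = f'.place j ↔ f.place i = f.place j := by
  constructor
  · intro e
    by_contra hne
    refine f.place_ne i j hne (a j - a i) ?_
    rw [h, h] at e
    rw [eq_mul_inv_of_mul_eq e, mul_sub, zpow_sub, mul_assoc, mul_comm]
  · intro e
    rw [h, h, e, ha i j e]

theorem Equivalent.refl (f : Filling N) : Equivalent f f :=
  ⟨0, 0, by simp, by simp, by simp⟩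

theorem Equivalent.symm {f f' : Filling N} (h : Equivalent f f') : Equivalent f' f := by
  obtain ⟨a, t, ha, ht, h⟩ := h
  have hp := Equivalent.place_eq (f := f) (f' := f') ha (fun i => (h i).1)
  refine ⟨fun i => -a i, fun i => -t i, fun i j e => ?_, fun i j e hc => ?_, fun i => ?_⟩
  · simp only [ha i j ((hp i j).1 e)]
  · have e' := (hp i j).1 e
    have := ha i j e'
    simp only [neg_inj]
    refine ht i j e' ?_
    rw [(h i).2, (h j).2] at hc
    simp only [cc] at hc ⊢
    rw [this] at hc
    convert hc using 2
    ring
  · rw [(h i).1, (h i).2]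
    constructor
    · rw [mul_assoc, ← zpow_add]; simp
    · ext
      · simp
      · simp; ring

theorem Equivalent.trans {f f' f'' : Filling N} (h : Equivalent f f') (h' : Equivalent f' f'') :
    Equivalent f f'' := by
  obtain ⟨a, t, ha, ht, h⟩ := h
  obtain ⟨b, u, hb, hu, h'⟩ := h'
  have hp := Equivalent.place_eq (f := f) (f' := f') ha (fun i => (h i).1)
  refine ⟨fun i => a i + b i, fun i => t i + u i, fun i j e => ?_, fun i j e hc => ?_,
    fun i => ?_⟩
  · simp only [ha i j e, hb i j ((hp i j).2 e)]
  · simp only [ht i j e hc]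
    rw [hu i j ((hp i j).2 e)]
    rw [(h i).2, (h j).2]
    simp only [cc] at hc ⊢
    rw [ha i j e]
    convert hc using 2
    ring
  · rw [(h' i).1, (h' i).2, (h i).1, (h i).2]
    constructor
    · rw [mul_add, zpow_add, mul_assoc]
    · ext
      · simp; ring
      · simp; ring

instance setoid (N : ℕ) : Setoid (Filling N) where
  r := Equivalent
  iseqv := ⟨Equivalent.refl, Equivalent.symm, Equivalent.trans⟩

/-- Keep only the nodes numbered `0, …, M-1`. -/
def restrict {M : ℕ} (h : M ≤ N) (f : Filling N) : Filling M where
  node i := f.node (Fin.castLE h i)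
  place i := f.place (Fin.castLE h i)
  injective := f.injective.comp (Fin.castLE_injective h)
  place_ne _ _ := f.place_ne _ _

/-- The content `γ q^(2(y-x))` of the node numbered `i`. -/
def content (f : Filling N) (i : Fin N) : Kˣ := f.place i * q ^ (2 * cc (f.node i))

end Filling

/-- Fillings up to equivalence. -/
def FillingClass (N : ℕ) : Type := Quotient (Filling.setoid N)

namespace FillingClass

variable {N : ℕ}

/-- `T^↓m`, obtained by keeping only the nodes numbered `0, …, M-1`, where `M = m + 1`. -/
def restrict {M : ℕ} (h : M ≤ N) : FillingClass N → FillingClass M :=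
  Quotient.map (Filling.restrict h) (by
    rintro f f' ⟨a, t, ha, ht, hf⟩
    exact ⟨fun i => a (Fin.castLE h i), fun i => t (Fin.castLE h i), fun i j => ha _ _,
      fun i j => ht _ _, fun i => hf _⟩)

/-- The content of the node numbered `i`. -/
def content (T : FillingClass N) : Fin N → Kˣ :=
  Quotient.lift Filling.content (by
    rintro f f' ⟨a, t, -, -, hf⟩
    funext i
    simp only [Filling.content, (hf i).1, (hf i).2, cc]
    rw [mul_assoc, ← zpow_add]
    congr 2
    ring) T

/-- The class is a standard tableau: it has a representative whose nodes form a placed skew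
diagram and whose numbers ascend along rows and down columns. -/
def IsStandardTableau (T : FillingClass N) : Prop :=
  ∃ f : Filling N, f.IsSkew ∧ f.IsStandard ∧ (Quotient.mk _ f : FillingClass N) = T

end FillingClass

namespace LabelShape

variable (S : LabelShape)

/-- Standard tableaux of type `(R,v)`: triples of standard tableaux of sizes `l+1`, `l'+1`,
`l''+1` such that `T₁^↓1 = T₂^↓1` and `T₁^↓k = T₃^↓k`. -/
@[ext]
structure STab where
  T1 : FillingClass (S.l + 1)
  T2 : FillingClass (S.l' + 1)
  T3 : FillingClass (S.l'' + 1)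
  standard1 : T1.IsStandardTableau
  standard2 : T2.IsStandardTableau
  standard3 : T3.IsStandardTableau
  agree12 : T1.restrict (Nat.succ_le_succ S.one_le_l) = T2.restrict (Nat.succ_le_succ S.one_le_l')
  agree13 : T1.restrict (Nat.succ_le_succ S.k_le_l) = T3.restrict (Nat.succ_le_succ S.k_le_l'')

variable {S}

/-- The sequence of contents of a standard tableau of type `(R,v)`. -/
def STab.seq (T : S.STab) : S.Seq
  | none => T.T1.content 0
  | some (Sum.inl a) => T.T1.content ⟨a, Nat.lt_succ_of_le (Finset.mem_Icc.1 a.2).2⟩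
  | some (Sum.inr (Sum.inl b)) => T.T2.content ⟨b, Nat.lt_succ_of_le (Finset.mem_Icc.1 b.2).2⟩
  | some (Sum.inr (Sum.inr c)) => T.T3.content ⟨c, Nat.lt_succ_of_le (Finset.mem_Icc.1 c.2).2⟩

/-- Admissibility: the truncated orbit consists of sequences of contents of standard tableaux. -/
def STab.IsAdmissible (T : S.STab) : Prop :=
  ∀ s ∈ S.truncOrbit T.seq, ∃ T' : S.STab, T'.seq = s

variable (S)

/-- The admissible truncated orbits. -/
def IsAdmissibleOrbit (O : Set S.Seq) : Prop :=
  ∃ T : S.STab, T.IsAdmissible ∧ O = S.truncOrbit T.seq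

/-- The set of admissible standard tableaux `T` with `Δ(T) = 1`. -/
def ASTabBar : Set S.STab := {T | T.IsAdmissible ∧ S.Delta T.seq = 1}

end LabelShape

/-! ### Root systems with a chosen vertex -/

/-- A labelling of the Dynkin diagram of a root system `P` with base `b` and chosen vertex `v`:
a shape together with a bijection between its labels and the simple roots that sends the label
`1` to `v` and identifies the Cartan matrices. (The root system is then simply-laced.) -/
structure Labelling {ι M N : Type*} [AddCommGroup M] [Module ℝ M] [AddCommGroup N] [Module ℝ N]
    {P : RootPairing ι ℝ M N} [P.IsCrystallographic] (b : P.Base) (v : b.support)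
    extends LabelShape where
  vertex : toLabelShape.Vert ≃ b.support
  vertex_one : vertex toLabelShape.one = v
  cartan_eq : ∀ i j, b.cartanMatrix (vertex i) (vertex j) = toLabelShape.cartan i j

namespace Labelling

variable {ι M N : Type*} [AddCommGroup M] [Module ℝ M] [AddCommGroup N] [Module ℝ N]
  {P : RootPairing ι ℝ M N} [P.IsCrystallographic] {b : P.Base} {v : b.support}
  (D : Labelling b v)

theorem det_ne_zero [Finite ι] [P.IsRootSystem] :
    (D.cartan.map (Int.cast : ℤ → ℚ)).det ≠ 0 := by
  classical
  have h1 : b.cartanMatrix.det ≠ 0 :=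
    Matrix.nondegenerate_iff_det_ne_zero.1 b.cartanMatrix_nondegenerate
  have h2 : D.cartan = b.cartanMatrix.submatrix D.vertex D.vertex := by
    ext i j
    exact (D.cartan_eq i j).symm
  have h3 : D.cartan.det ≠ 0 := by
    rw [h2, Matrix.det_submatrix_equiv_self]
    exact h1
  have h4 : (D.cartan.map (Int.cast : ℤ → ℚ)).det = ((D.cartan.det : ℤ) : ℚ) := by
    have := (Int.castRingHom ℚ).map_det D.cartan
    simpa using this.symm
  rw [h4]
  exact_mod_cast h3

/-- The simple coroot on `ℚ ⊗ Q_R`. -/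
def corootQ (i : D.Vert) : (D.Vert → ℚ) →ₗ[ℤ] ℚ :=
  ∑ j, D.cartan i j • LinearMap.proj j

theorem corootQ_apply (i : D.Vert) (x : D.Vert → ℚ) :
    D.corootQ i x = Matrix.mulVec (D.cartan.map (Int.cast : ℤ → ℚ)) x i := by
  simp [corootQ, Matrix.mulVec, dotProduct]

theorem corootQ_omega [Finite ι] [P.IsRootSystem] (i : D.Vert) :
    D.corootQ i D.omega = if i = D.one then 1 else 0 := by
  rw [corootQ_apply, LabelShape.omega, Matrix.mulVec_mulVec,
    Matrix.mul_nonsing_inv _ (isUnit_iff_ne_zero.2 D.det_ne_zero), Matrix.one_mulVec,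
    Pi.single_apply]

theorem corootQ_single (i j : D.Vert) :
    D.corootQ i (Pi.single j 1) = D.cartan i j := by
  simp [corootQ_apply]

theorem corootQ_int [Finite ι] [P.IsRootSystem] (i : D.Vert) (x : D.Lbar) :
    ((⌊D.corootQ i x⌋ : ℤ) : ℚ) = D.corootQ i x := by
  have h : D.corootQ i x ∈ LinearMap.range (Algebra.linearMap ℤ ℚ) := by
    have : D.Lbar ≤ (LinearMap.range (Algebra.linearMap ℤ ℚ)).comap (D.corootQ i) := by
      refine Submodule.span_le.2 ?_
      rintro y (⟨j, rfl⟩ | rfl)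
      · exact ⟨D.cartan i j, by simp [corootQ_single]⟩
      · refine ⟨if i = D.one then 1 else 0, ?_⟩
        rw [corootQ_omega]
        split_ifs <;> simp
    exact this x.2
  obtain ⟨m, hm⟩ := h
  rw [← hm]
  simp

/-- The root datum with lattice `Q_R + ℤ ω`. -/
def rootDatumBar [Finite ι] [P.IsRootSystem] : RootDatum D.cartan D.Lbar where
  free := by
    have : Module.Finite ℤ D.Lbar := by
      rw [Module.Finite.iff_fg]
      exact Submodule.fg_span ((Set.finite_range _).union (Set.finite_singleton _))
    infer_instance
  finite := by
    rw [Module.Finite.iff_fg]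
    exact Submodule.fg_span ((Set.finite_range _).union (Set.finite_singleton _))
  root i := ⟨Pi.single i 1, Submodule.subset_span (Or.inl ⟨i, rfl⟩)⟩
  coroot i :=
    { toFun := fun x => ⌊D.corootQ i x⌋
      map_add' := fun x y => by
        have := D.corootQ_int i (x + y)
        rw [Submodule.coe_add, map_add, ← D.corootQ_int i x, ← D.corootQ_int i y] at this
        rw [Submodule.coe_add, map_add]
        rw [← D.corootQ_int i x, ← D.corootQ_int i y]
        exact_mod_cast this
      map_smul' := fun m x => by
        rw [Submodule.coe_smul, map_smul, ← D.corootQ_int i x]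
        rw [zsmul_eq_mul, ← Int.cast_mul, Int.floor_intCast, Int.floor_intCast]
        simp }
  linearIndependent_root := by
    have h : LinearIndependent ℤ (fun i : D.Vert => (Pi.single i 1 : D.Vert → ℚ)) :=
      (Pi.linearIndependent_single_one D.Vert ℚ).restrict_scalars
        (R := ℤ) (fun a b h => by simpa using h)
    exact LinearIndependent.of_comp D.Lbar.subtype h
  coroot_root i j := by
    simp [corootQ_single]
  diag i := by simp [LabelShape.cartan]

/-- The affine Hecke algebra `ℂ(q)H̄(R,v)`, of the root datum with lattice `Q_R + ℤ ω`. -/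
abbrev Hbar [Finite ι] [P.IsRootSystem] : Type := D.rootDatumBar.AffineHecke

/-- The `ℤ`-linear map `φ : L → Q_R + ℤ ω` with `ε ↦ -ω` and `α_i ↦ α_i`. -/
def phi : D.L →ₗ[ℤ] D.Lbar :=
  LinearMap.coprod
    (LinearMap.toSpanSingleton ℤ D.Lbar (-⟨D.omega, Submodule.subset_span (Or.inr rfl)⟩))
    (∑ i, LinearMap.smulRight (LinearMap.proj i : (D.Vert → ℤ) →ₗ[ℤ] ℤ)
      (⟨Pi.single i 1, Submodule.subset_span (Or.inl ⟨i, rfl⟩)⟩ : D.Lbar))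

theorem phi_alpha [Finite ι] [P.IsRootSystem] (i : D.Vert) :
    D.phi (D.alpha i) = D.rootDatumBar.root i := by
  simp [phi, LabelShape.alpha, rootDatumBar, Pi.single_apply, -Fintype.sum_sum_type]

theorem coroot_phi [Finite ι] [P.IsRootSystem] (i : D.Vert) (x : D.L) :
    D.rootDatumBar.coroot i (D.phi x) = D.rootDatum.coroot i x := by
  obtain ⟨c, a⟩ := x
  have h1 : ((D.rootDatumBar.coroot i (D.phi (c, a)) : ℤ) : ℚ) =
      D.corootQ i (D.phi (c, a)) := D.corootQ_int i _
  have h2 : ((D.phi (c, a) : D.Lbar) : D.Vert → ℚ) =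
      (-c) • D.omega + ∑ j, a j • (Pi.single j 1 : D.Vert → ℚ) := by
    simp [phi, -Fintype.sum_sum_type]
  have h3 : D.rootDatum.coroot i (c, a) =
      (if i = D.one then (-1 : ℤ) else 0) * c + ∑ j, D.cartan i j * a j := by
    simp only [LabelShape.rootDatum, LabelShape.coroot]
    split_ifs <;> simp [-Fintype.sum_sum_type]
  rw [h2, map_add, map_sum, map_smul, corootQ_omega] at h1
  simp only [map_smul, corootQ_single] at h1
  have h4 : ((D.rootDatumBar.coroot i (D.phi (c, a)) : ℤ) : ℚ) =
      ((D.rootDatum.coroot i (c, a) : ℤ) : ℚ) := by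
    rw [h1, h3]
    push_cast
    congr 1
    · split_ifs <;> simp
    · exact Finset.sum_congr rfl fun j _ => by simp [mul_comm]
  exact_mod_cast h4

/-- The canonical morphism `ℂ(q)H(R,v) → ℂ(q)H̄(R,v)`, `g_i ↦ g_i`, `X^x ↦ X^{φ(x)}`. -/
def proj [Finite ι] [P.IsRootSystem] : D.H →ₐ[K] D.Hbar :=
  D.rootDatum.mapHecke D.rootDatumBar D.phi D.phi_alpha D.coroot_phi

end Labelling

end Calibrated

end

noncomputable section

namespace Calibrated

/-! ### The indeterminate is not a root of unity -/

/-! Everything rests on two local conditions on a sequence, read as a character `χ` of `L`: `χ(α_i)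
≠ 1` for every vertex `i`, and `χ(α_i + α_j) ≠ 1` for adjacent vertices `i`, `j`. This is
`LabelShape.Good`, and both sides of the correspondence turn out to be governed by the truncated
orbits that consist of good sequences.

Combinatorics. Since `q` is not a root of unity, a standard tableau can be recovered, up to
equivalence, from its contents, and a finite sequence is a sequence of contents exactly when it is
`Interlaced` (`Filling.interlaced_content`, `Interlaced.exists_filling`,
`Filling.equivalent_of_content_eq`). A tableau of type `(R,v)` is therefore a sequence interlaced
along the three paths. Along a path, the reflection of one of its vertices exchanges two
neighbouring entries; an induction on the distance between equal entries shows that if a truncated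
orbit is good, all its elements are interlaced along every path (`IsPath.interlaced_of_good`).
Conversely, interlacing at distances one and two gives goodness (`STab.good_seq`). So admissible
means that the truncated orbit is good.

Algebra. On `V_O`, for a good closed `O`, the defining relations reduce to identities between
rational functions of `χ(α_i)`, and truncation does not disturb them (`truncCoeff_mul_inv`).
Conversely, let `χ` be a weight of a calibrated representation. If `χ(α_i) = 1`, a Jordan block
appears. Otherwise `g_i` minus a scalar carries the weight vector to weight `r_i(χ)`, and can kill
it only where the reflection is truncated. These facts and the braid relation make every weight
good, and the set of weights is closed under truncated operators.

Passage to the quotient. The kernel of `φ` is `ℤ Δ`, where `Δ` denotes `DeltaL`, a vector fixed by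
the Weyl group. Since `C = X^Δ` acts on `v_s` by `χ_s(Δ) = Δ(s)`, the representation descends
exactly when this number is `1`. Truncated orbits lie in orbits of a finite Weyl group, so that
`V_O` is finite-dimensional and realizes every admissible tableau with `Δ = 1` in the calibrated
spectrum. -/

theorem q_zpow_eq_one {m : ℤ} (h : q ^ m = 1) : m = 0 := by
  have key : ∀ m : ℕ, q ^ m = 1 → m = 0 := by
    intro m h
    have h1 : (RatFunc.X : RatFunc ℂ) ^ m = 1 := by
      have := congrArg (Units.val) h
      simpa [q] using this
    have h2 : (Polynomial.X : Polynomial ℂ) ^ m = 1 := by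
      apply RatFunc.algebraMap_injective ℂ
      simpa using h1
    have := congrArg Polynomial.natDegree h2
    simpa using this
  rcases Int.eq_nat_or_neg m with ⟨n, rfl | rfl⟩
  · simpa using key n (by simpa using h)
  · simpa using key n (by simpa using h)

theorem q_zpow_injective : Function.Injective fun m : ℤ => q ^ m := fun a b h => by
  have h1 : q ^ (a - b) = 1 := by
    rw [zpow_sub, mul_inv_eq_one]
    exact h
  have := q_zpow_eq_one h1
  omega

/-! ### Skew diagrams -/

/-- A difference of two order ideals is convex. Conversely a finite convex set is the order ideal it
generates minus the part of that ideal outside the set. Convexity is the only form in which skewness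
is used below. -/
theorem isSkewDiagram_iff (Γ : Set (ℤ × ℤ)) : IsSkewDiagram Γ ↔ Γ.Finite ∧ Γ.OrdConnected := by
  constructor
  · rintro ⟨lam, mu, t, -, rfl⟩
    refine ⟨?_, ⟨?_⟩⟩
    · refine ((lam.cells \ mu.cells).finite_toSet.image
        fun c => (((c.1 : ℤ) + t, (c.2 : ℤ) + t) : ℤ × ℤ)).subset ?_
      rintro θ ⟨c, hc, rfl⟩
      exact ⟨c, hc, rfl⟩
    · rintro _ ⟨⟨a, b⟩, hc, rfl⟩ _ ⟨⟨a', b'⟩, hc', rfl⟩ ⟨x, y⟩ ⟨⟨h1, h2⟩, ⟨h3, h4⟩⟩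
      simp only [Finset.mem_sdiff, YoungDiagram.mem_cells] at hc hc' h1 h2 h3 h4
      have e1 : ((x - t).toNat : ℤ) = x - t := Int.toNat_of_nonneg (by omega)
      have e2 : ((y - t).toNat : ℤ) = y - t := Int.toNat_of_nonneg (by omega)
      refine ⟨((x - t).toNat, (y - t).toNat), ?_, ?_⟩
      · simp only [Finset.mem_sdiff, YoungDiagram.mem_cells]
        exact ⟨lam.up_left_mem (by omega) (by omega) hc'.1,
          fun h => hc.2 (mu.up_left_mem (by omega) (by omega) h)⟩
      · ext <;> simp only <;> omega
  · rintro ⟨hf, hc⟩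
    classical
    obtain ⟨⟨m1, m2⟩, hm⟩ := hf.bddBelow
    -- One translation along the diagonal must make both coordinates nonnegative, hence the minimum.
    set t := min m1 m2 with ht
    have hlow : ∀ θ ∈ Γ, t ≤ θ.1 ∧ t ≤ θ.2 := fun θ hθ => by
      have := hm hθ
      exact ⟨(min_le_left _ _).trans this.1, (min_le_right _ _).trans this.2⟩
    let cells : Finset (ℕ × ℕ) :=
      hf.toFinset.biUnion fun θ => Finset.Iic ((θ.1 - t).toNat, (θ.2 - t).toNat)
    have hcells : ∀ c : ℕ × ℕ, c ∈ cells ↔ ∃ θ ∈ Γ, (c.1 : ℤ) + t ≤ θ.1 ∧ (c.2 : ℤ) + t ≤ θ.2 := by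
      intro c
      simp only [cells, Finset.mem_biUnion, Set.Finite.mem_toFinset, Finset.mem_Iic, Prod.le_def]
      refine exists_congr fun θ => and_congr_right fun hθ => ?_
      have := hlow θ hθ
      omega
    let lam : YoungDiagram := ⟨cells, fun c c' hle hmem => by
      rw [Finset.mem_coe, hcells] at hmem ⊢
      obtain ⟨θ, hθ, h1, h2⟩ := hmem
      have h3 : c'.1 ≤ c.1 := hle.1
      have h4 : c'.2 ≤ c.2 := hle.2
      exact ⟨θ, hθ, by omega, by omega⟩⟩
    -- The complement in the ideal is again an ideal: a cell of `Γ` below a cell outside `Γ`, itself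
    -- below some `θ ∈ Γ`, would contradict convexity.
    let mu : YoungDiagram :=
      ⟨cells.filter fun c => (((c.1 : ℤ) + t, (c.2 : ℤ) + t) : ℤ × ℤ) ∉ Γ, fun c c' hle hmem => by
      simp only [Finset.coe_filter, Set.mem_ofPred_eq, hcells] at hmem ⊢
      obtain ⟨⟨θ, hθ, h1, h2⟩, h⟩ := hmem
      have h3 : c'.1 ≤ c.1 := hle.1
      have h4 : c'.2 ≤ c.2 := hle.2
      refine ⟨⟨θ, hθ, by omega, by omega⟩, fun h' => h (hc.out h' hθ ⟨⟨?_, ?_⟩, ⟨h1, h2⟩⟩)⟩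
      · simp only; omega
      · simp only; omega⟩
    refine ⟨lam, mu, t, fun c hc => (Finset.mem_filter.1 hc).1, ?_⟩
    ext ⟨x, y⟩
    simp only [Set.mem_ofPred_eq, Finset.mem_sdiff, lam, mu, Finset.mem_filter, hcells, not_and,
      not_not]
    constructor
    · intro h
      have h1 := hlow _ h
      have e1 : ((x - t).toNat : ℤ) = x - t := Int.toNat_of_nonneg (by simp only at h1; omega)
      have e2 : ((y - t).toNat : ℤ) = y - t := Int.toNat_of_nonneg (by simp only at h1; omega)
      have e3 : (x, y) = (((x - t).toNat : ℤ) + t, ((y - t).toNat : ℤ) + t) := by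
        rw [e1, e2]; simp
      refine ⟨((x - t).toNat, (y - t).toNat), ⟨⟨_, h, ?_, ?_⟩, fun _ => ?_⟩, e3⟩
      · simp only; omega
      · simp only; omega
      · rw [← e3]; exact h
    · rintro ⟨c, ⟨h1, h2⟩, e⟩
      rw [e]
      exact h2 h1

/-! ### Contents of standard tableaux -/

/-- Two occurrences of a value `c` are separated by an occurrence of `q² c` and by an occurrence
of `q⁻² c`. -/
def Interlaced {N : ℕ} (c : Fin N → Kˣ) : Prop :=
  ∀ i j, i < j → c i = c j → ∀ e : ℤ, e = 1 ∨ e = -1 →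
    ∃ m, i < m ∧ m < j ∧ c m = q ^ (2 * e) * c i

namespace Filling

variable {N : ℕ}

/-- Distinct places never differ by an even power of `q`, and the powers of `q` are distinct, so a
content determines the place relative to another node and the diagonal. -/
theorem content_eq_mul_iff (f : Filling N) (i j : Fin N) (m : ℤ) :
    f.content j = q ^ (2 * m) * f.content i ↔
      f.place j = f.place i ∧ cc (f.node j) = cc (f.node i) + m := by
  constructor
  · intro h
    have hp : f.place j = f.place i := by
      by_contra hne
      refine f.place_ne j i hne (m + cc (f.node i) - cc (f.node j)) ?_
      simp only [content] at h
      rw [eq_mul_inv_of_mul_eq h, ← zpow_neg]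
      have : (2 * (m + cc (f.node i) - cc (f.node j)) : ℤ)
        = 2 * m + 2 * cc (f.node i) + -(2 * cc (f.node j)) := by ring
      rw [this, zpow_add, zpow_add, mul_left_comm, mul_assoc, mul_comm, mul_assoc]
    refine ⟨hp, ?_⟩
    simp only [content, hp] at h
    rw [mul_left_comm, mul_right_inj, ← zpow_add] at h
    have := q_zpow_injective h
    omega
  · rintro ⟨h1, h2⟩
    simp only [content, h1, h2]
    rw [mul_left_comm, ← zpow_add]
    congr 2
    ring

theorem content_eq_iff (f : Filling N) (i j : Fin N) :
    f.content j = f.content i ↔ f.place j = f.place i ∧ cc (f.node j) = cc (f.node i) := by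
  simpa using f.content_eq_mul_iff i j 0

theorem eq_of_node_eq (f : Filling N) {i j : Fin N} (h : f.place i = f.place j)
    (h1 : (f.node i).1 = (f.node j).1) (h2 : (f.node i).2 = (f.node j).2) : i = j :=
  f.injective (Prod.ext (Prod.ext h1 h2) h)

theorem IsSkew.exists_node {f : Filling N} (hf : f.IsSkew) {i j : Fin N}
    (h : f.place i = f.place j) {x y : ℤ} (h1 : f.node i ≤ (x, y)) (h2 : (x, y) ≤ f.node j) :
    ∃ m, f.place m = f.place i ∧ f.node m = (x, y) :=
  ((isSkewDiagram_iff _).1 (hf i)).2.out ⟨i, rfl, rfl⟩ ⟨j, h.symm, rfl⟩ ⟨h1, h2⟩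

/-- Convexity puts the corner in the row of `i` and the column of `j` into the diagram. Numbers
ascend along the row from `i` to the corner, then down the column to `j`. -/
theorem le_of_node_le {f : Filling N} (hf : f.IsSkew) (hs : f.IsStandard) {i j : Fin N}
    (h : f.place i = f.place j) (hle : f.node i ≤ f.node j) : i ≤ j := by
  obtain ⟨hx, hy⟩ := hle
  obtain ⟨m, hm, hn⟩ := hf.exists_node h (x := (f.node i).1) (y := (f.node j).2)
    ⟨le_rfl, hy⟩ ⟨hx, le_rfl⟩
  have n1 : (f.node m).1 = (f.node i).1 := by rw [hn]
  have n2 : (f.node m).2 = (f.node j).2 := by rw [hn]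
  have h1 : i ≤ m := by
    rcases hy.lt_or_eq with hy | hy
    · exact ((hs i m hm.symm).1 n1.symm (by omega)).le
    · exact (f.eq_of_node_eq hm.symm n1.symm (by omega)).le
  have h2 : m ≤ j := by
    rcases hx.lt_or_eq with hx | hx
    · exact ((hs m j (hm.trans h)).2 n2 (by omega)).le
    · exact (f.eq_of_node_eq (hm.trans h) (by omega) n2).le
  exact h1.trans h2

theorem lt_of_node_le {f : Filling N} (hf : f.IsSkew) (hs : f.IsStandard) {i j : Fin N}
    (h : f.place i = f.place j) (hle : f.node i ≤ f.node j) (hne : f.node i ≠ f.node j) : i < j :=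
  lt_of_le_of_ne (le_of_node_le hf hs h hle) fun e => hne (by rw [e])

/-- Equal contents lie on one diagonal, the smaller number to the north-west. The right and lower
neighbours of the first node lie between the two nodes, hence in the diagram, and carry the contents
multiplied by `q²` and `q⁻²`. -/
theorem interlaced_content {f : Filling N} (hf : f.IsSkew) (hs : f.IsStandard) :
    Interlaced f.content := by
  intro i j hij hc e he
  obtain ⟨hp, hcc⟩ := (f.content_eq_iff j i).1 hc
  simp only [cc] at hcc
  have hx : (f.node i).1 < (f.node j).1 := by
    by_contra hle
    exact absurd (le_of_node_le hf hs hp.symm ⟨by omega, by omega⟩) (by omega)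
  have key : ∀ a b : ℤ, 0 ≤ a → a ≤ 1 → 0 ≤ b → b ≤ 1 → b - a = e →
      ∃ m, i < m ∧ m < j ∧ f.content m = q ^ (2 * e) * f.content i := by
    intro a b ha ha' hb hb' hab
    obtain ⟨m, hm, hn⟩ := hf.exists_node hp (x := (f.node i).1 + a) (y := (f.node i).2 + b)
      ⟨by simp only; omega, by simp only; omega⟩ ⟨by simp only; omega, by simp only; omega⟩
    refine ⟨m, lt_of_node_le hf hs hm.symm ?_ ?_, lt_of_node_le hf hs (hm.trans hp) ?_ ?_,
      (f.content_eq_mul_iff i m e).2 ⟨hm, ?_⟩⟩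
    · rw [hn]; exact ⟨by simp only; omega, by simp only; omega⟩
    · rw [hn]
      intro h'
      rw [Prod.ext_iff] at h'
      simp only at h'
      omega
    · rw [hn]; exact ⟨by simp only; omega, by simp only; omega⟩
    · rw [hn]
      intro h'
      rw [Prod.ext_iff] at h'
      simp only at h'
      omega
    · rw [hn]
      simp only [cc]
      omega
  rcases he with rfl | rfl
  · exact key 0 1 (by omega) (by omega) (by omega) (by omega) (by omega)
  · exact key 1 0 (by omega) (by omega) (by omega) (by omega) (by omega)

/-- In a standard filling the small numbers occupy an order ideal of each diagram, and an order
ideal of a convex set is convex. -/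
theorem IsSkew.restrict {f : Filling N} (hf : f.IsSkew) (hs : f.IsStandard) {M : ℕ} (h : M ≤ N) :
    (f.restrict h).IsSkew := by
  intro i
  rw [isSkewDiagram_iff]
  refine ⟨?_, ⟨?_⟩⟩
  · exact (Set.finite_range (f.restrict h).node).subset fun θ ⟨j, _, hj⟩ => ⟨j, hj⟩
  · rintro _ ⟨j, hj, rfl⟩ _ ⟨j', hj', rfl⟩ ⟨x, y⟩ ⟨h1, h2⟩
    obtain ⟨m, hm, hn⟩ := hf.exists_node (i := Fin.castLE h j) (j := Fin.castLE h j')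
      (hj.trans hj'.symm) h1 h2
    have hle : m ≤ Fin.castLE h j' :=
      le_of_node_le hf hs (hm.trans (hj.trans hj'.symm)) (by rw [hn]; exact h2)
    have hlt : m.1 < M := lt_of_le_of_lt (Fin.le_def.1 hle) (by simp)
    exact ⟨⟨m.1, hlt⟩, hm.trans hj, hn⟩

theorem IsStandard.restrict {f : Filling N} (hs : f.IsStandard) {M : ℕ} (h : M ≤ N) :
    (f.restrict h).IsStandard := fun i j hp => hs (Fin.castLE h i) (Fin.castLE h j) hp

/-! ### Uniqueness of the tableau with given contents -/

open Classical in
-- The left side depends on the contents alone. So contents determine the relative row of two nodes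
-- on equal or adjacent diagonals, which is all that survives translating components along the
-- diagonal.
theorem card_between {f : Filling N} (hf : f.IsSkew) (hs : f.IsStandard) {i j : Fin N}
    (hij : i < j) (hp : f.place i = f.place j) (hcc : |cc (f.node i) - cc (f.node j)| ≤ 1) :
    (((Finset.univ.filter fun m => f.content m = f.content i ∧ i ≤ m ∧ m < j).card : ℕ) : ℤ) =
      (f.node j).1 - (f.node i).1 + if cc (f.node j) = cc (f.node i) + 1 then 1 else 0 := by
  set δ : ℤ := if cc (f.node j) = cc (f.node i) + 1 then 1 else 0 with hδ
  rw [abs_le] at hcc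
  simp only [cc] at hcc hδ
  have hd : (δ = 1 ∧ (f.node j).2 - (f.node j).1 = (f.node i).2 - (f.node i).1 + 1) ∨
      (δ = 0 ∧ ((f.node j).2 - (f.node j).1 = (f.node i).2 - (f.node i).1 ∨
        (f.node j).2 - (f.node j).1 = (f.node i).2 - (f.node i).1 - 1)) := by
    by_cases h : (f.node j).2 - (f.node j).1 = (f.node i).2 - (f.node i).1 + 1
    · exact Or.inl ⟨hδ.trans (if_pos h), h⟩
    · exact Or.inr ⟨hδ.trans (if_neg h), by omega⟩
  -- The first row where the diagonal of `i` meets the quadrant south-east of `j`. Nodes of that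
  -- diagonal above row `z` are north-west of `j`, hence numbered before `j`; the others are
  -- numbered from `j` on.
  set z : ℤ := (f.node j).1 + δ with hz
  have key : ∀ m, f.place m = f.place i → cc (f.node m) = cc (f.node i) →
      ((f.node m).1 < z ↔ m < j) := by
    intro m hm hc
    simp only [cc] at hc
    constructor
    · intro hlt
      refine lt_of_node_le hf hs (hm.trans hp) ⟨by omega, by omega⟩ fun h => ?_
      rw [Prod.ext_iff] at h
      omega
    · intro hlt
      by_contra hge
      exact absurd (le_of_node_le hf hs (hm.trans hp).symm ⟨by omega, by omega⟩) (by omega)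
  have key2 : ∀ m, f.place m = f.place i → cc (f.node m) = cc (f.node i) →
      ((f.node i).1 ≤ (f.node m).1 ↔ i ≤ m) := by
    intro m hm hc
    simp only [cc] at hc
    constructor
    · intro hle
      exact le_of_node_le hf hs hm.symm ⟨by omega, by omega⟩
    · intro hle
      by_contra hlt
      have := lt_of_node_le hf hs hm (i := m) (j := i) ⟨by omega, by omega⟩ fun h => by
        rw [Prod.ext_iff] at h
        omega
      omega
  have himg : (Finset.univ.filter fun m => f.content m = f.content i ∧ i ≤ m ∧ m < j).image
      (fun m => (f.node m).1) = Finset.Ico (f.node i).1 z := by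
    ext x
    simp only [Finset.mem_image, Finset.mem_filter, Finset.mem_univ, true_and, Finset.mem_Ico,
      content_eq_iff]
    constructor
    · rintro ⟨m, ⟨⟨h1, h2⟩, h3, h4⟩, rfl⟩
      exact ⟨(key2 m h1 h2).2 h3, (key m h1 h2).2 h4⟩
    · rintro ⟨h1, h2⟩
      obtain ⟨m, hm, hn⟩ := hf.exists_node hp (x := x) (y := x + cc (f.node i))
        ⟨h1, by simp only [cc]; omega⟩ ⟨by simp only; omega, by simp only [cc]; omega⟩
      have hmc : cc (f.node m) = cc (f.node i) := by rw [hn]; simp [cc]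
      have hmx : (f.node m).1 = x := by rw [hn]
      exact ⟨m, ⟨⟨hm, hmc⟩, (key2 m hm hmc).1 (by omega), (key m hm hmc).1 (by omega)⟩, hmx⟩
  have hinj : Set.InjOn (fun m => (f.node m).1)
      ((Finset.univ.filter fun m => f.content m = f.content i ∧ i ≤ m ∧ m < j :) :
        Set (Fin N)) := by
    intro m hm m' hm' h
    simp only [Finset.coe_filter, Finset.mem_univ, true_and, Set.mem_ofPred_eq,
      content_eq_iff] at hm hm' h
    have h1 := hm.1.2
    have h2 := hm'.1.2
    simp only [cc] at h1 h2
    exact f.eq_of_node_eq (hm.1.1.trans hm'.1.1.symm) h (by omega)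
  have hlt : (f.node i).1 < z := (key i rfl rfl).2 hij
  rw [← Finset.card_image_of_injOn hinj, himg, Int.card_Ico, Int.toNat_of_nonneg (by omega)]
  omega

/-- The shift to the left is the difference of diagonals, constant on each place; the shift along
the diagonal is the difference of rows, constant on adjacent diagonals by `card_between`. -/
theorem equivalent_of_content_eq {f f' : Filling N} (hf : f.IsSkew) (hs : f.IsStandard)
    (hf' : f'.IsSkew) (hs' : f'.IsStandard) (h : f.content = f'.content) : f.Equivalent f' := by
  have hpl : ∀ i j, f.place j = f.place i → f'.place j = f'.place i ∧
      cc (f'.node j) - cc (f'.node i) = cc (f.node j) - cc (f.node i) := by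
    intro i j hp
    have := (f.content_eq_mul_iff i j (cc (f.node j) - cc (f.node i))).2 ⟨hp, by omega⟩
    rw [h, f'.content_eq_mul_iff] at this
    exact ⟨this.1, by omega⟩
  refine ⟨fun i => cc (f.node i) - cc (f'.node i), fun i => (f'.node i).1 - (f.node i).1,
    fun i j hp => ?_, ?_, fun i => ⟨?_, ?_⟩⟩
  · have := (hpl j i hp).2
    simp only
    omega
  · have key : ∀ i j, i < j → f.place i = f.place j → |cc (f.node i) - cc (f.node j)| ≤ 1 →
        (f'.node i).1 - (f.node i).1 = (f'.node j).1 - (f.node j).1 := by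
      intro i j hij hp hc
      obtain ⟨hp', hcc⟩ := hpl j i hp
      have h1 := card_between hf hs hij hp hc
      have h2 := card_between hf' hs' hij hp' (by rw [hcc]; exact hc)
      rw [← h, h1] at h2
      have h3 : (cc (f'.node j) = cc (f'.node i) + 1) ↔ (cc (f.node j) = cc (f.node i) + 1) := by
        omega
      simp only [h3] at h2
      omega
    intro i j hp hc
    rcases lt_trichotomy i j with hij | rfl | hij
    · exact key i j hij hp hc
    · rfl
    · exact (key j i hij hp.symm (by rw [abs_sub_comm]; exact hc)).symm
  · have := congrFun h i
    simp only [content] at this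
    rw [mul_sub, zpow_sub, ← mul_assoc, this]
    simp
  · ext
    · simp
    · simp only [cc]; ring

end Filling

/-! ### Existence of a tableau with given interlaced contents -/

open Classical in
theorem count_le_count_add_one {A B : ℕ → Prop} (hAB : ∀ m, A m → ¬ B m)
    (h : ∀ i j, i < j → A i → A j → ∃ m, i < m ∧ m < j ∧ B m) (n d : ℕ) :
    Nat.count A (n + d) + Nat.count B n ≤ Nat.count B (n + d) + Nat.count A n + 1 := by
  -- The induction also records that, when the bound is attained, some occurrence of `A` has no `B`
  -- after it; a further `A` then forces a new `B` in between.
  suffices hs : Nat.count A (n + d) + Nat.count B n ≤ Nat.count B (n + d) + Nat.count A n + 1 ∧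
      (Nat.count A (n + d) + Nat.count B n = Nat.count B (n + d) + Nat.count A n + 1 →
        ∃ p, p < n + d ∧ A p ∧ ∀ m, p < m → m < n + d → ¬ B m) from hs.1
  induction d with
  | zero =>
    simp only [add_zero]
    exact ⟨by omega, fun h => by omega⟩
  | succ d ih =>
    obtain ⟨h1, h2⟩ := ih
    rw [← add_assoc, Nat.count_succ, Nat.count_succ]
    by_cases hA : A (n + d)
    · rw [if_pos hA, if_neg (hAB _ hA)]
      have hlt : Nat.count A (n + d) + Nat.count B n < Nat.count B (n + d) + Nat.count A n + 1 := by
        refine lt_of_le_of_ne h1 fun e => ?_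
        obtain ⟨p, hp, hAp, hB⟩ := h2 e
        obtain ⟨m, hm1, hm2, hm3⟩ := h p (n + d) hp hAp hA
        exact hB m hm1 hm2 hm3
      exact ⟨by omega, fun _ => ⟨n + d, by omega, hA, fun m _ _ => by omega⟩⟩
    · rw [if_neg hA]
      by_cases hB : B (n + d)
      · rw [if_pos hB]
        exact ⟨by omega, fun _ => by omega⟩
      · rw [if_neg hB]
        refine ⟨by omega, fun e => ?_⟩
        obtain ⟨p, hp, hAp, hBp⟩ := h2 (by omega)
        refine ⟨p, by omega, hAp, fun m hm hm' => ?_⟩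
        rcases Nat.lt_succ_iff_lt_or_eq.1 hm' with hm' | rfl
        · exact hBp m hm hm'
        · exact hB

open Classical in
theorem exists_count_eq {A : ℕ → Prop} {n k : ℕ} (h : k < Nat.count A n) :
    ∃ j < n, A j ∧ Nat.count A j = k := by
  induction n with
  | zero => simp at h
  | succ n ih =>
    rw [Nat.count_succ] at h
    by_cases hk : k < Nat.count A n
    · obtain ⟨j, hj, hA⟩ := ih hk
      exact ⟨j, by omega, hA⟩
    · split_ifs at h with hA
      · exact ⟨n, by omega, hA, by omega⟩
      · omega

/-- Used to fix the starting rows of all diagonals from the prescribed jumps between neighbouring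
ones. One of the two sums is always empty. -/
theorem exists_int_primitive (σ : ℤ → ℤ) : ∃ b : ℤ → ℤ, ∀ d, b (d + 1) = b d + σ d := by
  refine ⟨fun d => ∑ k ∈ Finset.range d.toNat, σ k - ∑ k ∈ Finset.range (-d).toNat, σ (-k - 1),
    fun d => ?_⟩
  rcases lt_or_ge d 0 with h | h
  · have h1 : (d + 1).toNat = 0 := by omega
    have h2 : d.toNat = 0 := by omega
    have h3 : (-d).toNat = (-(d + 1)).toNat + 1 := by omega
    have h4 : (-(((-(d + 1)).toNat : ℕ) : ℤ) - 1) = d := by omega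
    simp only [h1, h2, h3, Finset.sum_range_succ, h4]
    ring
  · have h1 : (d + 1).toNat = d.toNat + 1 := by omega
    have h2 : (-d).toNat = 0 := by omega
    have h3 : (-(d + 1)).toNat = 0 := by omega
    have h4 : ((d.toNat : ℕ) : ℤ) = d := by omega
    simp only [h1, h2, h3, Finset.sum_range_succ, h4]
    ring

/-- The predicate on numbers: the content at this number is `v`. -/
def HasValue {N : ℕ} (c : Fin N → Kˣ) (v : Kˣ) (m : ℕ) : Prop := ∃ h : m < N, c ⟨m, h⟩ = v

namespace Interlaced

variable {N : ℕ} {c : Fin N → Kˣ}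

open Classical in
theorem count_le (hc : Interlaced c) (v : Kˣ) {e : ℤ} (he : e = 1 ∨ e = -1) {n n' : ℕ}
    (hn : n ≤ n') :
    Nat.count (HasValue c v) n' + Nat.count (HasValue c (q ^ (2 * e) * v)) n ≤
      Nat.count (HasValue c (q ^ (2 * e) * v)) n' + Nat.count (HasValue c v) n + 1 := by
  obtain ⟨d, rfl⟩ := Nat.exists_eq_add_of_le hn
  refine count_le_count_add_one ?_ ?_ n d
  · rintro m ⟨h1, h2⟩ ⟨h3, h4⟩
    have h5 : q ^ (2 * e) * v = 1 * v := by rw [one_mul, ← h4, h2]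
    have := q_zpow_eq_one (mul_right_cancel h5)
    omega
  · rintro i j hij ⟨hi, hiv⟩ ⟨hj, hjv⟩
    obtain ⟨m, h1, h2, h3⟩ := hc ⟨i, hi⟩ ⟨j, hj⟩ hij (hiv.trans hjv.symm) e he
    exact ⟨m, h1, h2, m.2, by rw [← hiv]; exact h3⟩

open Classical in
/-- On the diagonal `d` of the component with place `γ`, the nodes numbered by less than `n`
fill the rows from `b d` to `b d + count`, for a suitable function `b`. -/
theorem exists_heights (hc : Interlaced c) (γ : Kˣ) : ∃ b : ℤ → ℤ, ∀ (n : ℕ) (d : ℤ),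
    b (d + 1) + Nat.count (HasValue c (γ * q ^ (2 * (d + 1)))) n ≤
        b d + Nat.count (HasValue c (γ * q ^ (2 * d))) n ∧
      b d + Nat.count (HasValue c (γ * q ^ (2 * d))) n ≤
        b (d + 1) + Nat.count (HasValue c (γ * q ^ (2 * (d + 1)))) n + 1 := by
  -- As `n` varies, the count on diagonal `d` minus the count on diagonal `d + 1` stays in an
  -- interval of length one containing `0`, its value at `n = 0`. So its values lie in `{-1, 0}` or
  -- in `{0, 1}`, and the jump `-1` or `0` of `b` normalizes both cases to `{0, 1}`.
  obtain ⟨b, hb⟩ := exists_int_primitive fun d =>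
    if ∃ n, Nat.count (HasValue c (γ * q ^ (2 * d))) n <
      Nat.count (HasValue c (γ * q ^ (2 * (d + 1)))) n then -1 else 0
  refine ⟨b, fun n d => ?_⟩
  have e1 : q ^ (2 * (1 : ℤ)) * (γ * q ^ (2 * d)) = γ * q ^ (2 * (d + 1)) := by
    rw [mul_left_comm, ← zpow_add]; congr 2; ring
  have e2 : q ^ (2 * (-1 : ℤ)) * (γ * q ^ (2 * (d + 1))) = γ * q ^ (2 * d) := by
    rw [mul_left_comm, ← zpow_add]; congr 2; ring
  have key : ∀ n n', n ≤ n' → _ ∧ _ := fun n n' h =>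
    ⟨hc.count_le (γ * q ^ (2 * d)) (Or.inl rfl) h,
      hc.count_le (γ * q ^ (2 * (d + 1))) (Or.inr rfl) h⟩
  simp only [e1, e2] at key
  rw [hb]
  have h0 := key 0 n (Nat.zero_le _)
  simp only [Nat.count_zero] at h0
  split_ifs with h
  · obtain ⟨n', hn'⟩ := h
    rcases le_total n n' with hle | hle
    · have := key n n' hle
      omega
    · have := key n' n hle
      omega
  · push Not at h
    have := h n
    omega

open Classical in
-- The nodes are dropped one after the other, each on the diagonal of its content and in the first
-- free row. Interlacing ensures that the filled region is at every stage a difference of two order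
-- ideals.
theorem exists_filling (hc : Interlaced c) :
    ∃ f : Filling N, f.IsSkew ∧ f.IsStandard ∧ f.content = c := by
  choose b hb using hc.exists_heights
  let Q := Kˣ ⧸ Subgroup.zpowers (q ^ (2 : ℤ))
  -- Choosing one representative in each coset of the powers of `q²` makes the condition on distinct
  -- places automatic.
  let pl : Fin N → Kˣ := fun i => (QuotientGroup.mk (c i) : Q).out
  have hpl : ∀ i j, (∃ a : ℤ, pl i = q ^ (2 * a) * pl j) → pl i = pl j := by
    rintro i j ⟨a, ha⟩
    have h1 : (QuotientGroup.mk (pl i) : Q) = QuotientGroup.mk (pl j) := by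
      rw [QuotientGroup.eq, ha]
      refine ⟨-a, ?_⟩
      simp only
      rw [mul_inv, inv_mul_cancel_right, zpow_mul, zpow_neg]
    simp only [pl, QuotientGroup.out_eq'] at h1 ⊢
    rw [h1]
  have hex : ∀ i, ∃ e : ℤ, c i = pl i * q ^ (2 * e) := by
    intro i
    have h1 : (QuotientGroup.mk (pl i) : Q) = QuotientGroup.mk (c i) := by
      simp only [pl, QuotientGroup.out_eq']
    rw [QuotientGroup.eq] at h1
    obtain ⟨a, ha⟩ := h1
    simp only at ha
    exact ⟨a, by rw [zpow_mul, ha]; group⟩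
  choose e he using hex
  -- The first free row on diagonal `d` once the numbers less than `n` are placed.
  let H : Kˣ → ℕ → ℤ → ℤ := fun γ n d => b γ d + Nat.count (HasValue c (γ * q ^ (2 * d))) n
  have hH : ∀ γ n d, H γ n (d + 1) ≤ H γ n d ∧ H γ n d ≤ H γ n (d + 1) + 1 := hb
  have hHk : ∀ γ n d (k : ℕ), H γ n (d + k) ≤ H γ n d ∧ H γ n d ≤ H γ n (d + k) + k := by
    intro γ n d k
    induction k with
    | zero => simp
    | succ k ih =>
      have := hH γ n (d + k)
      rw [add_assoc] at this
      push_cast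
      omega
  have hmono : ∀ γ d {n n' : ℕ}, n ≤ n' → H γ n d ≤ H γ n' d := by
    intro γ d n n' h
    have := Nat.count_monotone (HasValue c (γ * q ^ (2 * d))) h
    simp only [H]
    omega
  -- The nodes above the profile `H γ n` form an order ideal, because from one diagonal to the next
  -- the profile stays constant or goes up by one row.
  have hlow : ∀ γ n (θ θ' : ℤ × ℤ), θ ≤ θ' → θ'.1 < H γ n (cc θ') → θ.1 < H γ n (cc θ) := by
    rintro γ n ⟨x, y⟩ ⟨x', y'⟩ ⟨h1, h2⟩ h3
    simp only [cc] at h1 h2 h3 ⊢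
    rcases le_total (y - x) (y' - x') with h | h
    · obtain ⟨k, hk⟩ := Int.eq_ofNat_of_zero_le (sub_nonneg.2 h)
      have h4 := hHk γ n (y - x) k
      rw [← hk, add_sub_cancel] at h4
      omega
    · obtain ⟨k, hk⟩ := Int.eq_ofNat_of_zero_le (sub_nonneg.2 h)
      have h4 := hHk γ n (y' - x') k
      rw [← hk, add_sub_cancel] at h4
      omega
  let nd : Fin N → ℤ × ℤ := fun i => (H (pl i) i (e i), H (pl i) i (e i) + e i)
  have hcc : ∀ i, cc (nd i) = e i := fun i => by simp [cc, nd]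
  have hsucc : ∀ i : Fin N, H (pl i) (i + 1) (e i) = H (pl i) i (e i) + 1 := by
    intro i
    simp only [H]
    rw [Nat.count_succ, if_pos ⟨i.2, he i⟩]
    push_cast
    ring
  -- Once `j` is placed, the ideal contains node `j`, hence node `i`. If `i` came later, its row
  -- would still be free at that moment.
  have hlt : ∀ i j, pl i = pl j → nd i ≤ nd j → i ≤ j := by
    intro i j hp h
    have h1 : (nd j).1 < H (pl j) (j + 1) (cc (nd j)) := by
      rw [hcc, hsucc]
      simp [nd]
    have h2 := hlow _ _ _ _ h h1
    rw [← hp, hcc] at h2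
    by_contra hij
    have h3 := hmono (pl i) (e i) (n := j + 1) (n' := i) (by omega)
    simp only [nd] at h2
    omega
  let f : Filling N :=
    { node := nd
      place := pl
      injective := fun i j h => by
        have h1 := congrArg Prod.fst h
        have h2 := congrArg Prod.snd h
        exact le_antisymm (hlt i j h2 (le_of_eq h1)) (hlt j i h2.symm (ge_of_eq h1))
      place_ne := fun i j hne a h => hne (hpl i j ⟨a, h⟩) }
  refine ⟨f, fun i => ?_, fun i j hp => ⟨fun h1 h2 => ?_, fun h1 h2 => ?_⟩, ?_⟩
  · have hset : {θ | ∃ j, f.place j = f.place i ∧ f.node j = θ} =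
        {θ : ℤ × ℤ | θ.1 < H (pl i) N (cc θ) ∧ ¬ θ.1 < H (pl i) 0 (cc θ)} := by
      ext ⟨x, y⟩
      simp only [Set.mem_ofPred_eq]
      constructor
      · rintro ⟨j, hj, h⟩
        change pl j = pl i at hj
        change nd j = (x, y) at h
        rw [← h, hcc, ← hj]
        have h1 := hmono (pl j) (e j) (n := j + 1) (n' := N) (by omega)
        have h2 := hmono (pl j) (e j) (Nat.zero_le j)
        rw [hsucc] at h1
        have hx : H (pl j) j (e j) = x := congrArg Prod.fst h
        omega
      · rintro ⟨h1, h2⟩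
        simp only [H, Nat.count_zero] at h1 h2
        obtain ⟨j, hjN, ⟨_, hj⟩, hj'⟩ := exists_count_eq (n := N)
          (A := HasValue c (pl i * q ^ (2 * cc (x, y))))
          (k := (x - b (pl i) (cc (x, y))).toNat) (by omega)
        have hp : pl ⟨j, hjN⟩ = pl i := by
          refine hpl _ _ ⟨cc (x, y) - e ⟨j, hjN⟩, ?_⟩
          rw [he] at hj
          rw [eq_mul_inv_of_mul_eq hj, ← zpow_neg, mul_assoc, ← zpow_add, mul_comm]
          congr 2
          ring
        have hee : e ⟨j, hjN⟩ = cc (x, y) := by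
          rw [he, hp] at hj
          have := q_zpow_injective (mul_left_cancel hj)
          omega
        refine ⟨⟨j, hjN⟩, hp, ?_⟩
        have hx : H (pl ⟨j, hjN⟩) j (e ⟨j, hjN⟩) = x := by
          simp only [H]
          rw [hp, hee, hj']
          omega
        refine Prod.ext hx ?_
        change H (pl ⟨j, hjN⟩) j (e ⟨j, hjN⟩) + e ⟨j, hjN⟩ = y
        rw [hx, hee, cc, add_sub_cancel]
    rw [isSkewDiagram_iff]
    refine ⟨?_, ?_⟩
    · exact (Set.finite_range f.node).subset fun θ ⟨j, _, hj⟩ => ⟨j, hj⟩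
    · rw [hset]
      refine ⟨fun θ hθ θ' hθ' θ'' hθ'' => ⟨hlow _ _ _ _ hθ''.2 hθ'.1, fun h => hθ.2 ?_⟩⟩
      exact hlow _ _ _ _ hθ''.1 h
  · refine lt_of_le_of_ne (hlt i j hp ⟨h1.le, h2.le⟩) fun e => ?_
    rw [e] at h2
    exact lt_irrefl _ h2
  · refine lt_of_le_of_ne (hlt i j hp ⟨h2.le, h1.le⟩) fun e => ?_
    rw [e] at h2
    exact lt_irrefl _ h2
  · funext i
    change pl i * q ^ (2 * cc (nd i)) = c i
    rw [hcc, he i]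

end Interlaced

/-! ### Tableaux up to equivalence and their contents -/

namespace FillingClass

variable {N : ℕ}

theorem content_restrict {M : ℕ} (h : M ≤ N) (T : FillingClass N) (i : Fin M) :
    (T.restrict h).content i = T.content (Fin.castLE h i) := by
  induction T using Quotient.inductionOn with
  | _ f => rfl

namespace IsStandardTableau

theorem interlaced {T : FillingClass N} (hT : T.IsStandardTableau) : Interlaced T.content := by
  obtain ⟨f, hf, hs, rfl⟩ := hT
  exact Filling.interlaced_content hf hs

theorem restrict {T : FillingClass N} (hT : T.IsStandardTableau) {M : ℕ} (h : M ≤ N) :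
    (T.restrict h).IsStandardTableau := by
  obtain ⟨f, hf, hs, rfl⟩ := hT
  exact ⟨f.restrict h, hf.restrict hs h, hs.restrict h, rfl⟩

theorem eq_of_content_eq {T T' : FillingClass N} (hT : T.IsStandardTableau)
    (hT' : T'.IsStandardTableau) (h : T.content = T'.content) : T = T' := by
  obtain ⟨f, hf, hs, rfl⟩ := hT
  obtain ⟨f', hf', hs', rfl⟩ := hT'
  exact Quotient.sound (Filling.equivalent_of_content_eq hf hs hf' hs' h)

end IsStandardTableau

theorem exists_of_interlaced {c : Fin N → Kˣ} (hc : Interlaced c) :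
    ∃ T : FillingClass N, T.IsStandardTableau ∧ T.content = c := by
  obtain ⟨f, hf, hs, h⟩ := hc.exists_filling
  exact ⟨Quotient.mk _ f, ⟨f, hf, hs, rfl⟩, h⟩

end FillingClass

namespace LabelShape

variable (S : LabelShape)

/-! ### Paths in the labelled diagram -/

/-- The distance of a label to the label `0`. -/
def depth : Option S.Vert → ℕ
  | none => 0
  | some (Sum.inl a) => a
  | some (Sum.inr (Sum.inl b)) => b
  | some (Sum.inr (Sum.inr c)) => c

theorem depth_pred (j : S.Vert) : S.depth (some j) = S.depth (S.pred j) + 1 := by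
  rcases S.pred_cases j with ⟨rfl, h⟩ | ⟨p, h, ⟨a, b, rfl, rfl, e⟩ | ⟨a, b, rfl, rfl, e⟩ |
    ⟨a, b, rfl, rfl, e⟩ | ⟨a, b, rfl, rfl, e, e'⟩ | ⟨a, b, rfl, rfl, e, e'⟩⟩ <;>
    rw [h] <;> simp only [depth, one] <;> omega

theorem pred_eq_none_iff (j : S.Vert) : S.pred j = none ↔ j = S.one := by
  rcases S.pred_cases j with ⟨rfl, h⟩ | ⟨p, h, h'⟩
  · simp [h]
  · simp only [h, reduceCtorEq, false_iff]
    rintro rfl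
    have : S.pred S.one = none := dif_neg (by simp)
    simp [this] at h

theorem cartan_self (i : S.Vert) : S.cartan i i = 2 := by simp [cartan]

theorem cartan_pred {i j : S.Vert} (h : S.pred j = some i) : S.cartan i j = -1 := by
  have h1 := S.depth_pred j
  rw [h] at h1
  have hij : i ≠ j := by rintro rfl; omega
  simp [cartan, hij, h]

/-- The labels `p 0, …, p N` are those of a path that starts at the label `0`. -/
structure IsPath (p : ℕ → Option S.Vert) (N : ℕ) : Prop where
  zero : p 0 = none
  succ : ∀ m < N, ∃ v, p (m + 1) = some v ∧ S.pred v = p m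

namespace IsPath

variable {S} {p : ℕ → Option S.Vert} {N : ℕ}

theorem depth_eq (hp : S.IsPath p N) {m : ℕ} (hm : m ≤ N) : S.depth (p m) = m := by
  induction m with
  | zero => rw [hp.zero]; rfl
  | succ m ih =>
    obtain ⟨v, h1, h2⟩ := hp.succ m hm
    rw [h1, depth_pred, h2, ih (by omega)]

theorem injective (hp : S.IsPath p N) {m n : ℕ} (hm : m ≤ N) (hn : n ≤ N) (h : p m = p n) :
    m = n := by
  rw [← hp.depth_eq hm, ← hp.depth_eq hn, h]

end IsPath

theorem isPath_lab1 : S.IsPath S.lab1 S.l where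
  zero := dif_neg (by simp)
  succ m hm := ⟨Sum.inl ⟨m + 1, Finset.mem_Icc.2 ⟨by omega, hm⟩⟩, dif_pos _, rfl⟩

theorem lab2_of_le {m : ℕ} (h : m ≤ 1) : S.lab2 m = S.lab1 m :=
  dif_neg (by simp only [Finset.mem_Icc]; omega)

theorem lab3_of_le {m : ℕ} (h : m ≤ S.k) : S.lab3 m = S.lab1 m :=
  dif_neg (by simp only [Finset.mem_Icc]; omega)

theorem isPath_lab2 : S.IsPath S.lab2 S.l' where
  zero := (S.lab2_of_le (by omega)).trans S.isPath_lab1.zero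
  succ m hm := by
    rcases Nat.eq_zero_or_pos m with rfl | h
    · rw [S.lab2_of_le le_rfl, S.lab2_of_le zero_le_one]
      exact S.isPath_lab1.succ 0 S.one_le_l
    · exact ⟨Sum.inr (Sum.inl ⟨m + 1, Finset.mem_Icc.2 ⟨by omega, hm⟩⟩), dif_pos _, rfl⟩

theorem isPath_lab3 : S.IsPath S.lab3 S.l'' where
  zero := (S.lab3_of_le (by omega)).trans S.isPath_lab1.zero
  succ m hm := by
    by_cases h : m < S.k
    · rw [S.lab3_of_le h, S.lab3_of_le h.le]
      exact S.isPath_lab1.succ m (h.trans_le S.k_le_l)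
    · exact ⟨Sum.inr (Sum.inr ⟨m + 1, Finset.mem_Icc.2 ⟨by omega, hm⟩⟩), dif_pos _, rfl⟩

theorem exists_path (j : S.Vert) : ∃ p N, ((p = S.lab1 ∧ N = S.l) ∨ (p = S.lab2 ∧ N = S.l') ∨
    (p = S.lab3 ∧ N = S.l'')) ∧ ∃ m < N, p (m + 1) = some j := by
  rcases j with ⟨a, ha⟩ | ⟨a, ha⟩ | ⟨a, ha⟩ <;> have ha' := Finset.mem_Icc.1 ha
  · refine ⟨_, _, Or.inl ⟨rfl, rfl⟩, a - 1, by omega, ?_⟩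
    rw [Nat.sub_add_cancel (by omega)]
    exact dif_pos _
  · refine ⟨_, _, Or.inr (Or.inl ⟨rfl, rfl⟩), a - 1, by omega, ?_⟩
    rw [Nat.sub_add_cancel (by omega)]
    exact dif_pos _
  · refine ⟨_, _, Or.inr (Or.inr ⟨rfl, rfl⟩), a - 1, by omega, ?_⟩
    rw [Nat.sub_add_cancel (by omega)]
    exact dif_pos _

/-! ### The action of the simple reflections on sequences -/

theorem coroot_eps (i : S.Vert) : S.coroot i S.eps = if i = S.one then -1 else 0 := by
  simp only [coroot, eps]
  split_ifs <;> simp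

theorem coroot_alpha (i j : S.Vert) : S.coroot i (S.alpha j) = S.cartan i j :=
  S.rootDatum.coroot_root i j

/-- Seen along a path, the `δ` behave like the standard basis of type `A`: the reflection of a
vertex of the path exchanges two consecutive ones. This fails for labels off the path, which is why
each path is treated separately. -/
theorem IsPath.coroot_delta {p : ℕ → Option S.Vert} {N : ℕ} (hp : S.IsPath p N) {m n : ℕ}
    (hm : m < N) (hn : n ≤ N) {v : S.Vert} (hv : p (m + 1) = some v) :
    S.coroot v (S.delta (p n)) =
      (if n = m + 1 then 1 else 0) - (if n = m then 1 else 0) := by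
  have hpv : S.pred v = p m := by
    obtain ⟨w, h1, h2⟩ := hp.succ m hm
    obtain rfl : w = v := by simpa [h1] using hv
    exact h2
  induction n with
  | zero =>
    rw [hp.zero, delta, coroot_eps]
    have : v = S.one ↔ m = 0 := by
      rw [← pred_eq_none_iff, hpv, ← hp.zero]
      exact ⟨fun h => hp.injective (by omega) (by omega) h, fun h => by rw [h]⟩
    simp only [this]
    by_cases h : m = 0 <;> simp [h, eq_comm]
  | succ n ih =>
    obtain ⟨w, h1, h2⟩ := hp.succ n hn
    rw [h1, delta_pred, map_add, h2, ih (by omega), coroot_alpha]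
    have e1 : v = w ↔ n = m := by
      rw [← Option.some_inj, ← hv, ← h1]
      exact ⟨fun h => by have := hp.injective (by omega) (by omega) h; omega, fun h => by rw [h]⟩
    have e2 : S.pred v = some w ↔ m = n + 1 := by
      rw [hpv, ← h1]
      exact ⟨fun h => hp.injective (by omega) (by omega) h, fun h => by rw [h]⟩
    have e3 : S.pred w = some v ↔ n = m + 1 := by
      rw [h2, ← hv]
      exact ⟨fun h => hp.injective (by omega) (by omega) h, fun h => by rw [h]⟩
    simp only [cartan, e1, e2, e3]
    split_ifs <;> omega

theorem reflection_apply (i : S.Vert) (x : S.L) :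
    S.rootDatum.reflection i x = x - S.coroot i x • S.alpha i := rfl

theorem reflection_inv (i : S.Vert) :
    (S.rootDatum.reflection i)⁻¹ = S.rootDatum.reflection i :=
  Module.reflection_symm _

/-- A character of `L` is determined by its values on the `δ_j`. -/
theorem char_of_delta (χ : AddChar S.L Kˣ) : S.char (fun j => χ (S.delta j)) = χ := by
  ext1 x
  have hx : x = x.1 • S.eps + ∑ i, x.2 i • S.alpha i := by
    ext i
    · simp [eps, alpha, Prod.fst_sum, -Fintype.sum_sum_type]
    · simp [eps, alpha, Prod.snd_sum, -Fintype.sum_sum_type, Pi.single_apply]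
  have halpha : ∀ i, χ (S.alpha i) = χ (S.delta (some i)) / χ (S.delta (S.pred i)) := fun i => by
    rw [delta_pred, AddChar.map_add_eq_mul, mul_div_cancel_left]
  have hsum : χ (∑ i, x.2 i • S.alpha i) = ∏ i, χ (S.alpha i) ^ x.2 i := by
    have := map_prod χ.toMonoidHom (fun i => Multiplicative.ofAdd (x.2 i • S.alpha i)) Finset.univ
    refine (congrArg χ.toMonoidHom (ofAdd_sum _ _)).trans (this.trans ?_)
    exact Finset.prod_congr rfl fun i _ => AddChar.map_zsmul_eq_zpow χ _ _
  conv_rhs => rw [hx, AddChar.map_add_eq_mul, hsum, AddChar.map_zsmul_eq_zpow]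
  simp only [halpha]
  rfl

theorem char_act (w : S.L ≃ₗ[ℤ] S.L) (s : S.Seq) (x : S.L) :
    S.char (S.act w s) x = S.char s (w⁻¹ x) := by
  have := S.char_of_delta ((S.char s).compAddMonoidHom (w⁻¹ : S.L ≃ₗ[ℤ] S.L).toAddMonoidHom)
  exact congrArg (fun χ : AddChar S.L Kˣ => χ x) this

theorem act_reflection (i : S.Vert) (s : S.Seq) (j : Option S.Vert) :
    S.act (S.rootDatum.reflection i) s j =
      s j / (s (some i) / s (S.pred i)) ^ S.coroot i (S.delta j) := by
  rw [act, reflection_inv, reflection_apply, AddChar.map_sub_eq_div, AddChar.map_zsmul_eq_zpow,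
    char_delta, char_alpha]

theorem act_act_reflection (i : S.Vert) (s : S.Seq) :
    S.act (S.rootDatum.reflection i) (S.act (S.rootDatum.reflection i) s) = s := by
  funext j
  rw [act, reflection_inv, char_act, reflection_inv]
  have : S.rootDatum.reflection i (S.rootDatum.reflection i (S.delta j)) = S.delta j :=
    Module.involutive_reflection _ _
  rw [this, char_delta]

/-- The conditions on a sequence that make the action of the generators well defined. -/
def Good (t : S.Seq) : Prop :=
  (∀ i, t (some i) ≠ t (S.pred i)) ∧ ∀ i j, S.pred j = some i → t (some j) ≠ t (S.pred i)

variable {S}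

theorem mem_truncOrbit_self (s : S.Seq) : s ∈ S.truncOrbit s := Relation.ReflTransGen.refl

theorem mem_truncOrbit_of_trunc {s t t' : S.Seq} {i : S.Vert} (ht : t ∈ S.truncOrbit s)
    (h : S.trunc i t = some t') : t' ∈ S.truncOrbit s := Relation.ReflTransGen.tail ht ⟨i, h⟩

theorem trunc_eq_some {t : S.Seq} {i : S.Vert}
    (h : ∀ e : ℤ, e = 1 ∨ e = -1 → t (some i) ≠ q ^ (2 * e) * t (S.pred i)) :
    S.trunc i t = some (S.act (S.rootDatum.reflection i) t) :=
  if_neg (not_or.2 ⟨h 1 (Or.inl rfl), h (-1) (Or.inr rfl)⟩)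

theorem IsPath.exists_swap {p : ℕ → Option S.Vert} {N : ℕ} (hp : S.IsPath p N) {s t : S.Seq}
    (ht : t ∈ S.truncOrbit s) {m : ℕ} (hm : m < N)
    (h : ∀ e : ℤ, e = 1 ∨ e = -1 → t (p (m + 1)) ≠ q ^ (2 * e) * t (p m)) :
    ∃ t' ∈ S.truncOrbit s, t' (p (m + 1)) = t (p m) ∧ t' (p m) = t (p (m + 1)) ∧
      ∀ n ≤ N, n ≠ m → n ≠ m + 1 → t' (p n) = t (p n) := by
  obtain ⟨v, h1, h2⟩ := hp.succ m hm
  have hc := fun {n : ℕ} (hn : n ≤ N) => hp.coroot_delta S hm hn h1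
  refine ⟨_, mem_truncOrbit_of_trunc ht (trunc_eq_some (i := v) (by rw [← h1, h2]; exact h)),
    ?_, ?_, fun n hn h3 h4 => ?_⟩
  · rw [act_reflection, hc (by omega), h2, ← h1]
    simp
  · rw [act_reflection, hc (by omega), h2, ← h1]
    simp
  · rw [act_reflection, hc hn]
    simp [h3, h4]

/-- If the whole truncated orbit satisfies the local conditions, then the values of its elements
along every path are interlaced. -/
theorem IsPath.interlaced_of_good {p : ℕ → Option S.Vert} {N : ℕ} (hp : S.IsPath p N) {s : S.Seq}
    (hs : ∀ t ∈ S.truncOrbit s, S.Good t) : Interlaced fun m : Fin (N + 1) => s (p m) := by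
  suffices key : ∀ g, ∀ t ∈ S.truncOrbit s, ∀ i, i + g ≤ N → 0 < g → t (p i) = t (p (i + g)) →
      ∀ e : ℤ, e = 1 ∨ e = -1 → ∃ m, i < m ∧ m < i + g ∧ t (p m) = q ^ (2 * e) * t (p i) by
    intro i j hij h e he
    obtain ⟨m, h1, h2, h3⟩ := key (j - i) s (mem_truncOrbit_self s) i (by omega) (by omega)
      (by rw [Nat.add_sub_cancel' (by omega)]; exact h) e he
    exact ⟨⟨m, by omega⟩, Fin.lt_def.2 h1, Fin.lt_def.2 (by simp only; omega), h3⟩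
  intro g
  induction g using Nat.strong_induction_on with
  | _ g ih =>
  intro t ht i hi hg heq
  have hneg : ∀ e : ℤ, e = 1 ∨ e = -1 → -e = 1 ∨ -e = -1 := by omega
  have hflip : ∀ (e : ℤ) (a b : Kˣ), a = q ^ (2 * e) * b → b = q ^ (2 * -e) * a := by
    rintro e a b rfl
    rw [← mul_assoc, ← zpow_add]
    simp
  obtain ⟨hg1, hg2⟩ := hs t ht
  have hstep : ∀ m < N, t (p (m + 1)) ≠ t (p m) := fun m hm => by
    obtain ⟨v, h1, h2⟩ := hp.succ m hm
    rw [h1, ← h2]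
    exact hg1 v
  have hne1 : g ≠ 1 := by
    rintro rfl
    exact hstep i (by omega) heq.symm
  -- If an end of the interval can be exchanged with its inner neighbour, the two equal values come
  -- closer and the induction applies to the new element of the orbit.
  by_cases hl : ∀ e : ℤ, e = 1 ∨ e = -1 → t (p (i + 1)) ≠ q ^ (2 * e) * t (p i)
  · obtain ⟨t', ht', h1, -, h3⟩ := hp.exists_swap ht (by omega) hl
    intro e he
    obtain ⟨m, hm1, hm2, hm3⟩ := ih (g - 1) (by omega) t' ht' (i + 1) (by omega) (by omega)
      (by rw [h1, heq, show i + 1 + (g - 1) = i + g by omega,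
            h3 _ hi (by omega) (by omega)]) e he
    exact ⟨m, by omega, by omega, by rw [← h3 m (by omega) (by omega) (by omega), hm3, h1]⟩
  by_cases hr : ∀ e : ℤ, e = 1 ∨ e = -1 →
      t (p (i + g - 1 + 1)) ≠ q ^ (2 * e) * t (p (i + g - 1))
  · obtain ⟨t', ht', -, h2, h3⟩ := hp.exists_swap ht (by omega) hr
    rw [Nat.sub_add_cancel (by omega)] at h2
    intro e he
    have h4 := h3 i (by omega) (by omega) (by omega)
    obtain ⟨m, hm1, hm2, hm3⟩ := ih (g - 1) (by omega) t' ht' i (by omega) (by omega)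
      (by rw [h4, ← Nat.add_sub_assoc (by omega), h2, heq]) e he
    exact ⟨m, by omega, by omega, by rw [← h3 m (by omega) (by omega) (by omega), hm3, h4]⟩
  push Not at hl hr
  obtain ⟨a, ha, hla⟩ := hl
  obtain ⟨b, hb, hrb⟩ := hr
  rw [Nat.sub_add_cancel (by omega), ← heq] at hrb
  replace hrb := hflip _ _ _ hrb
  -- Both inner neighbours are now `q^{±2}` times the common value. If the signs differ, they are
  -- the two required entries. If they agree, the inner neighbours form a pair of equal values at
  -- distance `g - 2`.
  by_cases hab : a = -b
  · rw [← hab, ← hla] at hrb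
    -- Here the inner neighbours coincide, and equal values at distance two contradict goodness.
    by_cases hg2' : g = 2
    · exfalso
      subst hg2'
      obtain ⟨v, h1, h2⟩ := hp.succ i (by omega)
      obtain ⟨w, h3, h4⟩ := hp.succ (i + 1) (by omega)
      refine hg2 v w (h4.trans h1) ?_
      rw [← h3, h2]
      exact heq.symm
    have hg3 : i + 1 + (g - 2) = i + g - 1 := by omega
    -- Between the inner neighbours the original value must occur again, at `m`; the pair `i`, `m`
    -- is closer, so the induction supplies both entries between them.
    obtain ⟨m, hm1, hm2, hm3⟩ := ih (g - 2) (by omega) t ht (i + 1) (by omega) (by omega)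
      (by rw [hg3]; exact hrb.symm) (-a) (hneg a ha)
    rw [← hflip _ _ _ hla] at hm3
    have him : i + (m - i) = m := by omega
    intro e he
    obtain ⟨m', h1, h2, h3⟩ := ih (m - i) (by omega) t ht i (by omega) (by omega)
      (by rw [him]; exact hm3.symm) e he
    exact ⟨m', h1, by omega, h3⟩
  · intro e he
    rcases (show e = a ∨ e = -b by omega) with rfl | rfl
    · exact ⟨i + 1, by omega, by omega, hla⟩
    · exact ⟨i + g - 1, by omega, by omega, hrb⟩

end LabelShape

namespace LabelShape

variable {S : LabelShape}

/-! ### Standard tableaux of type `(R,v)` and their sequences of contents -/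

namespace STab

theorem seq_lab1 (T : S.STab) (m : Fin (S.l + 1)) : T.seq (S.lab1 m) = T.T1.content m := by
  obtain ⟨m, hm⟩ := m
  rcases Nat.eq_zero_or_pos m with rfl | h
  · rw [S.isPath_lab1.zero]
    rfl
  · have : S.lab1 m = some (Sum.inl ⟨m, Finset.mem_Icc.2 ⟨h, by omega⟩⟩) := dif_pos _
    rw [this]
    rfl

theorem seq_lab2 (T : S.STab) (m : Fin (S.l' + 1)) : T.seq (S.lab2 m) = T.T2.content m := by
  obtain ⟨m, hm⟩ := m
  rcases Nat.lt_or_ge m 2 with h | h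
  · rw [S.lab2_of_le (by omega : m ≤ 1)]
    have h1 := congrArg (fun F => F.content ⟨m, h⟩) T.agree12
    simp only [FillingClass.content_restrict] at h1
    exact (T.seq_lab1 ⟨m, lt_of_lt_of_le h (Nat.succ_le_succ S.one_le_l)⟩).trans h1
  · have : S.lab2 m = some (Sum.inr (Sum.inl ⟨m, Finset.mem_Icc.2 ⟨h, by omega⟩⟩)) := dif_pos _
    rw [this]
    rfl

theorem seq_lab3 (T : S.STab) (m : Fin (S.l'' + 1)) : T.seq (S.lab3 m) = T.T3.content m := by
  obtain ⟨m, hm⟩ := m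
  rcases Nat.lt_or_ge m (S.k + 1) with h | h
  · rw [S.lab3_of_le (by omega : m ≤ S.k)]
    have h1 := congrArg (fun F => F.content ⟨m, h⟩) T.agree13
    simp only [FillingClass.content_restrict] at h1
    exact (T.seq_lab1 ⟨m, lt_of_lt_of_le h (Nat.succ_le_succ S.k_le_l)⟩).trans h1
  · have : S.lab3 m = some (Sum.inr (Sum.inr ⟨m, Finset.mem_Icc.2 ⟨h, by omega⟩⟩)) := dif_pos _
    rw [this]
    rfl

theorem seq_injective : Function.Injective (STab.seq (S := S)) := by
  intro T T' h
  ext1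
  · refine T.standard1.eq_of_content_eq T'.standard1 (funext fun m => ?_)
    rw [← seq_lab1, ← seq_lab1, h]
  · refine T.standard2.eq_of_content_eq T'.standard2 (funext fun m => ?_)
    rw [← seq_lab2, ← seq_lab2, h]
  · refine T.standard3.eq_of_content_eq T'.standard3 (funext fun m => ?_)
    rw [← seq_lab3, ← seq_lab3, h]

/-- The three tableaux are built independently; they agree on their common numbers because a tableau
is determined by its contents. -/
theorem exists_seq_eq {s : S.Seq} (h1 : Interlaced fun m : Fin (S.l + 1) => s (S.lab1 m))
    (h2 : Interlaced fun m : Fin (S.l' + 1) => s (S.lab2 m))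
    (h3 : Interlaced fun m : Fin (S.l'' + 1) => s (S.lab3 m)) : ∃ T : S.STab, T.seq = s := by
  obtain ⟨T1, hT1, e1⟩ := FillingClass.exists_of_interlaced h1
  obtain ⟨T2, hT2, e2⟩ := FillingClass.exists_of_interlaced h2
  obtain ⟨T3, hT3, e3⟩ := FillingClass.exists_of_interlaced h3
  refine ⟨⟨T1, T2, T3, hT1, hT2, hT3,
    (hT1.restrict _).eq_of_content_eq (hT2.restrict _) (funext fun m => ?_),
    (hT1.restrict _).eq_of_content_eq (hT3.restrict _) (funext fun m => ?_)⟩, ?_⟩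
  · rw [FillingClass.content_restrict, FillingClass.content_restrict, e1, e2]
    exact congrArg s (S.lab2_of_le (Nat.lt_succ_iff.1 m.2)).symm
  · rw [FillingClass.content_restrict, FillingClass.content_restrict, e1, e3]
    exact congrArg s (S.lab3_of_le (Nat.lt_succ_iff.1 m.2)).symm
  · funext j
    rcases j with _ | ⟨a, ha⟩ | ⟨a, ha⟩ | ⟨a, ha⟩
    · change T1.content 0 = _
      rw [e1]
      exact congrArg s S.isPath_lab1.zero
    · change T1.content _ = _
      rw [e1]
      exact congrArg s (dif_pos ha)
    · change T2.content _ = _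
      rw [e2]
      exact congrArg s (dif_pos ha)
    · change T3.content _ = _
      rw [e3]
      exact congrArg s (dif_pos ha)

/-- Equal values at distance one leave no room for a separating entry; at distance two there is a
single position for both the `q²` and the `q⁻²` entry. -/
theorem good_seq (T : S.STab) : S.Good T.seq := by
  have hI : ∀ p N, ((p = S.lab1 ∧ N = S.l) ∨ (p = S.lab2 ∧ N = S.l') ∨
      (p = S.lab3 ∧ N = S.l'')) → S.IsPath p N ∧ Interlaced fun m : Fin (N + 1) => T.seq (p m) := by
    rintro p N (⟨rfl, rfl⟩ | ⟨rfl, rfl⟩ | ⟨rfl, rfl⟩)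
    · refine ⟨S.isPath_lab1, ?_⟩
      simpa only [seq_lab1] using T.standard1.interlaced
    · refine ⟨S.isPath_lab2, ?_⟩
      simpa only [seq_lab2] using T.standard2.interlaced
    · refine ⟨S.isPath_lab3, ?_⟩
      simpa only [seq_lab3] using T.standard3.interlaced
  have hpred : ∀ {p N}, S.IsPath p N → ∀ {m v}, m < N → p (m + 1) = some v → S.pred v = p m := by
    intro p N hp m v hm hv
    obtain ⟨w, h1, h2⟩ := hp.succ m hm
    obtain rfl : w = v := by simpa [h1] using hv
    exact h2
  constructor
  · intro i h
    obtain ⟨p, N, hp, m, hm, hi⟩ := S.exists_path i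
    obtain ⟨hP, hint⟩ := hI p N hp
    rw [hpred hP hm hi, ← hi] at h
    obtain ⟨n, h1, h2, -⟩ := hint ⟨m, by omega⟩ ⟨m + 1, by omega⟩ (Fin.lt_def.2 (by simp)) h.symm
      1 (Or.inl rfl)
    rw [Fin.lt_def] at h1 h2
    simp only at h1 h2
    omega
  · intro i j hij h
    obtain ⟨p, N, hp, m, hm, hj⟩ := S.exists_path j
    obtain ⟨hP, hint⟩ := hI p N hp
    have h1 := hpred hP hm hj
    rw [hij] at h1
    rcases m with _ | m
    · simp [hP.zero] at h1
    have h2 := hpred hP (m := m) (by omega) h1.symm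
    rw [h2, ← hj] at h
    have key : ∀ e : ℤ, e = 1 ∨ e = -1 → T.seq (p (m + 1)) = q ^ (2 * e) * T.seq (p m) := by
      intro e he
      obtain ⟨n, h3, h4, h5⟩ := hint ⟨m, by omega⟩ ⟨m + 1 + 1, by omega⟩
        (Fin.lt_def.2 (by simp only; omega)) h.symm e he
      rw [Fin.lt_def] at h3 h4
      simp only at h3 h4
      have : (n : ℕ) = m + 1 := by omega
      rw [← this]
      exact h5
    have h6 := (key 1 (Or.inl rfl)).symm.trans (key (-1) (Or.inr rfl))
    have := q_zpow_injective (mul_right_cancel h6)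
    omega

/-- A tableau is admissible as soon as the local conditions hold on its truncated orbit. -/
theorem exists_admissible {s : S.Seq} (hs : ∀ t ∈ S.truncOrbit s, S.Good t) :
    ∃ T : S.STab, T.IsAdmissible ∧ T.seq = s := by
  have key : ∀ t ∈ S.truncOrbit s, ∃ T : S.STab, T.seq = t := by
    intro t ht
    have ht' : ∀ t' ∈ S.truncOrbit t, S.Good t' := fun t' h =>
      hs t' (Relation.ReflTransGen.trans ht h)
    exact exists_seq_eq (S.isPath_lab1.interlaced_of_good ht')
      (S.isPath_lab2.interlaced_of_good ht') (S.isPath_lab3.interlaced_of_good ht')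
  obtain ⟨T, hT⟩ := key s (mem_truncOrbit_self s)
  exact ⟨T, fun t ht => key t (by rwa [← hT]), hT⟩

end STab

theorem IsAdmissibleOrbit.good {O : Set S.Seq} (hO : S.IsAdmissibleOrbit O) :
    ∀ t ∈ O, S.Good t := by
  obtain ⟨T, hT, rfl⟩ := hO
  intro t ht
  obtain ⟨T', rfl⟩ := hT t ht
  exact T'.good_seq

/-! ### The invariant `Δ` -/

variable (S)

/-- Summation by parts, from `α_i = δ_i - δ_{i-1}`. It turns the product defining `Δ(s)` into the
value of a character. -/
theorem DeltaL_eq_sum_kappa : S.DeltaL = ∑ j, S.kappa j • S.delta j := by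
  have h1 : ∀ i, S.alpha i = S.delta (some i) - S.delta (S.pred i) := fun i => by
    rw [delta_pred, add_sub_cancel_left]
  have h2 : ∑ j, (∑ i ∈ Finset.univ.filter (fun i => S.pred i = j), S.n (some i)) • S.delta j =
      ∑ i, S.n (some i) • S.delta (S.pred i) := by
    simp only [Finset.sum_smul, Finset.sum_filter]
    rw [Finset.sum_comm]
    refine Finset.sum_congr rfl fun i _ => ?_
    simp only [ite_smul, zero_smul]
    rw [Finset.sum_ite_eq]
    simp
  simp only [kappa, sub_smul, Finset.sum_sub_distrib, h2]
  rw [Fintype.sum_option]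
  simp only [DeltaL, h1, smul_sub, Finset.sum_sub_distrib]
  simp only [delta]
  abel

theorem Delta_eq_char (s : S.Seq) : S.Delta s = S.char s S.DeltaL := by
  rw [DeltaL_eq_sum_kappa]
  have := map_prod (S.char s).toMonoidHom
    (fun j => Multiplicative.ofAdd (S.kappa j • S.delta j)) Finset.univ
  refine Eq.symm ((congrArg (S.char s).toMonoidHom (ofAdd_sum _ _)).trans (this.trans ?_))
  exact Finset.prod_congr rfl fun j _ =>
    (AddChar.map_zsmul_eq_zpow _ _ _).trans (congrArg (· ^ S.kappa j) (S.char_delta s j))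

theorem n0_pos : 0 < S.n0 := by
  rw [n0, Nat.pos_iff_ne_zero, Ne, Finset.lcm_eq_zero_iff]
  simp

/-- `n0` clears the denominators, so the floor in the definition of `n` loses nothing. -/
theorem n_eq (i : S.Vert) : (S.n (some i) : ℚ) = S.n0 * S.omega i := by
  have hd : (S.omega i).den ∣ S.n0 := Finset.dvd_lcm (Finset.mem_univ i)
  obtain ⟨c, hc⟩ := hd
  have : (S.n0 : ℚ) * S.omega i = ((c * (S.omega i).num : ℤ) : ℚ) := by
    rw [hc]
    push_cast
    rw [mul_comm ((S.omega i).den : ℚ), mul_assoc, Rat.den_mul_eq_num]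
  rw [n, this, Int.floor_intCast]

theorem DeltaL_eq : S.DeltaL = ((S.n0 : ℤ), fun i => S.n (some i)) := by
  ext i
  · simp [DeltaL, eps, alpha, Prod.fst_sum, -Fintype.sum_sum_type, n]
  · simp [DeltaL, eps, alpha, Prod.snd_sum, -Fintype.sum_sum_type, Pi.single_apply]

end LabelShape

/-! ### The kernel of `φ` and the Weyl invariance of `Δ` -/

namespace Labelling

variable {ι M N : Type*} [AddCommGroup M] [Module ℝ M] [AddCommGroup N] [Module ℝ N]
  {P : RootPairing ι ℝ M N} [P.IsCrystallographic] {b : P.Base} {v : b.support}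
  (D : Labelling b v)

theorem phi_coe (x : D.L) :
    ((D.phi x : D.Lbar) : D.Vert → ℚ) = fun i => -(x.1 : ℚ) * D.omega i + x.2 i := by
  funext i
  simp [phi, -Fintype.sum_sum_type, Pi.single_apply]

theorem phi_surjective : Function.Surjective D.phi := by
  have hle : D.Lbar ≤ (LinearMap.range D.phi).map D.Lbar.subtype := by
    refine Submodule.span_le.2 ?_
    rintro y (⟨j, rfl⟩ | rfl)
    · refine ⟨_, ⟨D.alpha j, rfl⟩, ?_⟩
      funext i
      simp [phi_coe, LabelShape.alpha, Pi.single_apply]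
    · refine ⟨_, ⟨-D.eps, rfl⟩, ?_⟩
      funext i
      simp [phi_coe, LabelShape.eps]
  intro y
  obtain ⟨_, ⟨x, rfl⟩, hx⟩ := hle y.2
  exact ⟨x, Subtype.ext hx⟩

theorem phi_DeltaL : D.phi D.DeltaL = 0 := by
  ext i
  rw [phi_coe, LabelShape.DeltaL_eq]
  simp only [LabelShape.n_eq]
  simp

/-- The coefficient of `ε` times `ω` has integral coordinates, so it is divisible by all reduced
denominators, hence by their lcm `n0`; this coefficient determines the rest. -/
theorem phi_eq_zero {x : D.L} (h : D.phi x = 0) : ∃ m : ℤ, x = m • D.DeltaL := by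
  have h1 : ∀ i, (x.2 i : ℚ) = x.1 * D.omega i := fun i => by
    have := congrArg (fun y : D.Lbar => (y : D.Vert → ℚ) i) h
    simp only [phi_coe] at this
    simp only [neg_mul, ZeroMemClass.coe_zero, Pi.zero_apply] at this
    linarith
  have h2 : D.n0 ∣ x.1.natAbs := by
    refine Finset.lcm_dvd fun i _ => ?_
    have h3 : (x.2 i : ℤ) * (D.omega i).den = x.1 * (D.omega i).num := by
      have := h1 i
      rw [← Rat.num_div_den (D.omega i), mul_div_assoc', eq_div_iff (by simp)] at this
      exact_mod_cast this
    have h4 : ((D.omega i).den : ℤ) ∣ x.1 * (D.omega i).num := ⟨x.2 i, by rw [← h3, mul_comm]⟩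
    have h5 : IsCoprime ((D.omega i).den : ℤ) (D.omega i).num :=
      (Int.isCoprime_iff_nat_coprime.2 (by simpa using (D.omega i).reduced)).symm
    exact Int.natCast_dvd.1 (h5.dvd_of_dvd_mul_right h4)
  obtain ⟨m, hm⟩ := Int.natCast_dvd.2 h2
  refine ⟨m, ?_⟩
  rw [LabelShape.DeltaL_eq]
  ext i
  · simp [hm, mul_comm]
  · have h3 : (x.2 i : ℚ) = ((m * D.n (some i) : ℤ) : ℚ) := by
      push_cast
      rw [LabelShape.n_eq, h1, hm]
      push_cast
      ring
    simpa using (by exact_mod_cast h3 : x.2 i = m * D.n (some i))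

variable [Finite ι] [P.IsRootSystem]

theorem coroot_DeltaL (i : D.Vert) : D.coroot i D.DeltaL = 0 := by
  have := D.coroot_phi i D.DeltaL
  rw [phi_DeltaL, map_zero] at this
  exact this.symm

theorem weylGroup_DeltaL {w : D.L ≃ₗ[ℤ] D.L} (hw : w ∈ D.rootDatum.weylGroup) :
    w D.DeltaL = D.DeltaL := by
  have hle : D.rootDatum.weylGroup ≤ MulAction.stabilizer (D.L ≃ₗ[ℤ] D.L) D.DeltaL := by
    refine (Subgroup.closure_le _).2 ?_
    rintro _ ⟨i, rfl⟩
    change D.rootDatum.reflection i D.DeltaL = _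
    rw [LabelShape.reflection_apply, coroot_DeltaL, zero_smul, sub_zero]
  exact hle hw

theorem Delta_act {w : D.L ≃ₗ[ℤ] D.L} (hw : w ∈ D.rootDatum.weylGroup) (s : D.Seq) :
    D.Delta (D.act w s) = D.Delta s := by
  rw [LabelShape.Delta_eq_char, LabelShape.Delta_eq_char, LabelShape.char_act,
    D.weylGroup_DeltaL (inv_mem hw)]

theorem Delta_eq_of_mem_truncOrbit {s t : D.Seq} (ht : t ∈ D.truncOrbit s) :
    D.Delta t = D.Delta s := by
  induction ht with
  | refl => rfl
  | tail _ h ih =>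
    obtain ⟨i, hi⟩ := h
    simp only [LabelShape.trunc] at hi
    split_ifs at hi
    rw [← Option.some.inj hi, D.Delta_act (Subgroup.subset_closure ⟨i, rfl⟩), ih]

end Labelling


/-! ### The structure coefficients -/

/-- The standard algebra structure, preferred to the one that comes from polynomials. -/
scoped instance natAlgebraK : Algebra ℕ K := Semiring.toNatAlgebra

/-- The standard algebra structure, preferred to the one that comes from polynomials. -/
scoped instance intAlgebraK : Algebra ℤ K := Ring.toIntAlgebra K

theorem q_ne_zero : (q : K) ≠ 0 := q.ne_zero

theorem q_sq_ne_one : (q : K) ^ 2 ≠ 1 := fun h => by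
  have h1 : q ^ (2 : ℤ) = 1 := Units.ext (by simpa using h)
  have := q_zpow_eq_one h1
  omega

theorem q_sq_ne_neg_one : (q : K) ^ 2 ≠ -1 := fun h => by
  have h2 : (q : K) ^ 4 = 1 := by
    rw [show 4 = 2 * 2 from rfl, pow_mul, h]
    ring
  have h1 : q ^ (4 : ℤ) = 1 := Units.ext (by simpa using h2)
  have := q_zpow_eq_one h1
  omega

theorem q_sub_inv_ne_zero : (q : K) - (q : K)⁻¹ ≠ 0 := fun h => by
  have h1 := mul_inv_cancel₀ q_ne_zero
  rw [← sub_eq_zero.1 h, ← pow_two] at h1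
  exact q_sq_ne_one h1

/-- The diagonal coefficient of `g_i`, as a function of `a = χ(α_i)`. -/
def diagCoeff (a : K) : K := ((q : K) - (q : K)⁻¹) * a / (a - 1)

/-- The off-diagonal coefficient of `g_i`, as a function of `a = χ(α_i)`. -/
def offCoeff (a : K) : K := ((q : K) * a - (q : K)⁻¹) / (a - 1)

open Classical in
/-- The off-diagonal coefficient of `g_i`, replaced by `0` when `r_i` is truncated. -/
def truncCoeff (a : K) : K :=
  if a = (q : K) ^ 2 ∨ a = ((q : K) ^ 2)⁻¹ then 0 else offCoeff a

/-- At `a = q^{±2}` one factor on the right already vanishes, so also setting the other to zero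
changes nothing. This is why truncated operators satisfy the same relations. -/
theorem truncCoeff_mul_inv (a : K) :
    truncCoeff a * truncCoeff a⁻¹ = offCoeff a * offCoeff a⁻¹ := by
  have hq := q_ne_zero
  unfold truncCoeff
  by_cases h : a = (q : K) ^ 2 ∨ a = ((q : K) ^ 2)⁻¹
  · have h0 : offCoeff ((q : K) ^ 2)⁻¹ = 0 := by
      rw [offCoeff, div_eq_zero_iff]
      left
      field_simp
      ring
    rw [if_pos h, zero_mul]
    rcases h with rfl | rfl
    · rw [h0, mul_zero]
    · rw [h0, zero_mul]
  · have h' : ¬ (a⁻¹ = (q : K) ^ 2 ∨ a⁻¹ = ((q : K) ^ 2)⁻¹) := by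
      rintro (h1 | h1)
      · exact h (Or.inr (by rw [← h1, inv_inv]))
      · exact h (Or.inl (inv_injective h1))
    rw [if_neg h, if_neg h']

theorem truncCoeff_inv_ne_zero {a : K} (h : truncCoeff a ≠ 0) : truncCoeff a⁻¹ ≠ 0 := by
  have hq := q_ne_zero
  unfold truncCoeff at h ⊢
  by_cases ha : a = (q : K) ^ 2 ∨ a = ((q : K) ^ 2)⁻¹
  · exact absurd (if_pos ha) h
  rw [if_neg ha] at h
  rw [if_neg fun h1 => ha (h1.symm.imp (fun h2 => inv_injective h2) fun h2 => by
    rw [← h2, inv_inv])]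
  intro h1
  rw [offCoeff, div_eq_zero_iff] at h1
  rcases h1 with h1 | h1
  · refine ha (Or.inl ?_)
    have h2 : a⁻¹ = ((q : K) ^ 2)⁻¹ := by
      rw [sub_eq_zero] at h1
      field_simp at h1 ⊢
      linear_combination h1
    exact inv_injective h2
  -- The case `a = 1`, where division by zero gives `offCoeff a = 0`.
  · refine h ?_
    rw [offCoeff, ← inv_inv a, sub_eq_zero.1 h1]
    simp

theorem diagCoeff_add_inv {a : K} (h0 : a ≠ 0) (h1 : a ≠ 1) :
    diagCoeff a + diagCoeff a⁻¹ = (q : K) - (q : K)⁻¹ := by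
  have hq := q_ne_zero
  have h2 : a - 1 ≠ 0 := sub_ne_zero.2 h1
  have h3 : 1 - a ≠ 0 := sub_ne_zero.2 h1.symm
  have h4 : a⁻¹ - 1 = (1 - a) / a := by field_simp
  rw [diagCoeff, diagCoeff, h4]
  field_simp
  ring

theorem diagCoeff_quadratic {a : K} (h0 : a ≠ 0) (h1 : a ≠ 1) :
    diagCoeff a * diagCoeff a + truncCoeff a * truncCoeff a⁻¹ =
      ((q : K) - (q : K)⁻¹) * diagCoeff a + 1 := by
  have hq := q_ne_zero
  have h2 : a - 1 ≠ 0 := sub_ne_zero.2 h1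
  have h3 : 1 - a ≠ 0 := sub_ne_zero.2 h1.symm
  have h4 : a⁻¹ - 1 = (1 - a) / a := by field_simp
  rw [truncCoeff_mul_inv, diagCoeff, offCoeff, offCoeff, h4]
  field_simp
  ring

/-- The comparison of the coefficients at `v_{r_i(s)}` in the braid relation; the denominators are
the reason for the conditions in `LabelShape.Good`. -/
theorem diagCoeff_braid {a b : K} (ha0 : a ≠ 0) (ha : a ≠ 1) (hb : b ≠ 1) (hab : a * b ≠ 1) :
    diagCoeff a * diagCoeff b + diagCoeff (a * b) * diagCoeff a⁻¹ =
      diagCoeff b * diagCoeff (a * b) := by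
  have hq := q_ne_zero
  have h2 : a - 1 ≠ 0 := sub_ne_zero.2 ha
  have h2' : b - 1 ≠ 0 := sub_ne_zero.2 hb
  have h2'' : a * b - 1 ≠ 0 := sub_ne_zero.2 hab
  have h3 : 1 - a ≠ 0 := sub_ne_zero.2 ha.symm
  have h4 : a⁻¹ - 1 = (1 - a) / a := by field_simp
  rw [diagCoeff, diagCoeff, diagCoeff, diagCoeff, h4]
  field_simp
  ring

/-- The comparison at `v_s` itself. Being a consequence of the quadratic identity and of
`diagCoeff_braid`, it needs no case distinction on truncation. -/
theorem diagCoeff_braid_diag {a b : K} (ha0 : a ≠ 0) (hb0 : b ≠ 0) (ha : a ≠ 1) (hb : b ≠ 1)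
    (hab : a * b ≠ 1) :
    diagCoeff a * diagCoeff b * diagCoeff a +
        truncCoeff a * diagCoeff (a * b) * truncCoeff a⁻¹ =
      diagCoeff b * diagCoeff a * diagCoeff b +
        truncCoeff b * diagCoeff (a * b) * truncCoeff b⁻¹ := by
  have ea := diagCoeff_quadratic ha0 ha
  have eb := diagCoeff_quadratic hb0 hb
  have e1 := diagCoeff_braid ha0 ha hb hab
  have e2 := diagCoeff_braid hb0 hb ha (by rwa [mul_comm])
  rw [mul_comm b a] at e2
  have e3 := diagCoeff_add_inv ha0 ha
  have e4 := diagCoeff_add_inv hb0 hb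
  linear_combination diagCoeff (a * b) * ea - diagCoeff (a * b) * eb + diagCoeff a * e1
    - diagCoeff b * e2 - diagCoeff (a * b) * diagCoeff a * e3
    + diagCoeff (a * b) * diagCoeff b * e4

/-! ### The Lusztig relation on weights -/

namespace RootDatum

variable {I : Type} {C : Matrix I I ℤ} {T : Type} [AddCommGroup T] (D : RootDatum C T)

theorem reflection_apply (i : I) (x : T) : D.reflection i x = x - D.coroot i x • D.root i := rfl

theorem reflection_reflection (i : I) (x : T) : D.reflection i (D.reflection i x) = x :=
  Module.involutive_reflection _ _

/-- The scalar by which `(X^x - X^{r_i(x)}) / (1 - X^{-α_i})` acts on vectors of weight `χ`. -/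
def lusztigScalar (i : I) (χ : AddChar T Kˣ) (x : T) : K :=
  (χ x : K) * ∑ k ∈ Finset.range (D.coroot i x).toNat, (χ (-(k • D.root i)) : K)
    - (χ (D.reflection i x) : K) *
      ∑ k ∈ Finset.range (-(D.coroot i x)).toNat, (χ (-(k • D.root i)) : K)

theorem one_sub_mul_lusztigScalar (i : I) (χ : AddChar T Kˣ) (x : T) :
    (1 - (χ (D.root i) : K)⁻¹) * D.lusztigScalar i χ x =
      (χ x : K) - (χ (D.reflection i x) : K) := by
  have hr : (χ (D.reflection i x) : K) = (χ x : K) * ((χ (D.root i) : K)⁻¹) ^ (D.coroot i x) := by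
    rw [reflection_apply, AddChar.map_sub_eq_div, AddChar.map_zsmul_eq_zpow]
    simp [div_eq_mul_inv]
  have hk : ∀ k : ℕ, (χ (-(k • D.root i)) : K) = ((χ (D.root i) : K)⁻¹) ^ k := fun k => by
    rw [AddChar.map_neg_eq_inv, AddChar.map_nsmul_eq_pow]
    simp
  have hg := fun m => mul_neg_geom_sum ((χ (D.root i) : K)⁻¹) m
  have h0 : (χ (D.root i) : K)⁻¹ ≠ 0 := inv_ne_zero (Units.ne_zero _)
  simp only [lusztigScalar, hk, hr]
  rcases le_total 0 (D.coroot i x) with h | h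
  · obtain ⟨m, hm⟩ := Int.eq_ofNat_of_zero_le h
    rw [hm]
    simp only [Int.toNat_natCast, Int.toNat_neg_natCast, Finset.range_zero, Finset.sum_empty,
      zpow_natCast]
    linear_combination (χ x : K) * hg m
  · obtain ⟨m, hm⟩ := Int.eq_ofNat_of_zero_le (neg_nonneg.2 h)
    rw [show D.coroot i x = -(m : ℤ) by omega]
    simp only [neg_neg, Int.toNat_natCast, Int.toNat_neg_natCast, Finset.range_zero,
      Finset.sum_empty, zpow_neg, zpow_natCast]
    have h1 : ((χ (D.root i) : K)⁻¹ ^ m)⁻¹ * ((χ (D.root i) : K)⁻¹ ^ m) = 1 :=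
      inv_mul_cancel₀ (pow_ne_zero _ h0)
    linear_combination -(χ x : K) * ((χ (D.root i) : K)⁻¹ ^ m)⁻¹ * hg m + (χ x : K) * h1

end RootDatum

namespace LabelShape

variable (S : LabelShape)

theorem cartan_symm (i j : S.Vert) : S.cartan i j = S.cartan j i := by
  simp only [cartan, eq_comm (a := i) (b := j), or_comm]

/-! ### The representation on `V_O` -/

/-- The value `χ_s(α_i)`. -/
def rootVal (i : S.Vert) (s : S.Seq) : K := (S.char s (S.alpha i) : K)

theorem rootVal_ne_zero (i : S.Vert) (s : S.Seq) : S.rootVal i s ≠ 0 := Units.ne_zero _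

theorem rootVal_eq (i : S.Vert) (s : S.Seq) :
    S.rootVal i s = (s (some i) : K) / (s (S.pred i) : K) := by
  rw [rootVal, char_alpha, Units.val_div_eq_div_val]

theorem reflection_alpha (i j : S.Vert) :
    S.rootDatum.reflection i (S.alpha j) = S.alpha j - S.cartan i j • S.alpha i := by
  rw [reflection_apply, coroot_alpha]

theorem char_act_reflection (i : S.Vert) (s : S.Seq) (x : S.L) :
    S.char (S.act (S.rootDatum.reflection i) s) x = S.char s (S.rootDatum.reflection i x) := by
  rw [char_act, reflection_inv]

theorem rootVal_act (i j : S.Vert) (s : S.Seq) :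
    S.rootVal j (S.act (S.rootDatum.reflection i) s) =
      S.rootVal j s / S.rootVal i s ^ S.cartan i j := by
  rw [rootVal, char_act_reflection, reflection_alpha, AddChar.map_sub_eq_div,
    AddChar.map_zsmul_eq_zpow]
  simp [rootVal]

theorem rootVal_act_self (i : S.Vert) (s : S.Seq) :
    S.rootVal i (S.act (S.rootDatum.reflection i) s) = (S.rootVal i s)⁻¹ := by
  have := S.rootVal_ne_zero i s
  rw [rootVal_act, cartan_self]
  field_simp

theorem act_comm {i j : S.Vert} (h : S.cartan i j = 0) (s : S.Seq) :
    S.act (S.rootDatum.reflection i) (S.act (S.rootDatum.reflection j) s) =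
      S.act (S.rootDatum.reflection j) (S.act (S.rootDatum.reflection i) s) := by
  have h' : S.cartan j i = 0 := by rw [cartan_symm, h]
  funext k
  rw [act, act, reflection_inv, reflection_inv, char_act_reflection, char_act_reflection]
  congr 1
  simp only [reflection_apply, map_sub, map_smul, coroot_alpha, h, h', zero_smul, sub_zero]
  abel

theorem act_braid {i j : S.Vert} (h : S.cartan i j = -1) (s : S.Seq) :
    S.act (S.rootDatum.reflection i) (S.act (S.rootDatum.reflection j)
        (S.act (S.rootDatum.reflection i) s)) =
      S.act (S.rootDatum.reflection j) (S.act (S.rootDatum.reflection i)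
        (S.act (S.rootDatum.reflection j) s)) := by
  have h' : S.cartan j i = -1 := by rw [cartan_symm, h]
  funext k
  rw [act, act, reflection_inv, reflection_inv]
  simp only [char_act_reflection]
  congr 1
  simp only [reflection_apply, map_sub, map_smul, coroot_alpha, h, h', cartan_self]
  module

variable {S}

theorem truncCoeff_eq_zero_of_trunc {i : S.Vert} {s : S.Seq} (h : S.trunc i s = none) :
    truncCoeff (S.rootVal i s) = 0 := by
  refine if_pos ?_
  simp only [trunc] at h
  split_ifs at h with h'
  rw [rootVal, char_alpha]
  rcases h' with h' | h'
  · left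
    rw [h', mul_div_cancel_right]
    simp
  · right
    rw [h', mul_div_cancel_right]
    simp

theorem truncCoeff_eq_of_trunc {i : S.Vert} {s t : S.Seq} (h : S.trunc i s = some t) :
    truncCoeff (S.rootVal i s) = offCoeff (S.rootVal i s) ∧
      t = S.act (S.rootDatum.reflection i) s := by
  simp only [trunc] at h
  split_ifs at h with h'
  refine ⟨if_neg fun h1 => h' ?_, (Option.some.inj h).symm⟩
  rw [rootVal, char_alpha] at h1
  refine h1.imp (fun h2 => ?_) fun h2 => ?_
  · rw [← div_eq_iff_eq_mul]
    ext
    simpa using h2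
  · rw [← div_eq_iff_eq_mul]
    ext
    simpa using h2

/-- A set of sequences closed under the truncated operators. -/
def TruncClosed (O : Set S.Seq) : Prop := ∀ s ∈ O, ∀ i t, S.trunc i s = some t → t ∈ O

theorem truncClosed_truncOrbit (s : S.Seq) : TruncClosed (S.truncOrbit s) :=
  fun _ ht _ _ h => mem_truncOrbit_of_trunc ht h

theorem TruncClosed.act_mem {O : Set S.Seq} (hO : TruncClosed O) {s : S.Seq} (hs : s ∈ O)
    {i : S.Vert} (h : truncCoeff (S.rootVal i s) ≠ 0) :
    S.act (S.rootDatum.reflection i) s ∈ O := by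
  rcases h' : S.trunc i s with _ | t
  · exact absurd (truncCoeff_eq_zero_of_trunc h') h
  · rw [← (truncCoeff_eq_of_trunc h').2]
    exact hO s hs i t h'

variable (O : Set S.Seq)

/-- The basis vector `v_s`, which is `0` if `s ∉ O`. -/
def vec (s : S.Seq) : O →₀ K := S.basisVec O (some s)

variable {O}

theorem vec_of_mem {s : S.Seq} (h : s ∈ O) : vec O s = Finsupp.single ⟨s, h⟩ 1 := dif_pos h

theorem vec_of_notMem {s : S.Seq} (h : s ∉ O) : vec O s = 0 := dif_neg h

theorem end_ext {f g : Module.End K (O →₀ K)} (h : ∀ s ∈ O, f (vec O s) = g (vec O s)) :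
    f = g := by
  refine Finsupp.lhom_ext' fun s => LinearMap.ext_ring ?_
  have := h s.1 s.2
  rw [vec_of_mem s.2] at this
  simpa using this

/-- Valid also for `s ∉ O`, where both sides vanish: `r_i` can be undone without truncation, so a
nonzero coefficient at some `r_i(s) ∈ O` would put `s` in `O`. Products of the `g_i` can therefore
be expanded without tracking membership. -/
theorem opG_vec (hO : TruncClosed O) (hg : ∀ s ∈ O, S.Good s) (i : S.Vert) (s : S.Seq) :
    S.opG O i (vec O s) = diagCoeff (S.rootVal i s) • vec O s +
      truncCoeff (S.rootVal i s) • vec O (S.act (S.rootDatum.reflection i) s) := by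
  by_cases hs : s ∈ O
  · have h0 : (s (S.pred i) : K) ≠ 0 := Units.ne_zero _
    have h1 : (s (some i) : K) - (s (S.pred i) : K) ≠ 0 := by
      rw [sub_ne_zero]
      exact fun h => (hg s hs).1 i (Units.ext h)
    have e : (s (some i) : K) / (s (S.pred i) : K) - 1 =
        ((s (some i) : K) - (s (S.pred i) : K)) / (s (S.pred i) : K) := by
      field_simp
    have e1 : ((q : K) - (q : K)⁻¹) * (s (some i) : K) / ((s (some i) : K) - (s (S.pred i) : K)) =
        diagCoeff (S.rootVal i s) := by
      rw [rootVal_eq, diagCoeff, e]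
      field_simp
    have e2 : ((q : K) * (s (some i) : K) - (q : K)⁻¹ * (s (S.pred i) : K)) /
        ((s (some i) : K) - (s (S.pred i) : K)) = offCoeff (S.rootVal i s) := by
      have := q_ne_zero
      rw [rootVal_eq, offCoeff, e]
      field_simp
    rw [vec_of_mem hs, opG, Finsupp.linearCombination_single, one_smul]
    simp only [e1, e2]
    rw [← vec_of_mem hs]
    congr 1
    rcases h' : S.trunc i s with _ | t
    · rw [truncCoeff_eq_zero_of_trunc h', zero_smul]
      exact smul_zero _
    · obtain ⟨h2, rfl⟩ := truncCoeff_eq_of_trunc h'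
      rw [h2]
      rfl
  · rw [vec_of_notMem hs, map_zero, smul_zero, zero_add]
    by_cases h : truncCoeff (S.rootVal i s) = 0
    · rw [h, zero_smul]
    · rw [vec_of_notMem, smul_zero]
      intro h'
      refine hs ?_
      have h2 := hO.act_mem h' (i := i)
      rw [act_act_reflection, rootVal_act_self] at h2
      exact h2 (truncCoeff_inv_ne_zero h)

variable (O) in
/-- The diagonal operator `X^x` on `V_O`. -/
def diagX (x : S.L) : Module.End K (O →₀ K) :=
  Finsupp.linearCombination K fun s : O => (S.char s.1 x : K) • vec O s.1

theorem diagX_vec (x : S.L) (s : S.Seq) : diagX O x (vec O s) = (S.char s x : K) • vec O s := by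
  by_cases hs : s ∈ O
  · rw [vec_of_mem hs, diagX, Finsupp.linearCombination_single, one_smul, vec_of_mem hs]
  · rw [vec_of_notMem hs, map_zero, smul_zero]

theorem opX_eq (j : Option S.Vert) : S.opX O j = diagX O (S.delta j) := by
  simp only [opX, diagX, char_delta, vec]

theorem mul_rootVal_ne_one {s : S.Seq} (hg : ∀ s ∈ O, S.Good s)
    (hs : s ∈ O) {i j : S.Vert} (h : S.cartan i j = -1) :
    S.rootVal i s * S.rootVal j s ≠ 1 := by
  have key : ∀ i j, S.pred j = some i → S.rootVal i s * S.rootVal j s ≠ 1 := by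
    intro i j hij h1
    refine (hg s hs).2 i j hij ?_
    have h2 : (s (S.pred i) : K) ≠ 0 := Units.ne_zero _
    have h3 : (s (some i) : K) ≠ 0 := Units.ne_zero _
    rw [rootVal_eq, rootVal_eq, hij] at h1
    ext
    field_simp at h1
    exact h1
  simp only [cartan] at h
  split_ifs at h with h1 h2
  rcases h2 with h2 | h2
  · rw [mul_comm]
    exact key j i h2
  · exact key i j h2

theorem rootVal_ne_one (hg : ∀ s ∈ O, S.Good s) {s : S.Seq} (hs : s ∈ O) (i : S.Vert) :
    S.rootVal i s ≠ 1 := by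
  intro h
  rw [rootVal, char_alpha, Units.val_eq_one, div_eq_one] at h
  exact (hg s hs).1 i h

theorem opG_quadratic (hO : TruncClosed O) (hg : ∀ s ∈ O, S.Good s) (i : S.Vert) :
    S.opG O i * S.opG O i =
    algebraMap K _ ((q : K) - (q : K)⁻¹) * S.opG O i + 1 := by
  refine end_ext fun s hs => ?_
  have h0 := S.rootVal_ne_zero i s
  have h1 := rootVal_ne_one hg hs i
  have e1 := diagCoeff_quadratic h0 h1
  have e2 := diagCoeff_add_inv h0 h1
  simp only [Module.End.mul_apply, LinearMap.add_apply, Module.algebraMap_end_apply,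
    Module.End.one_apply, opG_vec hO hg, map_add, map_smul, rootVal_act_self, act_act_reflection]
  linear_combination (norm := module) e1 • vec O s +
    (truncCoeff (S.rootVal i s) •
      congrArg (fun z => z • vec O (S.act (S.rootDatum.reflection i) s)) e2)

theorem opG_comm (hO : TruncClosed O) (hg : ∀ s ∈ O, S.Good s) {i j : S.Vert}
    (h : S.cartan i j = 0) :
    S.opG O i * S.opG O j = S.opG O j * S.opG O i := by
  refine end_ext fun s hs => ?_
  have h' : S.cartan j i = 0 := by rw [cartan_symm, h]
  simp only [Module.End.mul_apply, opG_vec hO hg, map_add, map_smul, rootVal_act, h, h', zpow_zero,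
    div_one, S.act_comm h]
  module

theorem opG_braid (hO : TruncClosed O) (hg : ∀ s ∈ O, S.Good s) {i j : S.Vert}
    (h : S.cartan i j = -1) :
    S.opG O i * S.opG O j * S.opG O i = S.opG O j * S.opG O i * S.opG O j := by
  refine end_ext fun s hs => ?_
  have h' : S.cartan j i = -1 := by rw [cartan_symm, h]
  have ha0 := S.rootVal_ne_zero i s
  have hb0 := S.rootVal_ne_zero j s
  have ha := rootVal_ne_one hg hs i
  have hb := rootVal_ne_one hg hs j
  have hab := mul_rootVal_ne_one hg hs h
  have e0 := diagCoeff_braid_diag ha0 hb0 ha hb hab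
  have e1 := diagCoeff_braid ha0 ha hb hab
  have e2 := diagCoeff_braid hb0 hb ha (by rwa [mul_comm])
  have r1 : S.rootVal j (S.act (S.rootDatum.reflection i) s) = S.rootVal i s * S.rootVal j s := by
    rw [rootVal_act, h, zpow_neg_one, div_inv_eq_mul, mul_comm]
  have r2 : S.rootVal i (S.act (S.rootDatum.reflection j) s) = S.rootVal i s * S.rootVal j s := by
    rw [rootVal_act, h', zpow_neg_one, div_inv_eq_mul]
  have r3 : S.rootVal i (S.act (S.rootDatum.reflection j) (S.act (S.rootDatum.reflection i) s)) =
      S.rootVal j s := by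
    rw [rootVal_act, h', zpow_neg_one, div_inv_eq_mul, rootVal_act_self, r1]
    field_simp
  have r4 : S.rootVal j (S.act (S.rootDatum.reflection i) (S.act (S.rootDatum.reflection j) s)) =
      S.rootVal i s := by
    rw [rootVal_act, h, zpow_neg_one, div_inv_eq_mul, rootVal_act_self, r2]
    field_simp
  simp only [Module.End.mul_apply, opG_vec hO hg, map_add, map_smul, rootVal_act_self,
    act_act_reflection, r1, r2, r3, r4, S.act_braid h]
  rw [mul_comm (S.rootVal j s)] at e2
  generalize vec O s = v0 at *
  generalize vec O (S.act (S.rootDatum.reflection i) s) = vi at *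
  generalize vec O (S.act (S.rootDatum.reflection j) s) = vj at *
  -- The coefficients at the vectors of two or three reflections agree identically; only those at
  -- `v_s`, `v_{r_i(s)}` and `v_{r_j(s)}` need the identities above.
  linear_combination (norm := module) e0 • v0 + (truncCoeff (S.rootVal i s) • e1) • vi
    - (truncCoeff (S.rootVal j s) • e2) • vj

/-- The off-diagonal terms cancel because `X^{r_i(x)}` acts on `v_{r_i(s)}` by `χ_s(x)`; the
diagonal term is the relation divided by `1 - χ_s(α_i)⁻¹`. -/
theorem opG_lusztig (hO : TruncClosed O) (hg : ∀ s ∈ O, S.Good s) (i : S.Vert) (x : S.L) :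
    S.opG O i * diagX O x - diagX O (S.rootDatum.reflection i x) * S.opG O i =
      algebraMap K _ ((q : K) - (q : K)⁻¹) *
        (diagX O x * ∑ k ∈ Finset.range (S.rootDatum.coroot i x).toNat,
          diagX O (-(k • S.rootDatum.root i)) -
        diagX O (S.rootDatum.reflection i x) *
          ∑ k ∈ Finset.range (-(S.rootDatum.coroot i x)).toNat,
            diagX O (-(k • S.rootDatum.root i))) := by
  refine end_ext fun s hs => ?_
  have h0 := S.rootVal_ne_zero i s
  have h1 := rootVal_ne_one hg hs i
  have e := S.rootDatum.one_sub_mul_lusztigScalar i (S.char s) x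
  have hL : (diagX O x * ∑ k ∈ Finset.range (S.rootDatum.coroot i x).toNat,
          diagX O (-(k • S.rootDatum.root i)) -
        diagX O (S.rootDatum.reflection i x) *
          ∑ k ∈ Finset.range (-(S.rootDatum.coroot i x)).toNat,
            diagX O (-(k • S.rootDatum.root i))) (vec O s) =
      S.rootDatum.lusztigScalar i (S.char s) x • vec O s := by
    simp only [Module.End.mul_apply, LinearMap.sub_apply, LinearMap.sum_apply, diagX_vec,
      ← Finset.sum_smul, map_smul, smul_smul, ← sub_smul]
    rw [RootDatum.lusztigScalar, mul_comm, mul_comm (∑ k ∈ _, _) (S.char s _ : K)]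
  rw [Module.End.mul_apply, hL]
  simp only [Module.End.mul_apply, LinearMap.sub_apply, Module.algebraMap_end_apply,
    opG_vec hO hg, map_add, map_smul, diagX_vec, char_act_reflection,
    S.rootDatum.reflection_reflection]
  have e' : diagCoeff (S.rootVal i s) * ((S.char s x : K) -
        (S.char s (S.rootDatum.reflection i x) : K)) =
      ((q : K) - (q : K)⁻¹) * S.rootDatum.lusztigScalar i (S.char s) x := by
    rw [← e]
    have h2 : S.rootVal i s - 1 ≠ 0 := sub_ne_zero.2 h1
    change _ * ((1 - (S.rootVal i s)⁻¹) * _) = _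
    rw [diagCoeff]
    field_simp
  linear_combination (norm := module) e' • vec O s

/-- The representation of `H(R,v)` on `V_O`. -/
def rep (hO : TruncClosed O) (hg : ∀ s ∈ O, S.Good s) : S.H →ₐ[K] Module.End K (O →₀ K) :=
  RingQuot.liftAlgHom K ⟨FreeAlgebra.lift K (Sum.elim (S.opG O) (diagX O)), by
    have hG : ∀ i, FreeAlgebra.lift K (Sum.elim (S.opG O) (diagX O)) (RootDatum.genG S.L i) =
        S.opG O i := fun i => by simp [RootDatum.genG]
    have hX : ∀ x, FreeAlgebra.lift K (Sum.elim (S.opG O) (diagX O)) (RootDatum.genX S.Vert x) =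
        diagX O x := fun x => by simp [RootDatum.genX]
    intro a b hab
    induction hab with
    | X_zero =>
      rw [hX, map_one]
      refine end_ext fun s hs => ?_
      rw [diagX_vec, AddChar.map_zero_eq_one]
      simp
    | X_add x y =>
      rw [map_mul, hX, hX, hX]
      refine end_ext fun s hs => ?_
      simp only [Module.End.mul_apply, diagX_vec, map_smul, AddChar.map_add_eq_mul, smul_smul,
        Units.val_mul]
      rw [mul_comm]
    | quadratic i =>
      simpa only [map_mul, map_add, map_one, AlgHom.commutes, hG] using opG_quadratic hO hg i
    | comm i j hij h => simpa only [map_mul, hG] using opG_comm hO hg h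
    | braid i j hij h => simpa only [map_mul, hG] using opG_braid hO hg h
    | lusztig i x =>
      simpa only [map_sub, map_mul, map_sum, AlgHom.commutes, RootDatum.lusztigQuotient, hG, hX]
        using opG_lusztig hO hg i x⟩

theorem rep_g (hO : TruncClosed O) (hg : ∀ s ∈ O, S.Good s) (i : S.Vert) :
    rep hO hg (S.rootDatum.g i) = S.opG O i := by
  simp [rep, RootDatum.g, RootDatum.genG]

theorem rep_X (hO : TruncClosed O) (hg : ∀ s ∈ O, S.Good s) (x : S.L) :
    rep hO hg (S.rootDatum.X x) = diagX O x := by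
  simp [rep, RootDatum.X, RootDatum.genX]

end LabelShape

namespace Labelling

variable {ι M N : Type*} [AddCommGroup M] [Module ℝ M] [AddCommGroup N] [Module ℝ N]
  {P : RootPairing ι ℝ M N} [P.IsCrystallographic] {b : P.Base} {v : b.support}
  (D : Labelling b v)

theorem hom_ext {A : Type} [Ring A] [Algebra K A] {f f' : D.H →ₐ[K] A}
    (hg : ∀ i, f (D.rootDatum.g i) = f' (D.rootDatum.g i))
    (hX : ∀ x, f (D.rootDatum.X x) = f' (D.rootDatum.X x)) : f = f' := by
  refine RingQuot.ringQuot_ext' K f f' (FreeAlgebra.hom_ext (funext fun x => ?_))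
  rcases x with i | x
  · exact hg i
  · exact hX x

variable [Finite ι] [P.IsRootSystem]

/-! ### The kernel of the projection -/

theorem proj_g (i : D.Vert) : D.proj (D.rootDatum.g i) = D.rootDatumBar.g i :=
  RootDatum.mapHecke_g _ _ _ _ _ _

theorem proj_X (x : D.L) : D.proj (D.rootDatum.X x) = D.rootDatumBar.X (D.phi x) :=
  RootDatum.mapHecke_X _ _ _ _ _ _

theorem proj_centralC : D.proj D.centralC = 1 := by
  rw [LabelShape.centralC, proj_X, phi_DeltaL, RootDatum.X_zero]

theorem proj_surjective : Function.Surjective D.proj := by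
  intro y
  obtain ⟨y, rfl⟩ := RingQuot.mkAlgHom_surjective K D.rootDatumBar.Rel y
  induction y using FreeAlgebra.induction with
  | grade0 r => exact ⟨algebraMap K _ r, by simp⟩
  | grade1 x =>
    rcases x with i | x
    · exact ⟨_, D.proj_g i⟩
    · obtain ⟨x, rfl⟩ := D.phi_surjective x
      exact ⟨_, D.proj_X x⟩
  | mul a b ha hb =>
    obtain ⟨a', ha'⟩ := ha
    obtain ⟨b', hb'⟩ := hb
    exact ⟨a' * b', by rw [map_mul, map_mul, ha', hb']⟩
  | add a b ha hb =>
    obtain ⟨a', ha'⟩ := ha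
    obtain ⟨b', hb'⟩ := hb
    exact ⟨a' + b', by rw [map_add, map_add, ha', hb']⟩

/-- A morphism from `H(R,v)` that sends `C` to `1` factors through the projection. -/
theorem exists_comp_proj {A : Type} [Ring A] [Algebra K A] (f : D.H →ₐ[K] A)
    (hf : f D.centralC = 1) : ∃ f' : D.Hbar →ₐ[K] A, f'.comp D.proj = f := by
  have hX0 : f (D.rootDatum.X 0) = 1 := by rw [RootDatum.X_zero, map_one]
  have hXadd : ∀ x y, f (D.rootDatum.X (x + y)) = f (D.rootDatum.X x) * f (D.rootDatum.X y) :=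
    fun x y => by rw [← map_mul, RootDatum.X_mul]
  let G : AddSubgroup D.L :=
    { carrier := {x | f (D.rootDatum.X x) = 1}
      zero_mem' := hX0
      add_mem' := fun {x y} hx hy => by
        simp only [Set.mem_ofPred_eq] at hx hy ⊢
        rw [hXadd, hx, hy, one_mul]
      neg_mem' := fun {x} hx => by
        simp only [Set.mem_ofPred_eq] at hx ⊢
        rw [← one_mul (f _), ← hx, ← hXadd, add_neg_cancel, hX0, hx] }
  have hker : ∀ x, D.phi x = 0 → f (D.rootDatum.X x) = 1 := by
    intro x hx
    obtain ⟨m, rfl⟩ := D.phi_eq_zero hx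
    exact G.zsmul_mem (show D.DeltaL ∈ G from hf) m
  have hphi : ∀ x y, D.phi x = D.phi y → f (D.rootDatum.X x) = f (D.rootDatum.X y) := by
    intro x y h
    rw [← sub_add_cancel x y, hXadd, hker (x - y) (by rw [map_sub, h, sub_self]), one_mul]
  -- The choice of preimages is harmless, since `f` sends `X^x` to `1` for `x` in `ker φ = ℤ Δ`.
  let F : D.Lbar → A := fun y => f (D.rootDatum.X (Function.surjInv D.phi_surjective y))
  have hF : ∀ x, F (D.phi x) = f (D.rootDatum.X x) :=
    fun x => hphi _ _ (Function.surjInv_eq D.phi_surjective _)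
  let lift := FreeAlgebra.lift K (Sum.elim (fun i => f (D.rootDatum.g i)) F)
  have hG : ∀ i, lift (RootDatum.genG D.Lbar i) = f (D.rootDatum.g i) :=
    fun i => by simp [lift, RootDatum.genG]
  have hX : ∀ x, lift (RootDatum.genX D.Vert (D.phi x)) = f (D.rootDatum.X x) :=
    fun x => by rw [← hF]; simp [lift, RootDatum.genX]
  have hr : ∀ i x, D.rootDatumBar.reflection i (D.phi x) = D.phi (D.rootDatum.reflection i x) :=
    fun i x => by
      rw [RootDatum.reflection_apply, RootDatum.reflection_apply, coroot_phi, map_sub, map_smul]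
      exact congrArg (fun z => _ - _ • z) (D.phi_alpha i).symm
  have hrel : ∀ ⦃a b⦄, D.rootDatumBar.Rel a b → lift a = lift b := by
    intro a b hab
    induction hab with
    | X_zero => rw [← map_zero D.phi, hX, hX0, map_one]
    | X_add x y =>
      obtain ⟨x, rfl⟩ := D.phi_surjective x
      obtain ⟨y, rfl⟩ := D.phi_surjective y
      rw [← map_add, map_mul, hX, hX, hX, hXadd]
    | quadratic i =>
      have h := congrArg f (RingQuot.mkAlgHom_rel K (RootDatum.Rel.quadratic (D := D.rootDatum) i))
      simp only [map_mul, map_add, map_one, AlgHom.commutes] at h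
      simp only [map_mul, map_add, map_one, AlgHom.commutes, hG]
      exact h
    | comm i j hij h =>
      have h := congrArg f
        (RingQuot.mkAlgHom_rel K (RootDatum.Rel.comm (D := D.rootDatum) i j hij h))
      simp only [map_mul] at h
      simp only [map_mul, hG]
      exact h
    | braid i j hij h =>
      have h := congrArg f
        (RingQuot.mkAlgHom_rel K (RootDatum.Rel.braid (D := D.rootDatum) i j hij h))
      simp only [map_mul] at h
      simp only [map_mul, hG]
      exact h
    | lusztig i x =>
      obtain ⟨x, rfl⟩ := D.phi_surjective x
      have h := congrArg f
        (RingQuot.mkAlgHom_rel K (RootDatum.Rel.lusztig (D := D.rootDatum) i x))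
      have hk : ∀ k : ℕ, -(k • D.rootDatumBar.root i) = D.phi (-(k • D.rootDatum.root i)) :=
        fun k => by
          rw [map_neg, map_nsmul]
          exact congrArg (fun z => -(k • z)) (D.phi_alpha i).symm
      simp only [map_sub, map_mul, AlgHom.commutes, RootDatum.mk_lusztig, map_sum] at h
      simp only [RootDatum.lusztigQuotient, map_sub, map_mul, map_sum, AlgHom.commutes, hG, hr,
        coroot_phi, hk, hX]
      exact h
  refine ⟨RingQuot.liftAlgHom K ⟨lift, hrel⟩, D.hom_ext (fun i => ?_) fun x => ?_⟩
  · rw [AlgHom.comp_apply, proj_g, RootDatum.g, RingQuot.liftAlgHom_mkAlgHom_apply, hG]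
  · rw [AlgHom.comp_apply, proj_X, RootDatum.X, RingQuot.liftAlgHom_mkAlgHom_apply, hX]

theorem ker_proj : TwoSidedIdeal.ker D.proj = TwoSidedIdeal.span {D.centralC - 1} := by
  refine le_antisymm (fun z hz => ?_) (TwoSidedIdeal.span_le.2 ?_)
  · rw [TwoSidedIdeal.mem_ker] at hz
    set J : TwoSidedIdeal D.H := TwoSidedIdeal.span {D.centralC - 1} with hJ
    -- The quotient map by `J` sends `C` to `1`, so it factors through the projection and kills its
    -- kernel.
    let f : D.H →ₐ[K] J.ringCon.Quotient := J.ringCon.mkₐ (α := K)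
    have hf : ∀ x y, f x = f y ↔ x - y ∈ J := fun x y => by
      rw [← TwoSidedIdeal.rel_iff]
      change ((x : J.ringCon.Quotient) = y) ↔ _
      exact RingCon.eq _
    obtain ⟨f', hf'⟩ := D.exists_comp_proj f (by
      rw [← map_one f, hf]
      exact TwoSidedIdeal.subset_span rfl)
    have h0 : f z = f 0 := by rw [← hf', AlgHom.comp_apply, hz, map_zero, map_zero]
    simpa using (hf z 0).1 h0
  · rintro _ rfl
    rw [SetLike.mem_coe, TwoSidedIdeal.mem_ker, map_sub, proj_centralC, map_one, sub_self]

end Labelling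

/-! ### The action of `C` on `V_O` -/

namespace LabelShape

variable {S : LabelShape} {O : Set S.Seq}

theorem rep_centralC (hO : TruncClosed O) (hg : ∀ s ∈ O, S.Good s) {c : Kˣ}
    (hc : ∀ s ∈ O, S.Delta s = c) : rep hO hg S.centralC = algebraMap K _ (c : K) := by
  refine end_ext fun s hs => ?_
  rw [centralC, rep_X, diagX_vec, ← Delta_eq_char, hc s hs]
  rfl

end LabelShape

/-! ### Weights of calibrated representations -/

/-- A diagonalizable operator has no Jordan block: the image of `f - μ` lies in the sum of the other
eigenspaces, which meets the one of `μ` trivially. -/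
theorem eq_zero_of_iSup_eigenspace {V : Type} [AddCommGroup V] [Module K V] {f : Module.End K V}
    (hf : ⨆ μ : K, Module.End.eigenspace f μ = ⊤) {u w : V} {μ : K} (hu : f u = μ • u)
    (hw : f w = μ • w + u) : u = 0 := by
  have key : ∀ w : V, f w - μ • w ∈ ⨆ ν ≠ μ, Module.End.eigenspace f ν := by
    intro w
    have hw : w ∈ ⨆ ν : K, Module.End.eigenspace f ν := by rw [hf]; trivial
    induction hw using Submodule.iSup_induction' with
    | mem ν x hx =>
      rw [Module.End.mem_eigenspace_iff] at hx
      rw [hx, ← sub_smul]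
      by_cases h : ν = μ
      · rw [h, sub_self, zero_smul]
        exact Submodule.zero_mem _
      · refine Submodule.smul_mem _ _ (Submodule.mem_iSup_of_mem ν
          (Submodule.mem_iSup_of_mem h (Module.End.mem_eigenspace_iff.2 hx)))
    | zero => simp
    | add x y _ _ hx hy =>
      rw [map_add, smul_add, add_sub_add_comm]
      exact Submodule.add_mem _ hx hy
  have h1 := key w
  rw [hw, add_sub_cancel_left] at h1
  have := (Module.End.eigenspaces_iSupIndep f) μ
  exact Submodule.disjoint_def.1 this u (Module.End.mem_eigenspace_iff.2 hu) h1

theorem eq_of_truncCoeff_eq_zero {a : K} (h1 : a ≠ 1) (h : truncCoeff a = 0) :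
    a = (q : K) ^ 2 ∨ a = ((q : K) ^ 2)⁻¹ := by
  have hq := q_ne_zero
  by_contra h'
  rw [truncCoeff, if_neg h', offCoeff, div_eq_zero_iff] at h
  rcases h with h | h
  · refine h' (Or.inr (eq_inv_of_mul_eq_one_left ?_))
    field_simp at h
    linear_combination h
  · exact h1 (sub_eq_zero.1 h)

/-! ### Weight vectors and intertwiners -/

namespace RootDatum

variable {I : Type} {C : Matrix I I ℤ} {T : Type} [AddCommGroup T] {D : RootDatum C T}
  {V : Type} [AddCommGroup V] [Module K V] (ρ : D.AffineHecke →ₐ[K] Module.End K V)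

theorem rep_quadratic (i : I) (u : V) : ρ (D.g i) (ρ (D.g i) u) =
    ((q : K) - (q : K)⁻¹) • ρ (D.g i) u + u := by
  have h := congrArg (fun z => ρ z u) (RingQuot.mkAlgHom_rel K (Rel.quadratic (D := D) i))
  simp only [map_add, map_mul, map_one, AlgHom.commutes, Module.End.mul_apply,
    LinearMap.add_apply, Module.algebraMap_end_apply, Module.End.one_apply] at h
  exact h

/-- The vector `u` is a non-zero weight vector of weight `χ`. -/
def IsWeightVector (χ : AddChar T Kˣ) (u : V) : Prop :=
  u ≠ 0 ∧ ∀ x : T, ρ (D.X x) u = (χ x : K) • u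

namespace IsWeightVector

variable {ρ} {χ : AddChar T Kˣ} {u : V}

theorem lusztig (hu : IsWeightVector ρ χ u) (i : I) (x : T) :
    (χ x : K) • ρ (D.g i) u - ρ (D.X (D.reflection i x)) (ρ (D.g i) u) =
      (((q : K) - (q : K)⁻¹) * D.lusztigScalar i χ x) • u := by
  have h := congrArg (fun z => ρ z u) (RingQuot.mkAlgHom_rel K (Rel.lusztig (D := D) i x))
  simp only [map_sub, map_mul, AlgHom.commutes, mk_lusztig, map_sum] at h
  simp only [Module.End.mul_apply, LinearMap.sub_apply, LinearMap.sum_apply,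
    Module.algebraMap_end_apply] at h
  have h' : ∀ x, ρ ((RingQuot.mkAlgHom K D.Rel) (genX I x)) u = (χ x : K) • u := hu.2
  simp only [hu.2, h', map_smul, ← Finset.sum_smul, smul_smul, ← sub_smul] at h
  rw [mul_comm _ (χ x : K), mul_comm _ (χ (D.reflection i x) : K)] at h
  rw [lusztigScalar, sub_mul]
  exact h

/-- If `χ(α_i) = 1`, the Lusztig quotient for `x = α_i`, namely `X^{α_i} + 1`, acts on `u` by `2`,
and `u`, `g_i u` would span a Jordan block of `X^{-α_i}`. -/
theorem root_ne_one (hu : IsWeightVector ρ χ u)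
    (hd : ∀ x : T, ⨆ μ : K, Module.End.eigenspace (ρ (D.X x)) μ = ⊤) (i : I) :
    (χ (D.root i) : K) ≠ 1 := by
  intro h
  have h1 : χ (D.root i) = 1 := Units.ext h
  have h2 : D.reflection i (D.root i) = -D.root i := by
    rw [reflection_apply, D.coroot_root, D.diag]
    module
  have h3 : D.lusztigScalar i χ (D.root i) = 2 := by
    rw [lusztigScalar, D.coroot_root, D.diag]
    simp [AddChar.map_neg_eq_inv, AddChar.map_nsmul_eq_pow, h1]
  have h4 := hu.lusztig i (D.root i)
  rw [h2, h3, h1, Units.val_one, one_smul] at h4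
  have h5 : ρ (D.X (-D.root i)) (ρ (D.g i) u) =
      (1 : K) • ρ (D.g i) u + (-(((q : K) - (q : K)⁻¹) * 2)) • u := by
    rw [neg_smul, ← h4]
    module
  have h6 := eq_zero_of_iSup_eigenspace (hd _) (μ := 1) (by
    rw [map_smul, hu.2, AddChar.map_neg_eq_inv, h1]
    simp) h5
  rw [smul_eq_zero, neg_eq_zero, mul_eq_zero] at h6
  rcases h6 with (h6 | h6) | h6
  · exact q_sub_inv_ne_zero h6
  · norm_num at h6
  · exact hu.1 h6

theorem intertwiner (hu : IsWeightVector ρ χ u) {i : I} (h1 : (χ (D.root i) : K) ≠ 1)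
    (hne : ρ (D.g i) u ≠ diagCoeff (χ (D.root i) : K) • u) :
    IsWeightVector ρ (χ.compAddMonoidHom (D.reflection i).toAddMonoidHom)
      (ρ (D.g i) u - diagCoeff (χ (D.root i) : K) • u) := by
  refine ⟨sub_ne_zero.2 hne, fun x => ?_⟩
  have h2 := hu.lusztig i (D.reflection i x)
  have h3 := D.one_sub_mul_lusztigScalar i χ (D.reflection i x)
  rw [reflection_reflection] at h2 h3
  have h0 : (χ (D.root i) : K) ≠ 0 := Units.ne_zero _
  have e' : diagCoeff (χ (D.root i) : K) * ((χ (D.reflection i x) : K) - (χ x : K)) =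
      ((q : K) - (q : K)⁻¹) * D.lusztigScalar i χ (D.reflection i x) := by
    rw [← h3]
    have h2 : (χ (D.root i) : K) - 1 ≠ 0 := sub_ne_zero.2 h1
    rw [diagCoeff]
    field_simp
  rw [← e'] at h2
  change _ = (χ (D.reflection i x) : K) • _
  rw [map_sub, map_smul, hu.2]
  linear_combination (norm := module) -h2

/-- If the intertwiner kills `u`, the diagonal coefficient is a root of the quadratic relation,
which leaves the product of the two off-diagonal coefficients equal to zero. -/
theorem truncCoeff_eq_zero (hu : IsWeightVector ρ χ u) {i : I} (h1 : (χ (D.root i) : K) ≠ 1)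
    (h : ρ (D.g i) u = diagCoeff (χ (D.root i) : K) • u) :
    truncCoeff (χ (D.root i) : K) = 0 := by
  have h2 := rep_quadratic ρ i u
  rw [h, map_smul, h, smul_smul] at h2
  have h3 := diagCoeff_quadratic (Units.ne_zero (χ (D.root i))) h1
  have h4 : (truncCoeff (χ (D.root i) : K) * truncCoeff (χ (D.root i) : K)⁻¹) • u = 0 := by
    linear_combination (norm := module) h3 • u - h2
  rcases mul_eq_zero.1 ((smul_eq_zero.1 h4).resolve_right hu.1) with h5 | h5
  · exact h5
  · by_contra h6
    exact truncCoeff_inv_ne_zero h6 h5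

/-- Suppose `χ(α_i + α_j) = 1`. A nonzero intertwined vector for `i` would have a weight equal to
`1` on `α_j`, against `root_ne_one`; so `g_i`, and likewise `g_j`, scales `u`. The braid relation
then forces equal scalars, although the quadratic relation makes their product `-1` and their sum `q
- q⁻¹`. -/
theorem mul_root_ne_one (hu : IsWeightVector ρ χ u)
    (hd : ∀ x : T, ⨆ μ : K, Module.End.eigenspace (ρ (D.X x)) μ = ⊤)
    {i j : I} (hij : C i j = -1) (hji : C j i = -1) :
    (χ (D.root i) : K) * (χ (D.root j) : K) ≠ 1 := by
  intro hab
  have key : ∀ i j, C i j = -1 → (χ (D.root i) : K) * (χ (D.root j) : K) = 1 →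
      ρ (D.g i) u = diagCoeff (χ (D.root i) : K) • u := by
    intro i j hij hab
    by_contra h
    have h1 := (hu.intertwiner (hu.root_ne_one hd i) h).root_ne_one hd j
    change (χ (D.reflection i (D.root j)) : K) ≠ 1 at h1
    rw [reflection_apply, D.coroot_root, hij, neg_one_smul, sub_neg_eq_add,
      AddChar.map_add_eq_mul, Units.val_mul, mul_comm] at h1
    exact h1 hab
  have hi := key i j hij hab
  have hj := key j i hji (by rwa [mul_comm])
  have hne : i ≠ j := by
    rintro rfl
    have := D.diag i
    omega
  have hbr := congrArg (fun z => ρ z u)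
    (RingQuot.mkAlgHom_rel K (Rel.braid (D := D) i j hne hij))
  simp only [map_mul, Module.End.mul_apply] at hbr
  change ρ (D.g i) (ρ (D.g j) (ρ (D.g i) u)) = ρ (D.g j) (ρ (D.g i) (ρ (D.g j) u)) at hbr
  have ha1 := hu.root_ne_one hd i
  have ha0 : (χ (D.root i) : K) ≠ 0 := Units.ne_zero _
  have h1 := hu.truncCoeff_eq_zero ha1 hi
  have h2 := diagCoeff_quadratic ha0 ha1
  have h3 := diagCoeff_add_inv ha0 ha1
  rw [← eq_inv_of_mul_eq_one_right hab] at h2 h3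
  rw [h1, zero_mul, add_zero] at h2
  simp only [hi, hj, map_smul, smul_smul] at hbr
  set A := diagCoeff (χ (D.root i) : K)
  set B := diagCoeff (χ (D.root j) : K)
  have hAB : A * B = -1 := by linear_combination A * h3 - h2
  have h4 : A - B = 0 := by
    have h5 := sub_eq_zero.2 hbr
    rw [← sub_smul] at h5
    have h6 := (smul_eq_zero.1 h5).resolve_right hu.1
    linear_combination (-1 : K) * h6 + (A - B) * hAB
  refine q_sq_ne_neg_one ?_
  have hq := mul_inv_cancel₀ q_ne_zero
  -- `(q + q⁻¹)² = (q - q⁻¹)² + 4 = (A + B)² - 4AB = (A - B)² = 0`.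
  have h7 : ((q : K) + (q : K)⁻¹) ^ 2 = 0 := by
    linear_combination (-(A + B) - ((q : K) - (q : K)⁻¹)) * h3 + (A - B) * h4 + 4 * hAB + 4 * hq
  have h8 : (q : K) + (q : K)⁻¹ = 0 := pow_eq_zero_iff (two_ne_zero) |>.1 h7
  linear_combination (q : K) * h8 - hq

end IsWeightVector

end RootDatum

/-! ### Weights along a truncated orbit -/

namespace LabelShape

variable {S : LabelShape} {V : Type} [AddCommGroup V] [Module K V]
  {ρ : S.H →ₐ[K] Module.End K V}

theorem good_of_isWeightVector
    (hd : ∀ x : S.L, ⨆ μ : K, Module.End.eigenspace (ρ (S.rootDatum.X x)) μ = ⊤)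
    {s : S.Seq} {u : V} (hu : RootDatum.IsWeightVector ρ (S.char s) u) : S.Good s := by
  constructor
  · intro i h
    refine hu.root_ne_one hd i ?_
    change (S.char s (S.alpha i) : K) = 1
    rw [char_alpha, h, div_self', Units.val_one]
  · intro i j hij h
    have hC := S.cartan_pred hij
    refine hu.mul_root_ne_one hd hC (by rw [cartan_symm, hC]) ?_
    change (S.char s (S.alpha i) : K) * (S.char s (S.alpha j) : K) = 1
    rw [char_alpha, char_alpha, hij, h, ← Units.val_mul, div_mul_div_cancel', div_self',
      Units.val_one]

/-- A step of the orbit is not truncated, so the intertwiner does not kill the weight vector and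
moves it to the reflected weight. -/
theorem exists_isWeightVector
    (hd : ∀ x : S.L, ⨆ μ : K, Module.End.eigenspace (ρ (S.rootDatum.X x)) μ = ⊤)
    {s : S.Seq} {u : V} (hu : RootDatum.IsWeightVector ρ (S.char s) u) {t : S.Seq}
    (ht : t ∈ S.truncOrbit s) : ∃ u', RootDatum.IsWeightVector ρ (S.char t) u' := by
  induction ht with
  | refl => exact ⟨u, hu⟩
  | @tail t t' _ h ih =>
    obtain ⟨u', hu'⟩ := ih
    obtain ⟨i, hi⟩ := h
    obtain ⟨-, rfl⟩ := truncCoeff_eq_of_trunc hi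
    have h1 := hu'.root_ne_one hd i
    have hne : ρ (S.rootDatum.g i) u' ≠ diagCoeff (S.char t (S.rootDatum.root i) : K) • u' := by
      intro h2
      have h3 := eq_of_truncCoeff_eq_zero h1 (hu'.truncCoeff_eq_zero h1 h2)
      have h4 : S.trunc i t = none := by
        refine if_pos ?_
        change ((S.char t (S.alpha i) : Kˣ) : K) = _ ∨ ((S.char t (S.alpha i) : Kˣ) : K) = _ at h3
        rw [char_alpha] at h3
        refine h3.imp (fun h3 => ?_) fun h3 => ?_
        · rw [← div_eq_iff_eq_mul]
          ext
          simpa using h3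
        · rw [← div_eq_iff_eq_mul]
          ext
          simpa using h3
      simp [h4] at hi
    have h5 := hu'.intertwiner h1 hne
    have h6 : (S.char t).compAddMonoidHom (S.rootDatum.reflection i).toAddMonoidHom =
        S.char (S.act (S.rootDatum.reflection i) t) := by
      ext1 x
      exact (S.char_act_reflection i t x).symm
    rw [h6] at h5
    exact ⟨_, h5⟩

end LabelShape

namespace Labelling

variable {ι M N : Type*} [AddCommGroup M] [Module ℝ M] [AddCommGroup N] [Module ℝ N]
  {P : RootPairing ι ℝ M N} [P.IsCrystallographic] {b : P.Base} {v : b.support}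
  (D : Labelling b v)

/-! ### Finiteness of the Weyl group -/

/-- The map from the root lattice to the ambient space of the root system. -/
def toAmbient : (D.Vert → ℤ) →ₗ[ℤ] M :=
  ∑ i, LinearMap.smulRight (LinearMap.proj i : (D.Vert → ℤ) →ₗ[ℤ] ℤ) (P.root (D.vertex i))

theorem toAmbient_apply (x : D.Vert → ℤ) : D.toAmbient x = ∑ i, x i • P.root (D.vertex i) := by
  simp [toAmbient, -Fintype.sum_sum_type]

theorem toAmbient_single (i : D.Vert) : D.toAmbient (Pi.single i 1) = P.root (D.vertex i) := by
  simp [toAmbient_apply, Pi.single_apply, -Fintype.sum_sum_type]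

theorem toAmbient_injective : Function.Injective D.toAmbient := by
  have h1 : LinearIndependent ℝ (fun i : D.Vert => P.root (D.vertex i)) :=
    LinearIndependent.comp b.linearIndepOn_root D.vertex D.vertex.injective
  have h2 : LinearIndependent ℤ (fun i : D.Vert => P.root (D.vertex i)) :=
    h1.restrict_scalars (R := ℤ) (fun a b h => by simpa using h)
  rw [injective_iff_map_eq_zero]
  intro x hx
  rw [toAmbient_apply] at hx
  exact funext fun i => Fintype.linearIndependent_iff.1 h2 x hx i

theorem coroot_toAmbient (i : D.Vert) (x : D.Vert → ℤ) :
    P.toLinearMap (D.toAmbient x) (P.coroot (D.vertex i)) = (D.coroot i (0, x) : ℤ) := by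
  rw [toAmbient_apply]
  have h : D.coroot i (0, x) = ∑ j, D.cartan i j * x j := by
    simp [LabelShape.coroot, -Fintype.sum_sum_type]
  rw [h, map_sum, LinearMap.sum_apply, Int.cast_sum]
  refine Finset.sum_congr rfl fun j _ => ?_
  rw [map_zsmul, LinearMap.smul_apply, RootPairing.root_coroot_eq_pairing, LabelShape.cartan_symm,
    ← D.cartan_eq, RootPairing.Base.cartanMatrix, RootPairing.Base.cartanMatrixIn_def,
    ← P.algebraMap_pairingIn ℤ]
  simp [mul_comm]

theorem toAmbient_reflection (i : D.Vert) (x : D.Vert → ℤ) :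
    ∃ y, D.rootDatum.reflection i (0, x) = (0, y) ∧
      D.toAmbient y = P.reflection (D.vertex i) (D.toAmbient x) := by
  refine ⟨x - D.coroot i (0, x) • Pi.single i 1, ?_, ?_⟩
  · rw [LabelShape.reflection_apply]
    simp [LabelShape.alpha]
  · rw [map_sub, map_smul, toAmbient_single, RootPairing.reflection_apply]
    change _ = _ - P.toLinearMap (D.toAmbient x) (P.coroot _) • _
    rw [coroot_toAmbient, Int.cast_smul_eq_zsmul]

/-- The condition says that `χ_s` is trivial on `ker φ = ℤ Δ`. -/
theorem exists_char_phi {s : D.Seq} (hs : D.Delta s = 1) :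
    ∃ χ : AddChar D.Lbar Kˣ, ∀ x, χ (D.phi x) = D.char s x := by
  have hphi : ∀ x y, D.phi x = D.phi y → D.char s x = D.char s y := by
    intro x y h
    obtain ⟨m, hm⟩ := D.phi_eq_zero (x := x - y) (by rw [map_sub, h, sub_self])
    rw [← sub_add_cancel x y, hm, AddChar.map_add_eq_mul, AddChar.map_zsmul_eq_zpow,
      ← LabelShape.Delta_eq_char, hs, one_zpow, one_mul]
  have hF : ∀ x, D.char s (Function.surjInv D.phi_surjective (D.phi x)) = D.char s x :=
    fun x => hphi _ _ (Function.surjInv_eq D.phi_surjective _)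
  refine ⟨⟨fun y => D.char s (Function.surjInv D.phi_surjective y), ?_, fun y y' => ?_⟩, hF⟩
  · rw [← map_zero D.phi, hF, AddChar.map_zero_eq_one]
  · obtain ⟨x, rfl⟩ := D.phi_surjective y
    obtain ⟨x', rfl⟩ := D.phi_surjective y'
    rw [← map_add, hF, hF, hF, AddChar.map_add_eq_mul]

variable [Finite ι] [P.IsRootSystem]

/-- The group permutes the finite set `A` of roots, seen in `L`, and fixes `Δ`. Since `Δ` and the
simple roots span `L` rationally, an element is determined by the images of the simple roots. -/
theorem finite_weylGroup : (D.rootDatum.weylGroup : Set (D.L ≃ₗ[ℤ] D.L)).Finite := by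
  set A : Set D.L := {y | y.1 = 0 ∧ D.toAmbient y.2 ∈ Set.range P.root} with hA
  have hAfin : A.Finite := by
    have h1 : (D.toAmbient ⁻¹' Set.range P.root).Finite :=
      (Set.finite_range _).preimage D.toAmbient_injective.injOn
    refine (h1.image fun x => ((0, x) : D.L)).subset ?_
    rintro ⟨c, x⟩ ⟨h2, h3⟩
    exact ⟨x, h3, Prod.ext h2.symm rfl⟩
  have hgen : ∀ i, ∀ y ∈ A, D.rootDatum.reflection i y ∈ A := by
    rintro i ⟨c, x⟩ ⟨h1, j, h2⟩
    obtain rfl : c = 0 := h1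
    obtain ⟨y, h3, h4⟩ := D.toAmbient_reflection i x
    rw [h3]
    exact ⟨rfl, P.reflectionPerm (D.vertex i) j, by
      rw [RootPairing.root_reflectionPerm, h4]
      exact congrArg _ h2⟩
  have hW : ∀ w ∈ D.rootDatum.weylGroup, (∀ y ∈ A, w y ∈ A) ∧ ∀ y ∈ A, w⁻¹ y ∈ A := by
    intro w hw
    refine Subgroup.closure_induction
      (p := fun w _ => (∀ y ∈ A, w y ∈ A) ∧ ∀ y ∈ A, w⁻¹ y ∈ A) ?_ ?_ ?_ ?_ hw
    · rintro _ ⟨i, rfl⟩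
      rw [LabelShape.reflection_inv]
      exact ⟨hgen i, hgen i⟩
    · exact ⟨fun y hy => hy, fun y hy => hy⟩
    · intro w w' _ _ h h'
      rw [mul_inv_rev]
      exact ⟨fun y hy => h.1 _ (h'.1 y hy), fun y hy => h'.2 _ (h.2 y hy)⟩
    · intro w _ h
      rw [inv_inv]
      exact ⟨h.2, h.1⟩
  have halpha : ∀ i, D.alpha i ∈ A := fun i =>
    ⟨rfl, D.vertex i, (D.toAmbient_single i).symm⟩
  have : Finite A := hAfin
  let F : D.rootDatum.weylGroup → (D.Vert → A) := fun w i =>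
    ⟨w.1 (D.alpha i), (hW w.1 w.2).1 _ (halpha i)⟩
  have hF : Function.Injective F := by
    rintro ⟨w, hw⟩ ⟨w', hw'⟩ h
    have h1 : ∀ i, w (D.alpha i) = w' (D.alpha i) := fun i => by
      have := congrFun h i
      exact congrArg Subtype.val this
    refine Subtype.ext (LinearEquiv.ext fun x => ?_)
    -- The coefficient of `ε` in `DeltaL` is `n0`, so multiplication by `n0` brings `L` into the
    -- span of `DeltaL` and the simple roots; `L` is torsion-free, so nothing is lost.
    have h2 : (D.n0 : ℤ) • x = x.1 • D.DeltaL +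
        ∑ i, ((D.n0 : ℤ) * x.2 i - x.1 * D.n (some i)) • D.alpha i := by
      rw [LabelShape.DeltaL_eq]
      ext i
      · simp [LabelShape.alpha, Prod.fst_sum, -Fintype.sum_sum_type, mul_comm]
      · simp [LabelShape.alpha, Prod.snd_sum, -Fintype.sum_sum_type, Pi.single_apply]
    have h3 : w ((D.n0 : ℤ) • x) = w' ((D.n0 : ℤ) • x) := by
      rw [h2]
      simp only [map_add, map_smul, map_sum, h1, D.weylGroup_DeltaL hw, D.weylGroup_DeltaL hw']
    rw [map_smul, map_smul] at h3
    have h4 : (D.n0 : ℤ) ≠ 0 := by exact_mod_cast D.n0_pos.ne'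
    exact smul_right_injective _ h4 h3
  exact Finite.of_injective F hF

theorem finite_truncOrbit (s : D.Seq) : (D.truncOrbit s).Finite := by
  refine (D.finite_weylGroup.image fun w => D.act w s).subset fun t ht => ?_
  induction ht with
  | refl =>
    refine ⟨1, one_mem _, funext fun j => ?_⟩
    exact D.char_delta s j
  | tail _ h ih =>
    obtain ⟨w, hw, rfl⟩ := ih
    obtain ⟨i, hi⟩ := h
    obtain ⟨-, rfl⟩ := LabelShape.truncCoeff_eq_of_trunc hi
    refine ⟨D.rootDatum.reflection i * w, mul_mem (Subgroup.subset_closure ⟨i, rfl⟩) hw,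
      funext fun j => ?_⟩
    change D.char s ((D.rootDatum.reflection i * w)⁻¹ _) = D.char _ _
    rw [LabelShape.char_act, mul_inv_rev]
    rfl

/-! ### The bijection between the calibrated spectrum and the admissible tableaux -/

/-- `C` acts on `V_O` by the scalar `c`, and a morphism descends exactly when it sends `C` to `1`;
the element `s ∈ O` makes `V_O` nonzero, so that the scalar can be read off. -/
theorem exists_rep_factor_iff {O : Set D.Seq} (hO : LabelShape.TruncClosed O)
    (hg : ∀ s ∈ O, D.Good s) {c : Kˣ} (hc : ∀ s ∈ O, D.Delta s = c) {s : D.Seq} (hs : s ∈ O) :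
    (∃ ρbar : D.Hbar →ₐ[K] Module.End K (O →₀ K),
      ρbar.comp D.proj = LabelShape.rep hO hg) ↔ D.Delta s = 1 := by
  have hC := LabelShape.rep_centralC hO hg hc
  constructor
  · rintro ⟨ρbar, h⟩
    rw [← h, AlgHom.comp_apply, proj_centralC, map_one] at hC
    have h1 := congrArg (fun f : Module.End K (O →₀ K) => f (Finsupp.single ⟨s, hs⟩ 1) ⟨s, hs⟩) hC
    rw [hc s hs]
    ext
    simpa [Module.algebraMap_end_apply] using h1.symm
  · intro h
    refine D.exists_comp_proj (A := Module.End K (O →₀ K)) (LabelShape.rep hO hg) ?_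
    rw [hC, ← hc s hs, h, Units.val_one, map_one]

/-- Pulled back to `H(R,v)`, the representation has every element of the truncated orbit as a
weight, so the orbit is good and comes from an admissible tableau. `Δ = 1` because `φ` kills
`DeltaL`. -/
theorem exists_tableau {χ : AddChar D.Lbar Kˣ} (hχ : χ ∈ D.rootDatumBar.calibratedSpectrum) :
    ∃ T ∈ D.ASTabBar, ∀ j, χ (D.phi (D.delta j)) = T.seq j := by
  obtain ⟨V, _, _, _, ρ, hd, u, hu0, hu⟩ := hχ
  set s : D.Seq := fun j => χ (D.phi (D.delta j)) with hs
  have hchar : ∀ x, D.char s x = χ (D.phi x) := fun x =>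
    congrArg (fun χ' : AddChar D.L Kˣ => χ' x)
      (D.char_of_delta (χ.compAddMonoidHom D.phi.toAddMonoidHom))
  have hρ : ∀ x, (ρ.comp D.proj) (D.rootDatum.X x) = ρ (D.rootDatumBar.X (D.phi x)) :=
    fun x => by rw [AlgHom.comp_apply, proj_X]
  have hd' : ∀ x, ⨆ μ : K,
      Module.End.eigenspace ((ρ.comp D.proj) (D.rootDatum.X x)) μ = ⊤ := fun x => by
    rw [hρ]
    exact hd _
  have hw : RootDatum.IsWeightVector (ρ.comp D.proj) (D.char s) u :=
    ⟨hu0, fun x => by rw [hρ, hu, hchar]⟩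
  obtain ⟨T, hT, hTs⟩ := LabelShape.STab.exists_admissible (s := s) fun t ht => by
    obtain ⟨u', hu'⟩ := LabelShape.exists_isWeightVector hd' hw ht
    exact LabelShape.good_of_isWeightVector hd' hu'
  refine ⟨T, ⟨hT, ?_⟩, fun j => by rw [hTs]⟩
  rw [hTs, LabelShape.Delta_eq_char, hchar, phi_DeltaL, AddChar.map_zero_eq_one]

/-- `V_O` for the truncated orbit `O` of the tableau is the witness: it descends since `Δ = 1`, is
finite-dimensional since `O` is finite, and its basis diagonalizes all `X^x`. -/
theorem exists_mem_calibratedSpectrum {T : D.STab} (hT : T ∈ D.ASTabBar) :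
    ∃ χ ∈ D.rootDatumBar.calibratedSpectrum, ∀ j, χ (D.phi (D.delta j)) = T.seq j := by
  obtain ⟨χ, hχ⟩ := D.exists_char_phi hT.2
  refine ⟨χ, ?_, fun j => by rw [hχ, LabelShape.char_delta]⟩
  set O := D.truncOrbit T.seq with hO
  have hcl : LabelShape.TruncClosed O := LabelShape.truncClosed_truncOrbit _
  have hg : ∀ t ∈ O, D.Good t := LabelShape.IsAdmissibleOrbit.good ⟨T, hT.1, rfl⟩
  have hs : T.seq ∈ O := LabelShape.mem_truncOrbit_self _
  obtain ⟨ρ, hρ⟩ := (D.exists_rep_factor_iff hcl hg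
    (fun t ht => D.Delta_eq_of_mem_truncOrbit ht) hs).2 hT.2
  have hX : ∀ x, ρ (D.rootDatumBar.X (D.phi x)) = LabelShape.diagX O x := fun x => by
    rw [← LabelShape.rep_X hcl hg, ← hρ, AlgHom.comp_apply, proj_X]
  have : Finite O := D.finite_truncOrbit T.seq
  refine ⟨O →₀ K, inferInstance, inferInstance, inferInstance, ρ, fun y => ?_,
    LabelShape.vec O T.seq, ?_, fun y => ?_⟩
  · obtain ⟨x, rfl⟩ := D.phi_surjective y
    rw [hX, eq_top_iff]
    rintro f -
    induction f using Finsupp.induction_linear with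
    | zero => exact Submodule.zero_mem _
    | add f f' hf hf' => exact Submodule.add_mem _ hf hf'
    | single t a =>
      have : (Finsupp.single t a : O →₀ K) = a • LabelShape.vec O t.1 := by
        rw [LabelShape.vec_of_mem t.2, Finsupp.smul_single, smul_eq_mul, mul_one]
      rw [this]
      exact Submodule.smul_mem _ _ (Submodule.mem_iSup_of_mem (D.char t.1 x : K)
        (Module.End.mem_eigenspace_iff.2 (LabelShape.diagX_vec x t.1)))
  · rw [LabelShape.vec_of_mem hs]
    simp
  · obtain ⟨x, rfl⟩ := D.phi_surjective y
    rw [hX, LabelShape.diagX_vec, hχ]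

theorem exists_spectrum_equiv : ∃ e : D.rootDatumBar.calibratedSpectrum ≃ D.ASTabBar,
    ∀ (χ : D.rootDatumBar.calibratedSpectrum) (j : Option D.Vert),
      χ.1 (D.phi (D.delta j)) = (e χ).1.seq j := by
  choose F hF hFs using fun χ : D.rootDatumBar.calibratedSpectrum => D.exists_tableau χ.2
  have hinj : ∀ χ χ' : AddChar D.Lbar Kˣ,
      (∀ j, χ (D.phi (D.delta j)) = χ' (D.phi (D.delta j))) → χ = χ' := by
    intro χ χ' h
    ext1 y
    obtain ⟨x, rfl⟩ := D.phi_surjective y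
    have h1 := D.char_of_delta (χ.compAddMonoidHom D.phi.toAddMonoidHom)
    have h2 := D.char_of_delta (χ'.compAddMonoidHom D.phi.toAddMonoidHom)
    have h3 : χ.compAddMonoidHom D.phi.toAddMonoidHom =
        χ'.compAddMonoidHom D.phi.toAddMonoidHom := by
      rw [← h1, ← h2]
      exact congrArg D.char (funext h)
    exact congrArg (fun ψ : AddChar D.L Kˣ => ψ x) h3
  refine ⟨Equiv.ofBijective (fun χ => ⟨F χ, hF χ⟩) ⟨fun χ χ' h => ?_, fun T => ?_⟩, hFs⟩
  · refine Subtype.ext (hinj _ _ fun j => ?_)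
    have h1 : F χ = F χ' := congrArg Subtype.val h
    rw [hFs, hFs, h1]
  · obtain ⟨χ, hχ, h⟩ := D.exists_mem_calibratedSpectrum T.2
    refine ⟨⟨χ, hχ⟩, Subtype.ext (LabelShape.STab.seq_injective (funext fun j => ?_))⟩
    exact (hFs ⟨χ, hχ⟩ j).symm.trans (h j)

end Labelling
end Calibrated

end

theorem proposition6p5 {ι M N : Type*} [Finite ι] [AddCommGroup M] [Module ℝ M]
    [AddCommGroup N] [Module ℝ N] (P : RootPairing ι ℝ M N) [P.IsRootSystem]
    [P.IsCrystallographic] [P.IsReduced] [P.IsIrreducible] (b : P.Base) (v : b.support)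
    (D : Calibrated.Labelling b v) :
    (Function.Surjective D.proj ∧
      TwoSidedIdeal.ker D.proj = TwoSidedIdeal.span {D.centralC - 1}) ∧
    (∀ w ∈ D.rootDatum.weylGroup, ∀ s : D.Seq, D.Delta (D.act w s) = D.Delta s) ∧
    (∀ O : Set D.Seq, D.IsAdmissibleOrbit O →
      ∃ ρ : D.H →ₐ[Calibrated.K] Module.End Calibrated.K (O →₀ Calibrated.K),
        (∀ i, ρ (D.rootDatum.g i) = D.opG O i) ∧
        (∀ j, ρ (D.rootDatum.X (D.delta j)) = D.opX O j) ∧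
        ∀ s ∈ O,
          (∃ ρbar : D.Hbar →ₐ[Calibrated.K] Module.End Calibrated.K (O →₀ Calibrated.K),
            ρbar.comp D.proj = ρ) ↔ D.Delta s = 1) ∧
    (∃ e : D.rootDatumBar.calibratedSpectrum ≃ D.ASTabBar,
      ∀ (χ : D.rootDatumBar.calibratedSpectrum) (j : Option D.Vert),
        χ.1 (D.phi (D.delta j)) = (e χ).1.seq j) := by
  refine ⟨⟨D.proj_surjective, D.ker_proj⟩, fun w hw s => D.Delta_act hw s, fun O hO => ?_,
    D.exists_spectrum_equiv⟩
  have hg := hO.good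
  obtain ⟨T, hT, rfl⟩ := hO
  have hcl := Calibrated.LabelShape.truncClosed_truncOrbit T.seq
  refine ⟨Calibrated.LabelShape.rep hcl hg, Calibrated.LabelShape.rep_g hcl hg, fun j => ?_,
    fun s hs => D.exists_rep_factor_iff hcl hg
      (fun t ht => D.Delta_eq_of_mem_truncOrbit ht) hs⟩
  rw [Calibrated.LabelShape.rep_X, Calibrated.LabelShape.opX_eq]
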